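/- A \emph{turn-based game} is played by Players $1$ and $2$ on a finite directed graph in which every vertex has an outgoing edge and is owned by one of the players; the owner of the current vertex moves the token along an edge. A \emph{bidding game with advantage-based tie-breaking} is played on a finite directed graph in which every vertex has an outgoing edge, with a total budget $N\in\mathbb N$. A configuration $\langle v,B_1,B_2,s\rangle$ consists of the position $v$ of the token, the budgets $B_1,B_2\in\mathbb N$ with $B_1+B_2=N$, and the player $s\in\{1,2\}$ who holds the advantage. In each turn the players simultaneously bid integers $b_i\in\{0,\dots,B_i\}$. The higher bidder wins the bidding, pays his bid to the opponent and moves the token along an edge. If $b_1=b_2$, Player $s$ chooses, knowing the bids, who wins the bidding: he either wins it and passes the advantage to the opponent, or lets the opponent win it and keeps the advantage. Let $\alpha$ be one of the qualitative objectives (for Player $1$) reachability, B\"uchi, parity, and M\"uller. A game with vertex set $V$ is equipped with a set $T\subseteq V$ that the infinite path of the token has to visit (reachability) or to visit infinitely often (B\"uchi); with a function $p:V\to\{1,2,\dots\}$ such that the largest value of $p$ on the vertices visited infinitely often has to be odd (parity); or with a colouring $\chi:V\to C$, $C$ finite, and a list $\mathcal F$ of subsets of $C$, such that the set of colours of the vertices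 visited infinitely often has to be in $\mathcal F$ (M\"uller). Let TB-WIN$_\alpha$ be the problem to decide, given a turn-based game with objective $\alpha$ and a vertex $v$, whether Player $1$ has a winning strategy from $v$. Let BID-WIN$_{\alpha,\mathrm{adv}}$ be the problem to decide, given a bidding game with advantage-based tie-breaking and objective $\alpha$, with budgets written in unary, and a configuration $c$, whether Player $1$ has a winning strategy from $c$. (Strategies are deterministic and may depend on the whole history. Graphs are given by adjacency matrices, colours and priorities are written in unary, and $\mathcal F$ is given as a list of bit vectors indexed by $C$.) \textbf{Theorem.} For each of these objectives $\alpha$, the complexities of TB-WIN$_\alpha$ and BID-WIN$_{\alpha,\mathrm{adv}}$ coincide: each of the two problems has a polynomial-time many-one reduction to the other one. Moreover, the reduction from TB-WIN$_\alpha$ to BID-WIN$_{\alpha,\mathrm{adv}}$ can be chosen such that, in every bidding game that it produces, the total budget is $0$ and there are two distinct sinks $t_1,t_2$ (vertices whose only outgoing edge is a self-loop), where every configuration on $t_i$ is winning for Player $i$, which force the holder of the advantage to use it: the initial vertex is not a sink, and the vertices other than $t_1,t_2$ can be assigned to the players such that the initial vertex is assigned to the initial holder of the advantage, every edge between two of these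 vertices leads from a vertex of one player to a vertex of the other player, and a vertex assigned to Player $i$ has an edge to $t_{3-i}$ but none to $t_i$. -/

import Mathlib

namespace BidGame

/-! ### Players and concurrent games -/

inductive Player where
  | one
  | two
  deriving DecidableEq

/-- The opponent of a player. -/
def Player.other : Player → Player
  | .one => .two
  | .two => .one

/-- The component of a pair that belongs to Player `i`. -/
def Player.pick {A : Type} (i : Player) (a₁ a₂ : A) : A :=
  match i with
  | .one => a₁
  | .two => a₂

/-- The arena of a concurrent game with actions `A` and vertices `V`: the nonempty set of actions
that each player may use in each vertex, and the transition function. -/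
structure Arena (A V : Type) where
  allowed : V → Player → Set A
  allowed_nonempty : ∀ v i, (allowed v i).Nonempty
  next : V → A → A → V

/-- A strategy maps a history, i.e. a sequence of triples (vertex, action of Player 1, action of
Player 2) followed by the current vertex, to an action. -/
abbrev Strategy (A V : Type) : Type := List (V × A × A) → V → A

namespace Arena

variable {A V : Type} (G : Arena A V)

/-- Legal strategies of Player `i` use allowed actions only. -/
def Legal (i : Player) (s : Strategy A V) : Prop := ∀ h v, s h v ∈ G.allowed v i

/-- The history (past triples and current vertex) after `m` turns. -/
def history (s₁ s₂ : Strategy A V) (v₀ : V) : ℕ → List (V × A × A) × V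
  | 0 => ([], v₀)
  | m + 1 =>
    let p := history s₁ s₂ v₀ m
    let a₁ := s₁ p.1 p.2
    let a₂ := s₂ p.1 p.2
    (p.1 ++ [(p.2, a₁, a₂)], G.next p.2 a₁ a₂)

/-- The path that corresponds to the play of two strategies from `v₀`. -/
def path (s₁ s₂ : Strategy A V) (v₀ : V) (m : ℕ) : V := (G.history s₁ s₂ v₀ m).2

/-- Player `i` has a winning strategy from `v`, where `α` is the objective of Player 1. -/
def Wins (α : Set (ℕ → V)) (i : Player) (v : V) : Prop :=
  match i with
  | .one => ∃ s₁, G.Legal .one s₁ ∧ ∀ s₂, G.Legal .two s₂ → G.path s₁ s₂ v ∈ α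
  | .two => ∃ s₂, G.Legal .two s₂ ∧ ∀ s₁, G.Legal .one s₁ → G.path s₁ s₂ v ∉ α

/-- Player `i` controls `v`: his allowed actions determine the next vertex. -/
def Controls (i : Player) (v : V) : Prop :=
  ∀ a ∈ G.allowed v i, ∃ u, ∀ a' ∈ G.allowed v i.other,
    G.next v (i.pick a a') (i.pick a' a) = u

/-- Turn-based: every vertex is controlled by one of the players. -/
def IsTurnBased : Prop := ∀ v, ∃ i, G.Controls i v

end Arena

/-! ### Objectives -/

/-- The vertices that a path visits infinitely often. -/
def infSet {V : Type} (π : ℕ → V) : Set V := {v | ∃ᶠ m in Filter.atTop, π m = v}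

/-- The four qualitative objectives. -/
inductive Objective where
  | reachability
  | buchi
  | parity
  | muller

/-- A Müller condition on `n` vertices: a colouring of the vertices together with an explicit
list of accepting sets of colours. -/
structure MullerCondition (n : ℕ) where
  colors : ℕ
  color : Fin n → Fin colors
  family : List (Finset (Fin colors))

/-- What a game with `n` vertices is equipped with, for each of the objectives: a set of target
(resp. accepting) vertices, a function to positive priorities, or a Müller condition. -/
def Condition : Objective → ℕ → Type
  | .reachability, n => Finset (Fin n)
  | .buchi, n => Finset (Fin n)
  | .parity, n => Fin n → ℕ+
  | .muller, n => MullerCondition n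

/-- The paths that are winning for Player 1. -/
def Condition.paths {n : ℕ} : {k : Objective} → Condition k n → Set (ℕ → Fin n)
  | .reachability, T => {π | ∃ m, π m ∈ (show Finset (Fin n) from T)}
  | .buchi, T => {π | ∃ᶠ m in Filter.atTop, π m ∈ (show Finset (Fin n) from T)}
  | .parity, p => {π | ∃ v ∈ infSet π, Odd ((show Fin n → ℕ+ from p) v : ℕ) ∧
      ∀ u ∈ infSet π, (show Fin n → ℕ+ from p) u ≤ (show Fin n → ℕ+ from p) v}
  | .muller, M => {π | ∃ S ∈ MullerCondition.family M,
      (S : Set (Fin (MullerCondition.colors M))) = MullerCondition.color M '' infSet π}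

/-! ### Turn-based games -/

/-- A turn-based game with objective `k`: a finite graph without dead ends, whose vertices are
partitioned between the players. -/
structure TurnBasedGame (k : Objective) where
  n : ℕ
  edge : Fin n → Fin n → Bool
  no_dead_end : ∀ v, ∃ u, edge v u = true
  owner : Fin n → Player
  cond : Condition k n

namespace TurnBasedGame

variable {k : Objective} (G : TurnBasedGame k)

/-- The owner of the vertex chooses a neighbor; the other player's action has no effect. -/
def arena : Arena (Fin G.n) (Fin G.n) where
  allowed v i := if i = G.owner v then {u | G.edge v u = true} else Set.univ
  allowed_nonempty v i := by
    split_ifs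
    · exact G.no_dead_end v
    · exact ⟨v, trivial⟩
  next v a₁ a₂ := (G.owner v).pick a₁ a₂

theorem arena_isTurnBased : G.arena.IsTurnBased := by
  intro v
  refine ⟨G.owner v, fun a _ => ⟨a, fun a' _ => ?_⟩⟩
  cases h : G.owner v <;> simp [arena, h, Player.pick]

end TurnBasedGame

/-- An instance of the decision problem for turn-based games: a game and a vertex. -/
structure TBInstance (k : Objective) extends TurnBasedGame k where
  start : Fin n

/-- TB-WIN: can Player 1 win from the given vertex? -/
def TBWin {k : Objective} (x : TBInstance k) : Prop :=
  x.arena.Wins x.cond.paths .one x.start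

/-! ### Bidding games with advantage-based tie-breaking -/

/-- A configuration: the position of the token, the two budgets, which add up to `N`, and the
player who holds the advantage. -/
@[ext] structure Config (n N : ℕ) where
  vertex : Fin n
  budget : Player → ℕ
  total : budget .one + budget .two = N
  adv : Player

/-- The configuration after Player `w` has won a bidding with the bid `b`, has moved the token to
`u`, and Player `s` holds the advantage. Player `w` pays `b` to the opponent. (Legal bids never
exceed the budget, so that the minimum is `b`.) -/
def Config.update {n N : ℕ} (c : Config n N) (w : Player) (b : ℕ) (s : Player) (u : Fin n) :
    Config n N where
  vertex := u
  budget i := if i = w then c.budget i - min b (c.budget w) else c.budget i + min b (c.budget w)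
  total := by
    have h := c.total
    cases w <;> simp <;> omega
  adv := s

/-- The vertices of the concurrent game: configurations, intermediate vertices after both bids
have been revealed, and intermediate vertices after a tie with bid `b` that the holder of the
advantage has decided to lose. -/
inductive BidVertex (n N : ℕ) where
  | conf (c : Config n N)
  | bids (c : Config n N) (b₁ b₂ : Fin (N + 1))
  | yielded (c : Config n N) (b : Fin (N + 1))

/-- The actions: to bid, to win the bidding or to have won it and to move the token, and, for
the holder of the advantage after a tie, to call the other player the winner. -/
inductive BidAction (n N : ℕ) where
  | bid (b : Fin (N + 1))
  | move (u : Fin n)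
  | yield

/-- The player with the strictly higher bid, if there is one. -/
def higherBidder (b₁ b₂ : ℕ) : Option Player :=
  if b₂ < b₁ then some .one else if b₁ < b₂ then some .two else none

/-- A bidding game with objective `k` and advantage-based tie-breaking: a finite graph without
dead ends and the total budget `N`. -/
structure BiddingGame (k : Objective) where
  n : ℕ
  edge : Fin n → Fin n → Bool
  no_dead_end : ∀ v, ∃ u, edge v u = true
  N : ℕ
  cond : Condition k n

namespace BiddingGame

variable {k : Objective} (G : BiddingGame k)

/-- Moving the token from `v` along an edge. -/
def moves (v : Fin G.n) : Set (BidAction G.n G.N) := {a | ∃ u, G.edge v u = true ∧ a = .move u}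

/-- In a configuration both players bid at most their budgets. An intermediate vertex is
controlled by one player, and all actions are allowed to the other one. -/
def allowed : BidVertex G.n G.N → Player → Set (BidAction G.n G.N)
  | .conf c, i => {a | ∃ b : Fin (G.N + 1), (b : ℕ) ≤ c.budget i ∧ a = .bid b}
  | .bids c b₁ b₂, i =>
    match higherBidder b₁ b₂ with
    | some w => if i = w then G.moves c.vertex else Set.univ
    | none => if i = c.adv then insert .yield (G.moves c.vertex) else Set.univ
  | .yielded c _, i => if i = c.adv.other then G.moves c.vertex else Set.univ

/-- Transitions; the last case of each `match` concerns actions that are not allowed. After a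
tie, the holder of the advantage either moves, and thereby wins the bidding and passes the
advantage, or lets the other player win the bidding and keeps the advantage. -/
def next : BidVertex G.n G.N → BidAction G.n G.N → BidAction G.n G.N → BidVertex G.n G.N
  | .conf c, a₁, a₂ =>
    match a₁, a₂ with
    | .bid b₁, .bid b₂ => .bids c b₁ b₂
    | _, _ => .conf c
  | .bids c b₁ b₂, a₁, a₂ =>
    match higherBidder b₁ b₂ with
    | some w =>
      match w.pick a₁ a₂ with
      | .move u => .conf (c.update w (w.pick b₁ b₂ : Fin (G.N + 1)) c.adv u)
      | _ => .bids c b₁ b₂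
    | none =>
      match c.adv.pick a₁ a₂ with
      | .move u => .conf (c.update c.adv b₁ c.adv.other u)
      | .yield => .yielded c b₁
      | _ => .bids c b₁ b₂
  | .yielded c b, a₁, a₂ =>
    match c.adv.other.pick a₁ a₂ with
    | .move u => .conf (c.update c.adv.other b c.adv u)
    | _ => .yielded c b

theorem moves_nonempty (v : Fin G.n) : (G.moves v).Nonempty := by
  obtain ⟨u, hu⟩ := G.no_dead_end v
  exact ⟨_, u, hu, rfl⟩

theorem allowed_nonempty (x : BidVertex G.n G.N) (i : Player) : (G.allowed x i).Nonempty := by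
  cases x with
  | conf c => exact ⟨.bid 0, 0, by simp, rfl⟩
  | bids c b₁ b₂ =>
    simp only [allowed]
    split
    · split_ifs
      · exact G.moves_nonempty _
      · exact ⟨.yield, trivial⟩
    · split_ifs
      · exact ⟨.yield, Or.inl rfl⟩
      · exact ⟨.yield, trivial⟩
  | yielded c b =>
    simp only [allowed]
    split_ifs
    · exact G.moves_nonempty _
    · exact ⟨.yield, trivial⟩

/-- The concurrent game that gives the semantics of the bidding game. -/
def arena : Arena (BidAction G.n G.N) (BidVertex G.n G.N) where
  allowed := G.allowed
  allowed_nonempty := G.allowed_nonempty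
  next := G.next

/-- Intermediate vertices do not contribute to the objective: a path `π` of the concurrent game
is winning for Player 1 iff the path `ρ` of the token is, where `φ` enumerates the positions
of the configurations in `π` in increasing order. -/
def objective : Set (ℕ → BidVertex G.n G.N) :=
  {π | ∃ ρ ∈ G.cond.paths, ∃ φ : ℕ → ℕ, StrictMono φ ∧
    Set.range φ = {m | ∃ c, π m = .conf c} ∧
    ∀ j, ∃ c, π (φ j) = .conf c ∧ c.vertex = ρ j}

/-- Player `i` has a winning strategy from the configuration `c`. -/
def WinsFrom (i : Player) (c : Config G.n G.N) : Prop := G.arena.Wins G.objective i (.conf c)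

end BiddingGame

/-- An instance of the decision problem for bidding games: a game and a configuration. -/
structure BidInstance (k : Objective) extends BiddingGame k where
  start : Config n N

/-- BID-WIN: can Player 1 win from the given configuration? -/
def BidWin {k : Objective} (x : BidInstance k) : Prop := x.WinsFrom .one x.start

/-- All budgets are zero, and two sinks `t .one` and `t .two`, of which `t i` is winning for Player
`i`, force the holder of the advantage to use it: the remaining vertices are assigned alternately
to the players, initially to the holder of the advantage, and each has an edge to the sink that is
winning for the opponent of the player it is assigned to (and none to the other sink). -/
def ForcesAdvantage {k : Objective} (x : BidInstance k) : Prop :=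
  x.N = 0 ∧ ∃ (t : Player → Fin x.n) (o : Fin x.n → Player),
    t .one ≠ t .two ∧
    (∀ i u, x.edge (t i) u = true ↔ u = t i) ∧
    (∀ i (c : Config x.n x.N), c.vertex = t i → x.WinsFrom i c) ∧
    x.start.vertex ∉ Set.range t ∧ o x.start.vertex = x.start.adv ∧
    ∀ v, v ∉ Set.range t →
      (∀ i, x.edge v (t i) = true ↔ i = (o v).other) ∧
      ∀ u, u ∉ Set.range t → x.edge v u = true → o u = (o v).other

/-! ### Encoding of instances as bit strings

An instance is listed as a sequence of natural numbers, each of which is written in unary. -/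

def bit (p : Prop) [Decidable p] : ℕ := if p then 1 else 0

def unary (l : List ℕ) : List Bool := l.flatMap fun m => List.replicate m true ++ [false]

/-- A table of `n` entries. -/
def tableNats {n : ℕ} (f : Fin n → ℕ) : List ℕ := List.ofFn f

/-- The adjacency matrix, row by row. -/
def edgeNats {n : ℕ} (e : Fin n → Fin n → Bool) : List ℕ :=
  (List.finRange n).flatMap fun v => tableNats fun u => bit (e v u = true)

def Condition.nats {n : ℕ} : {k : Objective} → Condition k n → List ℕ
  | .reachability, T => tableNats fun v => bit (v ∈ (show Finset (Fin n) from T))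
  | .buchi, T => tableNats fun v => bit (v ∈ (show Finset (Fin n) from T))
  | .parity, p => tableNats fun v => ((show Fin n → ℕ+ from p) v : ℕ)
  | .muller, M =>
    [MullerCondition.colors M, (MullerCondition.family M).length] ++
    (tableNats fun v => (MullerCondition.color M v : ℕ)) ++
    (MullerCondition.family M).flatMap fun S => tableNats fun c => bit (c ∈ S)

def TBInstance.nats {k : Objective} (x : TBInstance k) : List ℕ :=
  [x.n, (x.start : ℕ)] ++ (tableNats fun v => bit (x.owner v = .two)) ++ edgeNats x.edge ++
    x.cond.nats

def TBInstance.encode {k : Objective} (x : TBInstance k) : List Bool := unary x.nats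

def BidInstance.nats {k : Objective} (x : BidInstance k) : List ℕ :=
  [x.n, x.N, (x.start.vertex : ℕ), x.start.budget .one, x.start.budget .two,
    bit (x.start.adv = .two)] ++ edgeNats x.edge ++ x.cond.nats

def BidInstance.encode {k : Objective} (x : BidInstance k) : List Bool := unary x.nats

/-! The encodings are injective. -/

theorem bit_inj {p q : Prop} [Decidable p] [Decidable q] : bit p = bit q ↔ (p ↔ q) := by
  unfold bit
  split_ifs <;> simp_all

theorem replicate_sep_inj {a b : ℕ} {r s : List Bool}
    (h : List.replicate a true ++ false :: r = List.replicate b true ++ false :: s) :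
    a = b ∧ r = s := by
  induction a generalizing b with
  | zero => cases b <;> simp_all [List.replicate_succ]
  | succ a ih =>
    cases b with
    | zero => simp [List.replicate_succ] at h
    | succ b =>
      simp only [List.replicate_succ, List.cons_append, List.cons.injEq, true_and] at h
      exact ⟨congrArg _ (ih h).1, (ih h).2⟩

theorem unary_injective : Function.Injective unary := by
  intro l
  induction l with
  | nil => intro l' h; cases l' <;> simp_all [unary]
  | cons a l ih =>
    intro l' h
    cases l' with
    | nil => simp [unary] at h
    | cons b l' =>
      simp only [unary, List.flatMap_cons, List.append_assoc, List.singleton_append] at h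
      obtain ⟨h1, h2⟩ := replicate_sep_inj h
      rw [h1, ih h2]

theorem tableNats_injective {n : ℕ} : Function.Injective (tableNats (n := n)) :=
  List.ofFn_injective

@[simp] theorem length_tableNats {n : ℕ} (f : Fin n → ℕ) : (tableNats f).length = n := by
  simp [tableNats]

theorem flatMap_inj_fun {α : Type} {n : ℕ} {f g : α → List ℕ} (hf : ∀ a, (f a).length = n)
    (hg : ∀ a, (g a).length = n) (l : List α) (h : l.flatMap f = l.flatMap g) :
    ∀ a ∈ l, f a = g a := by
  induction l with
  | nil => simp
  | cons a l ih =>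
    rw [List.flatMap_cons, List.flatMap_cons] at h
    obtain ⟨h1, h2⟩ := List.append_inj h (by rw [hf, hg])
    simpa using And.intro h1 (ih h2)

theorem flatMap_inj_list {α : Type} {n : ℕ} {f : α → List ℕ} (hf : ∀ a, (f a).length = n)
    (hi : Function.Injective f) {l l' : List α} (hl : l.length = l'.length)
    (h : l.flatMap f = l'.flatMap f) : l = l' := by
  induction l generalizing l' with
  | nil => cases l' <;> simp_all
  | cons a l ih =>
    cases l' with
    | nil => simp at hl
    | cons b l' =>
      rw [List.flatMap_cons, List.flatMap_cons] at h
      obtain ⟨h1, h2⟩ := List.append_inj h (by rw [hf, hf])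
      rw [hi h1, ih (by simpa using hl) h2]

theorem edgeNats_injective {n : ℕ} : Function.Injective (edgeNats (n := n)) := by
  intro e e' h
  funext v u
  have h1 := flatMap_inj_fun (n := n) (by simp) (by simp) _ h v (List.mem_finRange v)
  have h2 := congrFun (tableNats_injective h1) u
  exact Bool.eq_iff_iff.2 (bit_inj.1 h2)

@[simp] theorem length_edgeNats {n : ℕ} (e : Fin n → Fin n → Bool) :
    (edgeNats e).length = n * n := by
  simp [edgeNats, List.length_flatMap]

theorem setNats_injective {n : ℕ} :
    Function.Injective fun S : Finset (Fin n) => tableNats fun v => bit (v ∈ S) := by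
  intro S T h
  ext v
  exact bit_inj.1 (congrFun (tableNats_injective h) v)

theorem Condition.nats_injective {k : Objective} {n : ℕ} :
    Function.Injective (Condition.nats (k := k) (n := n)) := by
  cases k with
  | reachability => exact setNats_injective
  | buchi => exact setNats_injective
  | parity =>
    intro p q h
    funext v
    exact PNat.coe_injective (congrFun (tableNats_injective h) v)
  | muller =>
    rintro ⟨c, f, F⟩ ⟨c', f', F'⟩ h
    simp only [Condition.nats, List.cons_append, List.nil_append, List.cons.injEq] at h
    obtain ⟨rfl, h2, h3⟩ := h
    obtain ⟨h4, h5⟩ := List.append_inj h3 (by simp)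
    have h6 : f = f' := funext fun v => Fin.val_injective (congrFun (tableNats_injective h4) v)
    have h7 : F = F' := flatMap_inj_list (n := c) (by simp) setNats_injective h2 h5
    rw [h6, h7]

theorem player_eq_of {p q : Player} (h : bit (p = .two) = bit (q = .two)) : p = q := by
  have := bit_inj.1 h
  cases p <;> cases q <;> simp_all

theorem TBInstance.encode_injective {k : Objective} :
    Function.Injective (TBInstance.encode (k := k)) := by
  rintro ⟨⟨n, e, d, o, c⟩, s⟩ ⟨⟨n', e', d', o', c'⟩, s'⟩ h
  have h := unary_injective h
  simp only [TBInstance.nats, List.cons_append, List.nil_append, List.cons.injEq,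
    List.append_assoc] at h
  obtain ⟨rfl, h2, h3⟩ := h
  obtain ⟨h4, h5⟩ := List.append_inj h3 (by simp)
  obtain ⟨h6, h7⟩ := List.append_inj h5 (by simp)
  have ho : o = o' := funext fun v => player_eq_of (congrFun (tableNats_injective h4) v)
  have hs : s = s' := Fin.val_injective h2
  have he := edgeNats_injective h6
  have hc := Condition.nats_injective h7
  subst ho hs he hc
  rfl

theorem BidInstance.encode_injective {k : Objective} :
    Function.Injective (BidInstance.encode (k := k)) := by
  rintro ⟨⟨n, e, d, N, c⟩, s⟩ ⟨⟨n', e', d', N', c'⟩, s'⟩ h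
  have h := unary_injective h
  simp only [BidInstance.nats, List.cons_append, List.nil_append, List.cons.injEq] at h
  obtain ⟨rfl, rfl, h1, h2, h3, h4, h5⟩ := h
  obtain ⟨h6, h7⟩ := List.append_inj h5 (by simp)
  have hs : s = s' := by
    ext i
    · exact h1
    · cases i
      · exact h2
      · exact h3
    · exact player_eq_of h4
  have he := edgeNats_injective h6
  have hc := Condition.nats_injective h7
  subst hs he hc
  rfl

/-! ### Polynomial-time reductions -/

/-- `f` is a polynomial-time many-one reduction from the decision problem `P`, whose instances are
written as the bit strings `ea x`, to the decision problem `Q`. -/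
def IsPolyTimeReduction {α β : Type} (ea : α → List Bool) (eb : β → List Bool)
    (P : α → Prop) (Q : β → Prop) (f : α → β) : Prop :=
  Nonempty (Turing.TM2ComputableInPolyTime ea eb f) ∧ ∀ x, P x ↔ Q (f x)

end BidGame

/-!
Both reductions preserve the winner because only the existence of a winning strategy of Player 1
matters. Such a strategy is tested against all paths that Player 2 can produce, so it makes no
difference whether Player 2 sees an action of Player 1 before he chooses his own.

*Bidding games are turn-based games.* In `BiddingGame.toTurnBased`, Player 1 first reveals his bid,
then Player 2 bids, and then the winner of the bidding moves (after a tie, possibly after the holder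
of the advantage has passed). A node consists of a phase, the position of the token, the budget of
Player 1, the holder of the advantage and two bids. Since budgets are written in unary, there are
polynomially many nodes.

*Turn-based games are bidding games.* In `TurnBasedGame.toBidding`, the total budget is `0`, so that
every bidding is a tie and the holder of the advantage decides who moves. The vertices are the
places `(v, i)`, where `i` is meant to hold the advantage, and two sinks. If `i` lets the opponent win the
bidding, then the opponent moves to his own sink and wins; hence `i` moves, and the advantage passes
to the opponent. If `i` does not own `v`, he can only move to `(v, i.other)`.

In each case, plays of the two games correspond to each other up to stuttering: a turn of one game
takes several turns of the other one. `Arena.wins_one_iff` expresses a winning strategy of Player 1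
as a graph of states all of whose paths are winning, and `Arena.Wins.transfer` transports such a
graph along a stuttering simulation. It applies since the winning condition depends on the path of
the token only (`BiddingGame.winsFrom_iff`) and is invariant under stuttering
(`Condition.paths_stutterInvariant`); the sinks are absorbed into the condition by
`Condition.withSinks`. The four simulations are `BiddingGame.wins_toTurnBased`,
`BiddingGame.wins_of_toTurnBased`, `TurnBasedGame.toBidding_winsFrom` and
`TurnBasedGame.wins_of_toBidding`.

*Running time.* Each entry of the encoding of a constructed game is an arithmetic expression in loop
counters and entries of the input. A `StackProg.Gen` is such a description of a list of numbers, by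
nested loops with bounds of this kind. It is compiled to a structured program on finitely many
stacks, which is compiled to a Turing machine of type `Turing.FinTM2`. The values of the expressions
are polynomially bounded, and so are the running times (`StackProg.polyTime_of_gen`). It remains to
check that `BidGame.toTBGen` and `BidGame.toBidGen` generate the encodings of the constructed games
(`BidGame.eval_toTBGen`, `BidGame.eval_toBidGen`).
-/

/-! ### Structured programs on stacks, and their compilation to Turing machines -/

namespace StackProg

open Turing Function

/-- Structured programs on stacks of booleans that are indexed by natural numbers.
`drain k p q` pops stack `k` until it is empty, and runs `p` after popping `true` and `q` after
popping `false`; `top k p q r` runs `p`, `q` or `r` if stack `k` is empty, or has `true` or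
`false` on top. -/
inductive Prog where
  | skip
  | push (k : ℕ) (b : Bool)
  | pop (k : ℕ)
  | seq (p q : Prog)
  | drain (k : ℕ) (p q : Prog)
  | top (k : ℕ) (p q r : Prog)

/-- The contents of the stacks. -/
abbrev Store : Type := ℕ → List Bool

/-- `Exec p S t S'`: the program `p` leads from `S` to `S'` in at most `t` steps. -/
inductive Exec : Prog → Store → ℕ → Store → Prop
  | skip {S} : Exec .skip S 1 S
  | push {S k b} : Exec (.push k b) S 1 (update S k (b :: S k))
  | pop {S k} : Exec (.pop k) S 1 (update S k (S k).tail)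
  | seq {p q S t S' t' S''} : Exec p S t S' → Exec q S' t' S'' → Exec (.seq p q) S (t + t') S''
  | drain_nil {k p q S} : S k = [] → Exec (.drain k p q) S 1 S
  | drain_cons {k p q S b l t S' t' S''} : S k = b :: l →
      Exec (bif b then p else q) (update S k l) t S' → Exec (.drain k p q) S' t' S'' →
      Exec (.drain k p q) S (1 + t + t') S''
  | top_nil {k p q r S t S'} : S k = [] → Exec p S t S' → Exec (.top k p q r) S (1 + t) S'
  | top_cons {k p q r S b l t S'} : S k = b :: l → Exec (bif b then q else r) S t S' →
      Exec (.top k p q r) S (1 + t) S'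
  | mono {p S t S' t'} : Exec p S t S' → t ≤ t' → Exec p S t' S'

namespace Prog

/-- A bound on the stacks that a program uses. -/
def bound : Prog → ℕ
  | skip => 0
  | push k _ => k
  | pop k => k
  | seq p q => max p.bound q.bound
  | drain k p q => max k (max p.bound q.bound)
  | top k p q r => max k (max p.bound (max q.bound r.bound))

/-- The control points of a program. -/
def Lab : Prog → Type
  | skip => Unit
  | push _ _ => Unit
  | pop _ => Unit
  | seq p q => p.Lab ⊕ q.Lab
  | drain _ p q => Option (p.Lab ⊕ q.Lab)
  | top _ p q r => Option (p.Lab ⊕ q.Lab ⊕ r.Lab)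

theorem finite_lab : ∀ p : Prog, Finite p.Lab
  | skip => inferInstanceAs (Finite Unit)
  | push _ _ => inferInstanceAs (Finite Unit)
  | pop _ => inferInstanceAs (Finite Unit)
  | seq p q => by
    have := p.finite_lab; have := q.finite_lab
    exact inferInstanceAs (Finite (p.Lab ⊕ q.Lab))
  | drain _ p q => by
    have := p.finite_lab; have := q.finite_lab
    exact inferInstanceAs (Finite (Option (p.Lab ⊕ q.Lab)))
  | top _ p q r => by
    have := p.finite_lab; have := q.finite_lab; have := r.finite_lab
    exact inferInstanceAs (Finite (Option (p.Lab ⊕ q.Lab ⊕ r.Lab)))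

/-- The control point at which a program starts. -/
def entry : (p : Prog) → p.Lab
  | skip => ()
  | push _ _ => ()
  | pop _ => ()
  | seq p _ => Sum.inl p.entry
  | drain _ _ _ => (none : Option _)
  | top _ _ _ _ => (none : Option _)

/-- The machine statement at each control point of a program, as part of a machine whose labels
are obtained from the control points by `emb`, and which goes on at the label `exit`. The state
of the machine holds the symbol that has been read last. -/
def code (m : ℕ) : (p : Prog) → {Λ : Type} → (p.Lab → Λ) → Λ → p.Lab →
    TM2.Stmt (fun _ : Fin (m + 1) => Bool) Λ (Option Bool)
  | skip, _, _, exit, _ => .goto fun _ => exit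
  | push k b, _, _, exit, _ => .push (Fin.ofNat (m + 1) k) (fun _ => b) (.goto fun _ => exit)
  | pop k, _, _, exit, _ => .pop (Fin.ofNat (m + 1) k) (fun v _ => v) (.goto fun _ => exit)
  | seq p q, _, emb, _, Sum.inl l => p.code m (fun x => emb (Sum.inl x)) (emb (Sum.inr q.entry)) l
  | seq _ q, _, emb, exit, Sum.inr l => q.code m (fun x => emb (Sum.inr x)) exit l
  | drain k p q, _, emb, exit, none =>
    .pop (Fin.ofNat (m + 1) k) (fun _ o => o) (.goto fun o => match o with
      | none => exit
      | some true => emb (some (Sum.inl p.entry))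
      | some false => emb (some (Sum.inr q.entry)))
  | drain _ p _, _, emb, _, some (Sum.inl l) =>
    p.code m (fun x => emb (some (Sum.inl x))) (emb none) l
  | drain _ _ q, _, emb, _, some (Sum.inr l) =>
    q.code m (fun x => emb (some (Sum.inr x))) (emb none) l
  | top k p q r, _, emb, _, none =>
    .peek (Fin.ofNat (m + 1) k) (fun _ o => o) (.goto fun o => match o with
      | none => emb (some (Sum.inl p.entry))
      | some true => emb (some (Sum.inr (Sum.inl q.entry)))
      | some false => emb (some (Sum.inr (Sum.inr r.entry))))
  | top _ p _ _, _, emb, exit, some (Sum.inl l) =>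
    p.code m (fun x => emb (some (Sum.inl x))) exit l
  | top _ _ q _, _, emb, exit, some (Sum.inr (Sum.inl l)) =>
    q.code m (fun x => emb (some (Sum.inr (Sum.inl x)))) exit l
  | top _ _ _ r, _, emb, exit, some (Sum.inr (Sum.inr l)) =>
    r.code m (fun x => emb (some (Sum.inr (Sum.inr x)))) exit l

end Prog

section Simulation

variable {m : ℕ} {Λ : Type}

/-- The machine configuration with label `l`, state `v`, and the first stacks of `S`. -/
def cfg (m : ℕ) {Λ : Type} (l : Option Λ) (v : Option Bool) (S : Store) :
    TM2.Cfg (fun _ : Fin (m + 1) => Bool) Λ (Option Bool) :=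
  ⟨l, v, fun i => S i⟩

/-- The machine reaches the second configuration from the first one in at most `t` steps. -/
def Steps (M : Λ → TM2.Stmt (fun _ : Fin (m + 1) => Bool) Λ (Option Bool)) (t : ℕ)
    (c c' : TM2.Cfg (fun _ : Fin (m + 1) => Bool) Λ (Option Bool)) : Prop :=
  ∃ n ≤ t, (flip bind (TM2.step M))^[n] (some c) = some c'

variable {M : Λ → TM2.Stmt (fun _ : Fin (m + 1) => Bool) Λ (Option Bool)}

theorem Steps.trans {t t' : ℕ} {c c' c''} (h : Steps M t c c') (h' : Steps M t' c' c'') :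
    Steps M (t + t') c c'' := by
  obtain ⟨n, hn, e⟩ := h
  obtain ⟨n', hn', e'⟩ := h'
  exact ⟨n' + n, by omega, by rw [Function.iterate_add_apply, e, e']⟩

theorem Steps.single {c c'} (h : TM2.step M c = some c') : Steps M 1 c c' :=
  ⟨1, le_rfl, by simpa [flip] using h⟩

theorem ofNat_val {k : ℕ} (hk : k ≤ m) : ((Fin.ofNat (m + 1) k : Fin (m + 1)) : ℕ) = k :=
  Nat.mod_eq_of_lt (Nat.lt_succ_of_le hk)

theorem update_restrict {k : ℕ} (hk : k ≤ m) (S : Store) (l : List Bool) :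
    (update (fun i : Fin (m + 1) => S i) (Fin.ofNat (m + 1) k) l) =
      fun i : Fin (m + 1) => update S k l i := by
  funext i
  by_cases h : i = Fin.ofNat (m + 1) k
  · subst h; rw [update_self, ofNat_val hk, update_self]
  · rw [update_of_ne h, update_of_ne]
    intro h'
    exact h (Fin.ext (by rw [ofNat_val hk, h']))

/-- A machine that contains the code of a program simulates its executions. -/
theorem Exec.steps {p : Prog} {S S' : Store} {t : ℕ} (h : Exec p S t S') (hp : p.bound ≤ m)
    (emb : p.Lab → Λ) (exit : Λ) (hM : ∀ l, M (emb l) = p.code m emb exit l) (v : Option Bool) :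
    ∃ v', Steps M t (cfg m (some (emb p.entry)) v S) (cfg m (some exit) v' S') := by
  induction h generalizing exit v with
  | skip =>
    refine ⟨v, Steps.single ?_⟩
    simp only [cfg, TM2.step, hM, Prog.code, TM2.stepAux]
  | push =>
    replace hp := show _ ≤ m from hp
    simp only [Prog.bound] at hp
    refine ⟨v, Steps.single ?_⟩
    simp only [cfg, TM2.step, hM, Prog.code, TM2.stepAux]
    rw [update_restrict hp, ofNat_val hp]
  | pop =>
    replace hp := show _ ≤ m from hp
    simp only [Prog.bound] at hp
    refine ⟨v, Steps.single ?_⟩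
    simp only [cfg, TM2.step, hM, Prog.code, TM2.stepAux]
    rw [update_restrict hp, ofNat_val hp]
  | @seq p q _ _ _ _ _ _ _ ih₁ ih₂ =>
    simp only [Prog.bound, max_le_iff] at hp
    obtain ⟨v', h₁⟩ := ih₁ hp.1 (fun x => emb (Sum.inl x)) (emb (Sum.inr q.entry))
      (fun l => hM (Sum.inl l)) v
    obtain ⟨v'', h₂⟩ := ih₂ hp.2 (fun x => emb (Sum.inr x)) exit (fun l => hM (Sum.inr l)) v'
    exact ⟨v'', h₁.trans h₂⟩
  | @drain_nil k p q S hS =>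
    simp only [Prog.bound, max_le_iff] at hp
    refine ⟨none, Steps.single ?_⟩
    have := hM none
    simp only [cfg, TM2.step, Prog.entry, this, Prog.code, TM2.stepAux]
    rw [update_restrict hp.1, ofNat_val hp.1]
    simp only [hS, List.tail_nil, List.head?_nil]
    rw [← hS, update_eq_self]
  | @drain_cons k p q S b l t S' t' S'' hS h₁ h₂ ih₁ ih₂ =>
    have hp' := hp
    simp only [Prog.bound, max_le_iff] at hp
    have h0 : Steps M 1 (cfg m (some (emb none)) v S)
        (cfg m (some (bif b then emb (some (Sum.inl p.entry)) else emb (some (Sum.inr q.entry))))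
          (some b) (update S k l)) := by
      refine Steps.single ?_
      have := hM none
      simp only [cfg, TM2.step, this, Prog.code, TM2.stepAux]
      rw [update_restrict hp.1, ofNat_val hp.1]
      simp only [hS, List.tail_cons, List.head?_cons]
      cases b <;> rfl
    have h3 : ∃ v', Steps M t (cfg m (some (bif b then emb (some (Sum.inl p.entry))
        else emb (some (Sum.inr q.entry)))) (some b) (update S k l))
        (cfg m (some (emb none)) v' S') := by
      cases b
      · exact ih₁ hp.2.2 (fun x => emb (some (Sum.inr x))) (emb none)
          (fun l => hM (some (Sum.inr l))) _
      · exact ih₁ hp.2.1 (fun x => emb (some (Sum.inl x))) (emb none)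
          (fun l => hM (some (Sum.inl l))) _
    obtain ⟨v', h3⟩ := h3
    obtain ⟨v'', h4⟩ := ih₂ hp' emb exit hM v'
    exact ⟨v'', (h0.trans h3).trans h4⟩
  | @top_nil k p q r S t S' hS h₁ ih₁ =>
    simp only [Prog.bound, max_le_iff] at hp
    obtain ⟨v', h3⟩ := ih₁ hp.2.1 (fun x => emb (some (Sum.inl x))) exit
      (fun l => hM (some (Sum.inl l))) none
    refine ⟨v', Steps.trans (Steps.single ?_) h3⟩
    have := hM none
    simp only [cfg, TM2.step, Prog.entry, this, Prog.code, TM2.stepAux]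
    rw [ofNat_val hp.1]
    simp only [hS, List.head?_nil]
  | @top_cons k p q r S b l t S' hS h₁ ih₁ =>
    simp only [Prog.bound, max_le_iff] at hp
    have h0 : Steps M 1 (cfg m (some (emb none)) v S)
        (cfg m (some (bif b then emb (some (Sum.inr (Sum.inl q.entry)))
          else emb (some (Sum.inr (Sum.inr r.entry))))) (some b) S) := by
      refine Steps.single ?_
      have := hM none
      simp only [cfg, TM2.step, this, Prog.code, TM2.stepAux]
      rw [ofNat_val hp.1]
      simp only [hS, List.head?_cons]
      cases b <;> rfl
    cases b
    · obtain ⟨v', h3⟩ := ih₁ hp.2.2.2 (fun x => emb (some (Sum.inr (Sum.inr x)))) exit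
        (fun l => hM (some (Sum.inr (Sum.inr l)))) (some false)
      exact ⟨v', h0.trans h3⟩
    · obtain ⟨v', h3⟩ := ih₁ hp.2.2.1 (fun x => emb (some (Sum.inr (Sum.inl x)))) exit
        (fun l => hM (some (Sum.inr (Sum.inl l)))) (some true)
      exact ⟨v', h0.trans h3⟩
  | mono _ hle ih =>
    obtain ⟨v', n, hn, e⟩ := ih hp emb exit hM v
    exact ⟨v', n, hn.trans hle, e⟩

end Simulation

/-- The stacks are empty, except that stack `k` contains `l`. -/
def only (k : ℕ) (l : List Bool) : Store := update (fun _ => []) k l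

/-- A program that turns the encoding of every `x` on stack `0` into the encoding of `f x` on
stack `1`, and takes polynomial time, yields a polynomial-time Turing machine for `f`. -/
theorem polyTime_of_exec {α β : Type} {ea : α → List Bool} {eb : β → List Bool} {f : α → β}
    (p : Prog) (T : Polynomial ℕ)
    (h : ∀ x, Exec p (only 0 (ea x)) (T.eval (ea x).length) (only 1 (eb (f x)))) :
    Nonempty (TM2ComputableInPolyTime ea eb f) := by
  classical
  have hfin := p.finite_lab
  obtain ⟨m, hm, hm1⟩ : ∃ m, p.bound ≤ m ∧ 1 ≤ m := ⟨max p.bound 1, by simp, by simp⟩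
  let M : Option p.Lab → TM2.Stmt (fun _ : Fin (m + 1) => Bool) (Option p.Lab) (Option Bool) :=
    fun l => match l with
    | none => .load (fun _ => none) .halt
    | some l => p.code m some none l
  let tm : FinTM2 :=
    { K := Fin (m + 1)
      k₀ := Fin.ofNat (m + 1) 0
      k₁ := Fin.ofNat (m + 1) 1
      Γ := fun _ => Bool
      Λ := Option p.Lab
      main := some p.entry
      ΛFin := Fintype.ofFinite _
      σ := Option Bool
      initialState := none
      Γk₀Fin := inferInstanceAs (Fintype Bool)
      m := M }
  have hstk : ∀ (k : ℕ) (hk : k ≤ m) (l : List Bool),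
      (fun i : Fin (m + 1) => only k l i) =
        fun i => if i = Fin.ofNat (m + 1) k then l else [] := by
    intro k hk l
    unfold only
    rw [← update_restrict hk (fun _ => [])]
    funext i
    simp only [update_apply]
  have key : ∀ x, Steps M (T.eval (ea x).length + 1) (cfg m (some (some p.entry)) none
      (only 0 (ea x))) (cfg m none none (only 1 (eb (f x)))) := by
    intro x
    obtain ⟨v', hs⟩ := (h x).steps hm some none (M := M) (fun _ => rfl) none
    exact hs.trans (Steps.single rfl)
  have hinit : ∀ x, initList tm ((ea x).map id) =
      cfg m (some (some p.entry)) none (only 0 (ea x)) := by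
    intro x
    unfold initList cfg
    congr 1
    rw [hstk 0 (by omega)]
    funext i
    by_cases hi : i = Fin.ofNat (m + 1) 0
    · rw [if_pos hi]; subst hi
      simp only [List.map_id]
      exact dif_pos rfl
    · rw [if_neg hi]
      exact dif_neg hi
  have hhalt : ∀ x, haltList tm ((eb (f x)).map id) = cfg m none none (only 1 (eb (f x))) := by
    intro x
    unfold haltList cfg
    congr 1
    rw [hstk 1 hm1]
    funext i
    by_cases hi : i = Fin.ofNat (m + 1) 1
    · rw [if_pos hi]; subst hi
      simp only [List.map_id]
      exact dif_pos rfl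
    · rw [if_neg hi]
      exact dif_neg hi
  refine ⟨{ tm := tm, inputAlphabet := Equiv.refl Bool, outputAlphabet := Equiv.refl Bool,
            time := T + 1, outputsFun := fun x => ?_ }⟩
  have hx : ∃ n ≤ T.eval (ea x).length + 1, (flip bind tm.step)^[n]
      (some (initList tm ((ea x).map id))) = some (haltList tm ((eb (f x)).map id)) := by
    rw [hinit, hhalt]
    exact key x
  exact ⟨⟨hx.choose, hx.choose_spec.2⟩, by simpa using hx.choose_spec.1⟩

end StackProg

/-! ### List generators with bounded loops run in polynomial time -/

namespace StackProg

open Turing Function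

/-- Arithmetic expressions in loop variables and entries of the input list. -/
inductive Expr where
  | const (n : ℕ)
  | var (i : ℕ)
  | input (e : Expr)
  | add (e₁ e₂ : Expr)
  | mul (e₁ e₂ : Expr)
  | sub (e₁ e₂ : Expr)

/-- The value of an expression; subtraction is truncated, and input entries beyond the end of the
list are `0`. -/
def Expr.eval (L : List ℕ) (env : ℕ → ℕ) : Expr → ℕ
  | .const n => n
  | .var i => env i
  | .input e => L.getD (e.eval L env) 0
  | .add e₁ e₂ => e₁.eval L env + e₂.eval L env
  | .mul e₁ e₂ => e₁.eval L env * e₂.eval L env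
  | .sub e₁ e₂ => e₁.eval L env - e₂.eval L env

/-- The variables of the expression are below `d`. -/
def Expr.Closed (d : ℕ) : Expr → Prop
  | .const _ => True
  | .var i => i < d
  | .input e => e.Closed d
  | .add e₁ e₂ => e₁.Closed d ∧ e₂.Closed d
  | .mul e₁ e₂ => e₁.Closed d ∧ e₂.Closed d
  | .sub e₁ e₂ => e₁.Closed d ∧ e₂.Closed d

/-- Generators of lists of natural numbers. Loop variables are named by their nesting level:
`loop e g` at level `d` runs `g` with variable `d` ranging over the numbers below `e`. -/
inductive Gen where
  | emit (e : Expr)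
  | seq (g₁ g₂ : Gen)
  | loop (e : Expr) (g : Gen)

/-- The list generated at nesting level `d`. -/
def Gen.eval (L : List ℕ) (d : ℕ) (env : ℕ → ℕ) : Gen → List ℕ
  | .emit e => [e.eval L env]
  | .seq g₁ g₂ => g₁.eval L d env ++ g₂.eval L d env
  | .loop e g => (List.range (e.eval L env)).flatMap fun i => g.eval L (d + 1) (update env d i)

/-- At nesting level `d`, only the variables below `d` are used. -/
def Gen.Closed (d : ℕ) : Gen → Prop
  | .emit e => e.Closed d
  | .seq g₁ g₂ => g₁.Closed d ∧ g₂.Closed d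
  | .loop e g => e.Closed d ∧ g.Closed (d + 1)

/-! Stack `0` holds the input, stack `1` is auxiliary, stack `2` collects the output in reverse,
stack `3 + 2 * i` holds variable `i` in unary, stack `4 + 2 * i` the remaining number of rounds
of the loop at level `i`, and the stacks above are used for intermediate results. -/

/-- Push the (unary) content of stack `a` onto stack `k`, with auxiliary stack `s`. -/
def copy (a k s : ℕ) : Prog :=
  .seq (.drain a (.push s true) .skip)
    (.drain s (.seq (.push a true) (.push k true)) .skip)

/-- Empty stack `k`. -/
def clear (k : ℕ) : Prog := .drain k .skip .skip

/-- Push `n` times `true` onto stack `k`. -/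
def pushN (k : ℕ) : ℕ → Prog
  | 0 => .skip
  | n + 1 => .seq (.push k true) (pushN k n)

/-- Push, in unary, onto stack `k` the value of the input entry that is selected by stack `s`
as in `masked`. -/
def readInput (k s : ℕ) : Prog :=
  .drain 0 (.seq (.push 1 true) (.top s .skip .skip (.push k true)))
    (.seq (.push 1 false) (.pop s))

/-- Push, in unary, the value of an expression onto stack `k`, with auxiliary stacks from `s`
on. -/
def Expr.code (k s : ℕ) : Expr → Prog
  | .const n => pushN k n
  | .var i => copy (3 + 2 * i) k s
  | .input e =>
    .seq (.push s false) (.seq (e.code s (s + 1)) (.seq (readInput k s)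
      (.seq (.drain 1 (.push 0 true) (.push 0 false)) (clear s))))
  | .add e₁ e₂ => .seq (e₁.code k s) (e₂.code k s)
  | .mul e₁ e₂ =>
    .seq (e₁.code s (s + 2)) (.seq (e₂.code (s + 1) (s + 2))
      (.seq (.drain s (copy (s + 1) k (s + 2)) .skip) (clear (s + 1))))
  | .sub e₁ e₂ =>
    .seq (e₁.code s (s + 2)) (.seq (e₂.code (s + 1) (s + 2))
      (.seq (.drain (s + 1) (.pop s) .skip) (.drain s (.push k true) .skip)))

/-- Push the reversed unary encoding of the generated list onto stack `2`. -/
def Gen.code (d : ℕ) : Gen → Prog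
  | .emit e => .seq (e.code 2 (3 + 2 * d)) (.push 2 false)
  | .seq g₁ g₂ => .seq (g₁.code d) (g₂.code d)
  | .loop e g =>
    .seq (e.code (4 + 2 * d) (5 + 2 * d))
      (.seq (.drain (4 + 2 * d) (.seq (g.code (d + 1)) (.push (3 + 2 * d) true)) .skip)
        (clear (3 + 2 * d)))

/-- A `drain` loop whose body takes the store `st (b :: l)` to `st l`. -/
theorem Exec.drain {k T : ℕ} {p q : Prog} (st : List Bool → Store) (hk : ∀ l, st l k = l)
    (l : List Bool) (h : ∀ b l', b :: l' <:+ l →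
      Exec (bif b then p else q) (update (st (b :: l')) k l') T (st l')) :
    Exec (.drain k p q) (st l) (l.length * (T + 1) + 1) (st []) := by
  induction l with
  | nil => simpa using Exec.drain_nil (hk [])
  | cons b l ih =>
    have h1 := h b l (List.suffix_refl _)
    have h2 := ih fun b' l' hs => h b' l' (hs.trans (List.suffix_cons b l))
    refine (Exec.drain_cons (hk _) h1 h2).mono ?_
    simp only [List.length_cons]
    ring_nf
    omega

/-- A `drain` loop on a stack that contains `true` only, with the store `st i` when `i` rounds
are left. -/
theorem Exec.drain_replicate {k T : ℕ} {p q : Prog} (n : ℕ) (st : ℕ → Store)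
    (hk : ∀ i, st i k = List.replicate i true)
    (h : ∀ i < n, Exec p (update (st (i + 1)) k (List.replicate i true)) T (st i)) :
    Exec (.drain k p q) (st n) (n * (T + 1) + 1) (st 0) := by
  induction n with
  | zero => simpa using Exec.drain_nil (hk 0)
  | succ n ih =>
    refine (Exec.drain_cons (b := true) (l := List.replicate n true) (by rw [hk]; rfl)
      (h n (by omega)) (ih fun i hi => h i (by omega))).mono ?_
    ring_nf
    omega

theorem Exec.congr {p : Prog} {S S' S₀ S₁ : Store} {t t' : ℕ} (h : Exec p S t S') (h₀ : S₀ = S)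
    (h₁ : S' = S₁) (ht : t ≤ t') : Exec p S₀ t' S₁ := by
  subst h₀ h₁
  exact h.mono ht

theorem exec_clear (k : ℕ) (S : Store) :
    Exec (clear k) S ((S k).length * 2 + 1) (update S k []) := by
  have := Exec.drain (k := k) (T := 1) (p := .skip) (q := .skip) (fun l => update S k l)
    (by simp) (S k) (fun b l' _ => by
      have : update (update S k (b :: l')) k l' = update S k l' := by simp
      rw [this]
      cases b <;> exact Exec.skip)
  simpa [clear] using this

theorem replicate_append_cons (n : ℕ) (l : List Bool) :
    List.replicate n true ++ true :: l = true :: (List.replicate n true ++ l) := by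
  induction n with
  | zero => rfl
  | succ n ih => simp [List.replicate_succ, ih]

theorem exec_pushN (k n : ℕ) (S : Store) :
    Exec (pushN k n) S (n + 1) (update S k (List.replicate n true ++ S k)) := by
  induction n generalizing S with
  | zero => simpa [pushN] using Exec.skip
  | succ n ih =>
    refine (Exec.seq Exec.push (ih _)).congr rfl ?_ (by omega)
    simp [replicate_append_cons, List.replicate_succ]

theorem exec_copy {a k s n : ℕ} {S : Store} (hak : a ≠ k) (has : a ≠ s) (hks : k ≠ s)
    (ha : S a = List.replicate n true) (hs : S s = []) :
    Exec (copy a k s) S (5 * n + 2) (update S k (List.replicate n true ++ S k)) := by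
  have h1 := Exec.drain_replicate (k := a) (T := 1) (p := .push s true) (q := .skip) n
    (fun i => update (update S a (List.replicate i true)) s (List.replicate (n - i) true))
    (fun i => by simp [has]) (fun i hi => by
      refine Exec.push.congr rfl ?_ le_rfl
      funext j
      simp only [update_apply]
      have : n - i = n - (i + 1) + 1 := by omega
      split_ifs <;> simp_all [List.replicate_succ])
  have h2 := Exec.drain_replicate (k := s) (T := 2) (p := .seq (.push a true) (.push k true))
    (q := .skip) n
    (fun i => update (update (update S s (List.replicate i true)) a (List.replicate (n - i) true))
      k (List.replicate (n - i) true ++ S k))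
    (fun i => by simp [has.symm, hks.symm]) (fun i hi => by
      refine (Exec.seq Exec.push Exec.push).congr rfl ?_ le_rfl
      funext j
      simp only [update_apply]
      have : n - i = n - (i + 1) + 1 := by omega
      split_ifs <;> simp_all [List.replicate_succ])
  refine (Exec.seq (h1.congr ?_ rfl le_rfl) (h2.congr ?_ rfl le_rfl)).congr rfl ?_ (by omega)
  all_goals
    funext j
    simp only [update_apply]
    split_ifs <;> simp_all

/-- The sum of the entries of a unary list that are selected by a mask, in which `true` means
to skip an entry and `false` to select it; an exhausted mask selects nothing. -/
def masked : List Bool → List Bool → ℕ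
  | _, [] => 0
  | c, false :: l => masked c.tail l
  | false :: c, true :: l => masked (false :: c) l + 1
  | c, true :: l => masked c l

theorem exec_readInput {k s : ℕ} (hk0 : k ≠ 0) (hk1 : k ≠ 1) (hs0 : s ≠ 0) (hs1 : s ≠ 1)
    (hks : k ≠ s) (l : List Bool) (S : Store) (hl : S 0 = l) :
    ∃ c, Exec (readInput k s) S (l.length * 4 + 1)
      (update (update (update (update S 0 []) 1 (l.reverse ++ S 1)) s c) k
        (List.replicate (masked (S s) l) true ++ S k)) ∧ c.length ≤ (S s).length := by
  induction l generalizing S with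
  | nil =>
    refine ⟨S s, (Exec.drain_nil hl).congr rfl ?_ (by simp), le_rfl⟩
    funext j
    simp only [update_apply]
    split_ifs <;> simp_all [masked]
  | cons b l ih =>
    -- The store after one round, and the time that this round takes.
    obtain ⟨S', hb, hS0, hS1, hSs, hSk, hS⟩ : ∃ S', Exec (bif b then
          .seq (.push 1 true) (.top s .skip .skip (.push k true))
          else .seq (.push 1 false) (.pop s)) (update S 0 l) 3 S' ∧
        S' 0 = l ∧ S' 1 = b :: S 1 ∧ (S' s).length ≤ (S s).length ∧
        List.replicate (masked (S' s) l) true ++ S' k =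
          List.replicate (masked (S s) (b :: l)) true ++ S k ∧
        ∀ j, j ≠ 0 → j ≠ 1 → j ≠ s → j ≠ k → S' j = S j := by
      cases b with
      | false =>
        refine ⟨_, (Exec.seq Exec.push Exec.pop).mono (by omega), ?_, ?_, ?_, ?_, ?_⟩
        · simp [hs0.symm]
        · simp [hs1.symm]
        · simp [hs0, hs1]
        · have : masked (S s) (false :: l) = masked (S s).tail l := by
            cases S s <;> rfl
          simp [this, hs0, hs1, hk0, hk1, hks]
        · intro j h0 h1 h2 h3
          simp [h0, h1, h2]
      | true =>
        rcases hm : S s with _ | ⟨_ | _, c'⟩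
        · have hs' : update (update S 0 l) 1 (true :: update S 0 l 1) s = [] := by
            simp [hs0, hs1, hm]
          refine ⟨_, Exec.seq (t := 1) Exec.push (t' := 2)
            (Exec.top_nil (t := 1) hs' Exec.skip), ?_, ?_, ?_, ?_, ?_⟩
          · simp
          · simp
          · rw [hs']
          · rw [hs']; simp [masked, hk0, hk1]
          · intro j h0 h1 h2 h3
            simp [h0, h1]
        · have hs' : update (update S 0 l) 1 (true :: update S 0 l 1) s = false :: c' := by
            simp [hs0, hs1, hm]
          refine ⟨_, Exec.seq (t := 1) Exec.push (t' := 2)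
            (Exec.top_cons (t := 1) hs' Exec.push), ?_, ?_, ?_, ?_, ?_⟩
          · simp [hk0.symm]
          · simp [hk1.symm]
          · rw [update_of_ne hks.symm, hs']
          · rw [update_of_ne hks.symm, hs']
            simp [masked, hk0, hk1, replicate_append_cons, List.replicate_succ]
          · intro j h0 h1 h2 h3
            simp [h0, h1, h3]
        · have hs' : update (update S 0 l) 1 (true :: update S 0 l 1) s = true :: c' := by
            simp [hs0, hs1, hm]
          refine ⟨_, Exec.seq (t := 1) Exec.push (t' := 2)
            (Exec.top_cons (t := 1) hs' Exec.skip), ?_, ?_, ?_, ?_, ?_⟩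
          · simp
          · simp
          · rw [hs']
          · rw [hs']; simp [masked, hk0, hk1]
          · intro j h0 h1 h2 h3
            simp [h0, h1]
    obtain ⟨c, h, hc⟩ := ih S' hS0
    refine ⟨c, (Exec.drain_cons hl hb h).congr rfl ?_ (by simp only [List.length_cons]; omega),
      hc.trans hSs⟩
    funext j
    simp only [update_apply, hSk, hS1]
    split_ifs with h1 h2 h3 h4
    · rfl
    · rfl
    · simp
    · rfl
    · exact hS j h4 h3 h2 h1

open BidGame in
/-- Entry `i` of a unary listing is selected by the mask `true ^ i false`. -/
theorem masked_unary (i : ℕ) (L : List ℕ) :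
    masked (List.replicate i true ++ [false]) (unary L) = L.getD i 0 := by
  have h0 : ∀ l, masked [] l = 0 := by
    intro l
    induction l with
    | nil => rfl
    | cons b l ih => cases b <;> simpa [masked] using ih
  have hskip : ∀ c a l, masked (true :: c) (List.replicate a true ++ false :: l) = masked c l := by
    intro c a l
    induction a with
    | zero => simp [masked]
    | succ a ih => simpa [masked, List.replicate_succ] using ih
  have hsel : ∀ a l, masked [false] (List.replicate a true ++ false :: l) = a := by
    intro a l
    induction a with
    | zero => simp [masked, h0]
    | succ a ih => simpa [masked, List.replicate_succ] using ih
  have hcons : ∀ a L, unary (a :: L) = List.replicate a true ++ false :: unary L := by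
    simp [unary]
  induction L generalizing i with
  | nil => simp [unary, masked]
  | cons a L ih =>
    rw [hcons]
    cases i with
    | zero => simp [hsel]
    | succ i =>
      rw [List.replicate_succ, List.cons_append, hskip, ih]
      simp

end StackProg

namespace StackProg

open Turing Function BidGame

/-- The store holds the input list `L` and the variables below `d`, and the stacks from `s` on
are free. -/
structure Ready (L : List ℕ) (env : ℕ → ℕ) (d s : ℕ) (S : Store) : Prop where
  input : S 0 = unary L
  aux : S 1 = []
  vars : ∀ i < d, S (3 + 2 * i) = List.replicate (env i) true
  free : ∀ k, s ≤ k → S k = []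
  le : 3 + 2 * d ≤ s

theorem Ready.update {L : List ℕ} {env : ℕ → ℕ} {d s s' k : ℕ} {S : Store} (h : Ready L env d s S)
    (hs : s ≤ s') (hk0 : k ≠ 0) (hk1 : k ≠ 1) (hk : ∀ i < d, k ≠ 3 + 2 * i) (hks : k < s')
    (l : List Bool) : Ready L env d s' (update S k l) where
  input := by rw [update_of_ne hk0.symm, h.input]
  aux := by rw [update_of_ne hk1.symm, h.aux]
  vars i hi := by rw [update_of_ne (hk i hi).symm, h.vars i hi]
  free j hj := by rw [update_of_ne (by omega), h.free j (by omega)]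
  le := h.le.trans hs

theorem length_unary_cons (a : ℕ) (L : List ℕ) :
    (unary (a :: L)).length = a + 1 + (unary L).length := by
  simp [unary]
  omega

theorem getD_le_length_unary (L : List ℕ) (i : ℕ) : L.getD i 0 ≤ (unary L).length := by
  induction L generalizing i with
  | nil => simp
  | cons a L ih =>
    rw [length_unary_cons]
    cases i with
    | zero => simp; omega
    | succ i => have := ih i; simp at this ⊢; omega

theorem exec_move {a b : ℕ} (hab : a ≠ b) (l : List Bool) (S : Store) (ha : S a = l) :
    Exec (.drain a (.push b true) (.push b false)) S (l.length * 2 + 1)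
      (Function.update (Function.update S a []) b (l.reverse ++ S b)) := by
  induction l generalizing S with
  | nil =>
    refine (Exec.drain_nil ha).congr rfl ?_ (by simp)
    funext j
    simp only [update_apply]
    split_ifs <;> simp_all
  | cons c l ih =>
    have hb : Exec (bif c then .push b true else .push b false) (Function.update S a l) 1
        (Function.update (Function.update S a l) b (c :: S b)) := by
      rw [← update_of_ne hab.symm l S]
      cases c <;> exact Exec.push
    refine (Exec.drain_cons ha hb (ih _ (by simp [hab]))).congr rfl ?_
      (by simp only [List.length_cons]; omega)
    funext j
    simp only [update_apply]
    split_ifs <;> simp_all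

theorem exec_input {p : Prog} {k s t v : ℕ} {L : List ℕ} {S : Store} (hk0 : k ≠ 0) (hk1 : k ≠ 1)
    (hs0 : s ≠ 0) (hs1 : s ≠ 1) (hks : k ≠ s) (h0 : S 0 = unary L) (h1 : S 1 = []) (hs : S s = [])
    (hp : Exec p (Function.update S s [false]) t
      (Function.update S s (List.replicate v true ++ [false]))) :
    Exec (.seq (.push s false) (.seq p (.seq (readInput k s)
      (.seq (.drain 1 (.push 0 true) (.push 0 false)) (clear s))))) S
      (1 + (t + (((unary L).length * 4 + 1) + (((unary L).length * 2 + 1) + ((v + 1) * 2 + 1)))))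
      (Function.update S k (List.replicate (L.getD v 0) true ++ S k)) := by
  obtain ⟨c, hread, hcl⟩ := exec_readInput hk0 hk1 hs0 hs1 hks (unary L)
    (Function.update S s (List.replicate v true ++ [false])) (by rw [update_of_ne hs0.symm, h0])
  rw [update_self] at hcl
  rw [update_self, masked_unary, update_of_ne hks, update_of_ne hs1.symm, h1,
    List.append_nil] at hread
  have hmove := exec_move (a := 1) (b := 0) (by omega) (unary L).reverse
    (Function.update (Function.update (Function.update (Function.update (Function.update
        S s (List.replicate v true ++ [false])) 0 []) 1 (unary L).reverse) s c) k
        (List.replicate (L.getD v 0) true ++ S k)) (by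
          rw [update_of_ne hk1.symm, update_of_ne hs1.symm, update_self])
  rw [update_of_ne hk0.symm, update_of_ne hs0.symm,
    update_of_ne zero_ne_one, update_self, List.reverse_reverse, List.append_nil] at hmove
  have hclear := exec_clear s (Function.update (Function.update (Function.update (Function.update
    (Function.update (Function.update (Function.update
        S s (List.replicate v true ++ [false])) 0 []) 1 (unary L).reverse) s c) k
        (List.replicate (L.getD v 0) true ++ S k)) 1 []) 0 (unary L))
  refine (Exec.seq Exec.push (Exec.seq (hp.congr (by rw [hs]) rfl le_rfl) (Exec.seq hread
      (Exec.seq hmove hclear)))).congr rfl ?_ ?_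
  · funext j
    clear hp hread hmove hclear hcl
    simp only [update_apply]
    split_ifs <;> simp_all
  · rw [update_of_ne hs0, update_of_ne hs1, update_of_ne hks.symm, update_self]
    simp only [List.length_reverse]
    simp only [List.length_append, List.length_replicate, List.length_singleton] at hcl
    gcongr

theorem exec_mul {k s a b : ℕ} {S : Store} (hks : k < s) (ha : S s = List.replicate a true)
    (hb : S (s + 1) = List.replicate b true) (hf : S (s + 2) = []) :
    Exec (.seq (.drain s (copy (s + 1) k (s + 2)) .skip) (clear (s + 1))) S
      ((a * ((5 * b + 2) + 1) + 1) + (2 * b + 1))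
      (Function.update (Function.update (Function.update S s []) (s + 1) []) k
        (List.replicate (a * b) true ++ S k)) := by
  have hks₁ : k ≠ s := by omega
  have hks₂ : k ≠ s + 1 := by omega
  have hks₃ : k ≠ s + 2 := by omega
  have h3 := Exec.drain_replicate (k := s) (T := 5 * b + 2) (p := copy (s + 1) k (s + 2))
    (q := .skip) a (fun i => Function.update (Function.update (Function.update S s
      (List.replicate i true)) (s + 1) (List.replicate b true)) k
        (List.replicate ((a - i) * b) true ++ S k)) (fun i => by simp [hks₁.symm])
    (fun i hi => by
      refine (exec_copy (n := b) (by omega) (by omega) (by omega) ?_ ?_).congr rfl ?_ le_rfl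
      · simp [hks₂.symm]
      · simp [hks₃.symm, hf]
      · have e1 : (a - i) * b = b + (a - (i + 1)) * b := by
          rw [show a - i = a - (i + 1) + 1 by omega]; ring
        rw [e1, List.replicate_add b, List.append_assoc (List.replicate b true)]
        clear e1 hi
        funext j
        simp only [update_apply]
        split_ifs <;> simp_all)
  refine (Exec.seq (h3.congr ?_ rfl le_rfl) (exec_clear (s + 1) _)).congr rfl ?_ ?_
  · funext j
    clear h3
    simp only [update_apply]
    split_ifs <;> simp_all
  · funext j
    clear h3
    simp only [update_apply]
    split_ifs <;> simp_all
  · rw [update_of_ne hks₂.symm, update_self, List.length_replicate, mul_comm b]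

theorem exec_sub {k s a b : ℕ} {S : Store} (hks : k < s) (ha : S s = List.replicate a true)
    (hb : S (s + 1) = List.replicate b true) :
    Exec (.seq (.drain (s + 1) (.pop s) .skip) (.drain s (.push k true) .skip)) S
      ((b * (1 + 1) + 1) + (a * (1 + 1) + 1))
      (Function.update (Function.update (Function.update S s []) (s + 1) []) k
        (List.replicate (a - b) true ++ S k)) := by
  have hks₁ : k ≠ s := by omega
  have h3 := Exec.drain_replicate (k := s + 1) (T := 1) (p := .pop s)
    (q := .skip) b (fun i => Function.update (Function.update S (s + 1)
      (List.replicate i true)) s (List.replicate (a - (b - i)) true)) (fun i => by simp)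
    (fun i hi => by
      refine Exec.pop.congr rfl ?_ le_rfl
      have e1 : a - (b - i) = a - (b - (i + 1)) - 1 := by omega
      funext j
      simp only [update_apply, e1]
      by_cases h : j = s
      · simp [h]
      · by_cases h' : j = s + 1 <;> simp [h, h'])
  have h4 := Exec.drain_replicate (k := s) (T := 1) (p := .push k true)
    (q := .skip) (a - b) (fun i => Function.update (Function.update (Function.update S (s + 1) [])
      s (List.replicate i true)) k (List.replicate (a - b - i) true ++ S k))
    (fun i => by simp [hks₁.symm])
    (fun i hi => by
      refine Exec.push.congr rfl ?_ le_rfl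
      have e1 : a - b - i = a - b - (i + 1) + 1 := by omega
      funext j
      simp only [update_apply, e1]
      clear e1 hi
      split_ifs <;> simp_all [List.replicate_succ])
  refine (Exec.seq (h3.congr ?_ rfl le_rfl) (h4.congr ?_ rfl le_rfl)).congr rfl ?_ (by omega)
  all_goals
    funext j
    clear h3 h4
    simp only [update_apply]
    split_ifs <;> simp_all

theorem update_scratch {k s : ℕ} {S : Store} (hs : S s = []) (hs' : S (s + 1) = [])
    (x y z : List Bool) : Function.update (Function.update (Function.update (Function.update
      (Function.update S s x) (s + 1) y) s []) (s + 1) []) k z = Function.update S k z := by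
  funext j
  simp only [update_apply]
  split_ifs <;> simp_all

/-- The code of an expression computes its value, and both the value and the number of steps are
polynomially bounded in the length of the input and the values of the variables. -/
theorem Expr.exec (e : Expr) : ∃ P T : Polynomial ℕ, ∀ (L : List ℕ) (env : ℕ → ℕ) (d s k : ℕ)
    (S : Store) (M : ℕ), Ready L env d s S → e.Closed d → k ≠ 0 → k ≠ 1 →
    (∀ i < d, k ≠ 3 + 2 * i) → k < s → (unary L).length ≤ M → (∀ i < d, env i ≤ M) →
    e.eval L env ≤ P.eval M ∧ Exec (e.code k s) S (T.eval M)
      (Function.update S k (List.replicate (e.eval L env) true ++ S k)) := by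
  induction e with
  | const n =>
    refine ⟨Polynomial.C n, Polynomial.C (n + 1), fun L env d s k S M _ _ _ _ _ _ _ _ => ?_⟩
    simp only [Expr.eval, Polynomial.eval_C]
    exact ⟨le_rfl, exec_pushN k n S⟩
  | var i =>
    refine ⟨Polynomial.X, 5 * Polynomial.X + 2, fun L env d s k S M h hc _ _ hk hks _ hM => ?_⟩
    have hi : i < d := hc
    have := h.le
    refine ⟨by simpa [Expr.eval] using hM i hi, (exec_copy (hk i hi).symm (by omega) (by omega)
      (h.vars i hi) (h.free s le_rfl)).mono ?_⟩
    have := hM i hi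
    simp
    omega
  | input e ih =>
    obtain ⟨P, T, ih⟩ := ih
    refine ⟨Polynomial.X, 1 + (T + ((4 * Polynomial.X + 1) + ((2 * Polynomial.X + 1) +
      (2 * (P + 1) + 1)))), fun L env d s k S M h hc hk0 hk1 hk hks hL hM => ?_⟩
    have := h.le
    refine ⟨by simpa [Expr.eval] using (getD_le_length_unary L _).trans hL, ?_⟩
    have hr := h.update (k := s) (s' := s + 1) (by omega) (by omega) (by omega)
      (fun i hi => by omega) (by omega) [false]
    obtain ⟨hv, he⟩ := ih L env d (s + 1) s _ M hr hc (by omega) (by omega)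
      (fun i hi => by omega) (by omega) hL hM
    rw [update_self, update_idem] at he
    refine (exec_input hk0 hk1 (by omega) (by omega) (by omega) h.input h.aux (h.free s le_rfl)
      he).mono ?_
    simp only [Polynomial.eval_add, Polynomial.eval_one, Polynomial.eval_mul, Polynomial.eval_X,
      Polynomial.eval_ofNat]
    omega
  | add e₁ e₂ ih₁ ih₂ =>
    obtain ⟨P₁, T₁, ih₁⟩ := ih₁
    obtain ⟨P₂, T₂, ih₂⟩ := ih₂
    refine ⟨P₁ + P₂, T₁ + T₂, fun L env d s k S M h hc hk0 hk1 hk hks hL hM => ?_⟩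
    obtain ⟨hv₁, he₁⟩ := ih₁ L env d s k S M h hc.1 hk0 hk1 hk hks hL hM
    obtain ⟨hv₂, he₂⟩ := ih₂ L env d s k _ M (h.update le_rfl hk0 hk1 hk hks _) hc.2 hk0 hk1 hk
      hks hL hM
    simp only [Polynomial.eval_add, Expr.eval]
    refine ⟨by omega, (Exec.seq he₁ he₂).congr rfl ?_ le_rfl⟩
    simp only [update_self, update_idem]
    rw [add_comm, List.replicate_add, List.append_assoc]
  | mul e₁ e₂ ih₁ ih₂ =>
    obtain ⟨P₁, T₁, ih₁⟩ := ih₁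
    obtain ⟨P₂, T₂, ih₂⟩ := ih₂
    refine ⟨P₁ * P₂, T₁ + (T₂ + ((P₁ * ((5 * P₂ + 2) + 1) + 1) + (2 * P₂ + 1))),
      fun L env d s k S M h hc hk0 hk1 hk hks hL hM => ?_⟩
    have hle := h.le
    have hr₀ : Ready L env d (s + 2) S := ⟨h.input, h.aux, h.vars,
      fun j hj => h.free j (by omega), by omega⟩
    obtain ⟨hv₁, he₁⟩ := ih₁ L env d (s + 2) s S M hr₀ hc.1 (by omega) (by omega)
      (fun i hi => by omega) (by omega) hL hM
    have hr₁ := hr₀.update (k := s) le_rfl (by omega) (by omega) (fun i hi => by omega)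
      (by omega) (List.replicate (e₁.eval L env) true ++ S s)
    obtain ⟨hv₂, he₂⟩ := ih₂ L env d (s + 2) (s + 1) _ M hr₁ hc.2 (by omega) (by omega)
      (fun i hi => by omega) (by omega) hL hM
    set a := e₁.eval L env
    set b := e₂.eval L env
    have hab := exec_mul (k := k) (s := s) (a := a) (b := b) (S := Function.update
      (Function.update S s (List.replicate a true)) (s + 1) (List.replicate b true)) (by omega)
      (by simp) (by simp) (by simp [h.free (s + 2) (by omega)])
    rw [update_scratch (h.free s le_rfl) (h.free (s + 1) (by omega)),
      update_of_ne (by omega), update_of_ne (by omega)] at hab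
    rw [h.free s le_rfl, List.append_nil] at he₁ he₂
    rw [update_of_ne (by omega : s + 1 ≠ s), h.free (s + 1) (by omega), List.append_nil] at he₂
    refine ⟨?_, (Exec.seq he₁ (Exec.seq he₂ hab)).congr rfl rfl ?_⟩
    · simpa only [Polynomial.eval_mul, Expr.eval] using Nat.mul_le_mul hv₁ hv₂
    · simp only [Polynomial.eval_add, Polynomial.eval_one, Polynomial.eval_mul,
        Polynomial.eval_ofNat]
      gcongr
  | sub e₁ e₂ ih₁ ih₂ =>
    obtain ⟨P₁, T₁, ih₁⟩ := ih₁
    obtain ⟨P₂, T₂, ih₂⟩ := ih₂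
    refine ⟨P₁, T₁ + (T₂ + ((P₂ * (1 + 1) + 1) + (P₁ * (1 + 1) + 1))),
      fun L env d s k S M h hc hk0 hk1 hk hks hL hM => ?_⟩
    have hle := h.le
    have hr₀ : Ready L env d (s + 2) S := ⟨h.input, h.aux, h.vars,
      fun j hj => h.free j (by omega), by omega⟩
    obtain ⟨hv₁, he₁⟩ := ih₁ L env d (s + 2) s S M hr₀ hc.1 (by omega) (by omega)
      (fun i hi => by omega) (by omega) hL hM
    have hr₁ := hr₀.update (k := s) le_rfl (by omega) (by omega) (fun i hi => by omega)
      (by omega) (List.replicate (e₁.eval L env) true ++ S s)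
    obtain ⟨hv₂, he₂⟩ := ih₂ L env d (s + 2) (s + 1) _ M hr₁ hc.2 (by omega) (by omega)
      (fun i hi => by omega) (by omega) hL hM
    set a := e₁.eval L env
    set b := e₂.eval L env
    have hab := exec_sub (k := k) (s := s) (a := a) (b := b) (S := Function.update
      (Function.update S s (List.replicate a true)) (s + 1) (List.replicate b true)) (by omega)
      (by simp) (by simp)
    rw [update_scratch (h.free s le_rfl) (h.free (s + 1) (by omega)),
      update_of_ne (by omega), update_of_ne (by omega)] at hab
    rw [h.free s le_rfl, List.append_nil] at he₁ he₂
    rw [update_of_ne (by omega : s + 1 ≠ s), h.free (s + 1) (by omega), List.append_nil] at he₂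
    refine ⟨(Nat.sub_le _ _).trans hv₁, (Exec.seq he₁ (Exec.seq he₂ hab)).congr rfl rfl ?_⟩
    simp only [Polynomial.eval_add, Polynomial.eval_one, Polynomial.eval_mul]
    gcongr

end StackProg

namespace StackProg

open Turing Function BidGame

/-- The code of a generator outputs the generated list in polynomial time. -/
theorem Gen.exec (g : Gen) : ∃ T : Polynomial ℕ, ∀ (L : List ℕ) (env : ℕ → ℕ) (d : ℕ)
    (S : Store) (M : ℕ), Ready L env d (3 + 2 * d) S → g.Closed d → (unary L).length ≤ M →
    (∀ i < d, env i ≤ M) → Exec (g.code d) S (T.eval M)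
      (Function.update S 2 ((unary (g.eval L d env)).reverse ++ S 2)) := by
  induction g with
  | emit e =>
    obtain ⟨P, T, h⟩ := e.exec
    refine ⟨T + 1, fun L env d S M hr hc hL hM => ?_⟩
    obtain ⟨-, he⟩ := h L env d (3 + 2 * d) 2 S M hr hc (by omega) (by omega)
      (fun i hi => by omega) (by omega) hL hM
    simp only [Polynomial.eval_add, Polynomial.eval_one]
    refine (Exec.seq he Exec.push).congr rfl ?_ le_rfl
    simp [Gen.eval, unary]
  | seq g₁ g₂ ih₁ ih₂ =>
    obtain ⟨T₁, ih₁⟩ := ih₁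
    obtain ⟨T₂, ih₂⟩ := ih₂
    refine ⟨T₁ + T₂, fun L env d S M hr hc hL hM => ?_⟩
    have h₁ := ih₁ L env d S M hr hc.1 hL hM
    have h₂ := ih₂ L env d _ M (hr.update (k := 2) le_rfl (by omega) (by omega) (fun i hi => by omega)
      (by omega) ((unary (g₁.eval L d env)).reverse ++ S 2)) hc.2 hL hM
    simp only [Polynomial.eval_add]
    refine (Exec.seq h₁ h₂).congr rfl ?_ le_rfl
    simp [Gen.eval, unary]
  | loop e g ih =>
    obtain ⟨P, T, h⟩ := e.exec
    obtain ⟨Tg, ih⟩ := ih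
    refine ⟨T + ((P * ((Tg.comp (Polynomial.X + P) + 1) + 1) + 1) + (2 * P + 1)),
      fun L env d S M hr hc hL hM => ?_⟩
    have hr₀ : Ready L env d (5 + 2 * d) S := ⟨hr.input, hr.aux, hr.vars,
      fun j hj => hr.free j (by omega), by omega⟩
    obtain ⟨hv, he⟩ := h L env d (5 + 2 * d) (4 + 2 * d) S M hr₀ hc.1 (by omega) (by omega)
      (fun i hi => by omega) (by omega) hL hM
    have h3 := hr.free (3 + 2 * d) le_rfl
    have h4 := hr.free (4 + 2 * d) (by omega)
    rw [h4, List.append_nil] at he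
    set n := e.eval L env with hn
    -- The output after `j` rounds.
    let out : ℕ → List ℕ := fun j => (List.range j).flatMap fun i =>
      g.eval L (d + 1) (Function.update env d i)
    have hout : ∀ j, out (j + 1) = out j ++ g.eval L (d + 1) (Function.update env d j) := by
      intro j
      simp [out, List.range_succ]
    let st : ℕ → Store := fun i => Function.update (Function.update (Function.update S (4 + 2 * d)
      (List.replicate i true)) (3 + 2 * d) (List.replicate (n - i) true)) 2
      ((unary (out (n - i))).reverse ++ S 2)
    have hloop := Exec.drain_replicate (k := 4 + 2 * d) (T := (Tg.comp (Polynomial.X + P)).eval M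
        + 1) (p := .seq (g.code (d + 1)) (.push (3 + 2 * d) true)) (q := .skip) n st
      (fun i => by
        simp only [st]
        rw [update_of_ne (by omega), update_of_ne (by omega), update_self])
      (fun i hi => by
        have hrun : Ready L (Function.update env d (n - (i + 1))) (d + 1) (3 + 2 * (d + 1))
            (Function.update (st (i + 1)) (4 + 2 * d) (List.replicate i true)) := by
          refine ⟨?_, ?_, fun j hj => ?_, fun j hj => ?_, le_rfl⟩
          · simp only [st]
            rw [update_of_ne (by omega), update_of_ne (by omega), update_of_ne (by omega),
              update_of_ne (by omega), hr.input]
          · simp only [st]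
            rw [update_of_ne (by omega), update_of_ne (by omega), update_of_ne (by omega),
              update_of_ne (by omega), hr.aux]
          · simp only [st]
            rw [update_of_ne (by omega), update_of_ne (by omega)]
            by_cases hjd : j = d
            · subst hjd
              rw [update_self, update_self]
            · rw [update_of_ne (by omega), update_of_ne (by omega), update_of_ne hjd,
                hr.vars j (by omega)]
          · simp only [st]
            rw [update_of_ne (by omega), update_of_ne (by omega), update_of_ne (by omega),
              update_of_ne (by omega), hr.free j (by omega)]
        have hg := ih L _ (d + 1) _ (M + P.eval M) hrun hc.2 (by omega) (fun j hj => by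
          by_cases hjd : j = d
          · subst hjd
            rw [update_self]
            omega
          · rw [update_of_ne hjd]
            have := hM j (by omega)
            omega)
        rw [Polynomial.eval_comp, Polynomial.eval_add, Polynomial.eval_X]
        refine (Exec.seq hg Exec.push).congr rfl ?_ le_rfl
        have e1 : n - i = n - (i + 1) + 1 := by omega
        have e2 : unary (out (n - i)) = unary (out (n - (i + 1))) ++
            unary (g.eval L (d + 1) (Function.update env d (n - (i + 1)))) := by
          rw [e1, hout]
          simp [unary]
        have e3 : List.replicate (n - i) true = true :: List.replicate (n - (i + 1)) true := by
          rw [e1, List.replicate_succ]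
        simp only [st]
        rw [e2, e3]
        funext j
        simp only [update_apply]
        by_cases hj2 : j = 2
        · subst hj2
          simp [show ¬ 2 = 3 + 2 * d by omega, show ¬ 2 = 4 + 2 * d by omega]
        · by_cases hj3 : j = 3 + 2 * d
          · simp [hj3, show ¬ 3 + 2 * d = 2 by omega]
          · by_cases hj4 : j = 4 + 2 * d
            · simp [hj4, show ¬ 4 + 2 * d = 2 by omega]
            · simp [hj2, hj3, hj4])
    simp only [Polynomial.eval_add, Polynomial.eval_one, Polynomial.eval_mul,
      Polynomial.eval_ofNat]
    refine (Exec.seq he (Exec.seq (hloop.congr ?_ rfl le_rfl) (exec_clear (3 + 2 * d) _))).congr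
      rfl ?_ ?_
    · funext j
      simp only [st, update_apply]
      by_cases hj2 : j = 2
      · subst hj2
        simp [out, unary, show ¬ 2 = 4 + 2 * d by omega]
      · by_cases hj3 : j = 3 + 2 * d
        · simp [hj3, h3, show ¬ 3 + 2 * d = 2 by omega]
        · simp [hj2, hj3]
    · funext j
      simp only [st, update_apply]
      by_cases hj2 : j = 2
      · subst hj2
        simp [out, Gen.eval, hn, show ¬ 2 = 3 + 2 * d by omega]
      · by_cases hj3 : j = 3 + 2 * d
        · simp [hj3, h3, show ¬ 3 + 2 * d = 2 by omega]
        · by_cases hj4 : j = 4 + 2 * d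
          · simp [hj4, h4, show ¬ 4 + 2 * d = 2 by omega]
          · simp [hj2, hj3, hj4]
    · simp only [st]
      rw [update_of_ne (by omega), update_self, List.length_replicate, Nat.sub_zero, mul_comm n 2]
      gcongr

/-- A function that is computed by a list generator on unary encoded lists is computable in
polynomial time. -/
theorem polyTime_of_gen {α β : Type} {ea : α → List Bool} {eb : β → List Bool} {f : α → β}
    (g : Gen) (hg : g.Closed 0) (na : α → List ℕ) (ha : ∀ x, ea x = unary (na x))
    (hb : ∀ x, eb (f x) = unary (g.eval (na x) 0 fun _ => 0)) :
    Nonempty (TM2ComputableInPolyTime ea eb f) := by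
  obtain ⟨T, hT⟩ := g.exec
  -- After the generator has run, stack 2 contains at most as many symbols as there were steps.
  have hlen : ∀ {p S t S'}, Exec p S t S' → ∀ k, (S' k).length ≤ (S k).length + t := by
    intro p S t S' h
    induction h with
    | skip => intro k; omega
    | @push S j b =>
      intro k
      by_cases h : k = j
      · subst h; simp
      · simp [h]
    | @pop S j =>
      intro k
      by_cases h : k = j
      · subst h; simp; omega
      · simp [h]
    | seq _ _ ih₁ ih₂ => intro k; have := ih₁ k; have := ih₂ k; omega
    | drain_nil => intro k; omega
    | @drain_cons j p q S b l t S' t' S'' hS _ _ ih₁ ih₂ =>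
      intro k
      have h1 := ih₁ k
      have h2 := ih₂ k
      by_cases h : k = j
      · subst h
        rw [update_self] at h1
        rw [hS, List.length_cons]
        omega
      · rw [update_of_ne h] at h1
        omega
    | top_nil _ _ ih => intro k; have := ih k; omega
    | top_cons _ _ ih => intro k; have := ih k; omega
    | mono _ _ ih => intro k; have := ih k; omega
  refine polyTime_of_exec (.seq (g.code 0) (.seq (clear 0)
    (.drain 2 (.push 1 true) (.push 1 false)))) (T + ((2 * Polynomial.X + 1) + (2 * T + 1)))
    fun x => ?_
  have hr : Ready (na x) (fun _ => 0) 0 (3 + 2 * 0) (only 0 (ea x)) :=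
    ⟨by simp [only, ha], by simp [only], fun i hi => by omega,
      fun j hj => by rw [only, update_of_ne (by omega)], le_rfl⟩
  have h1 := hT _ _ _ _ (ea x).length hr hg (by rw [ha]) (fun i hi => by omega)
  set out := unary (g.eval (na x) 0 fun _ => 0) with hout
  have hl := hlen h1 2
  have e2 : only 0 (ea x) 2 = [] := by simp [only]
  rw [e2, List.append_nil] at h1 hl
  rw [update_self, List.length_reverse, List.length_nil, zero_add] at hl
  have h3 := exec_move (a := 2) (b := 1) (by omega) out.reverse
    (Function.update (Function.update (only 0 (ea x)) 2 out.reverse) 0 [])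
    (by rw [update_of_ne (by omega), update_self])
  simp only [Polynomial.eval_add, Polynomial.eval_one, Polynomial.eval_mul,
      Polynomial.eval_ofNat, Polynomial.eval_X]
  refine (Exec.seq h1 (Exec.seq (exec_clear 0 _) h3)).congr rfl ?_ ?_
  · rw [hb, ← hout]
    funext j
    simp only [only, update_apply]
    by_cases h1 : j = 1
    · simp [h1]
    · by_cases h2 : j = 2
      · simp [h2]
      · by_cases h0 : j = 0 <;> simp [h0, h1, h2]
  · rw [update_of_ne (by omega), only, update_self, List.length_reverse, mul_comm _ 2, mul_comm _ 2]
    omega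

end StackProg

/-! ### Winning strategies as graphs of plays, and stuttering simulations -/

namespace BidGame

open Filter

section Sequences

/-- An infinite sequence whose consecutive entries are connected by finite paths can be refined to
an infinite path. -/
theorem exists_path_of_transGen {S : Type} {Q : S → S → Prop} (s : ℕ → S)
    (h : ∀ j, Relation.TransGen Q (s j) (s (j + 1))) :
    ∃ y : ℕ → S, y 0 = s 0 ∧ (∀ t, Q (y t) (y (t + 1))) ∧ ∀ j, ∃ t, y t = s j := by
  have hseg : ∀ a b, Relation.TransGen Q a b →
      ∃ (n : ℕ) (f : ℕ → S), f 0 = a ∧ f (n + 1) = b ∧ ∀ i ≤ n, Q (f i) (f (i + 1)) := by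
    intro a b hab
    induction hab with
    | single hq =>
      rename_i b
      refine ⟨0, fun i => if i = 0 then a else b, rfl, rfl, fun i hi => ?_⟩
      obtain rfl : i = 0 := by omega
      exact hq
    | @tail b c _ hq ih =>
      obtain ⟨n, f, h0, hn, hf⟩ := ih
      refine ⟨n + 1, fun i => if i ≤ n + 1 then f i else c, by simpa using h0, by simp,
        fun i hi => ?_⟩
      rcases Nat.lt_or_ge n i with hni | hni
      · obtain rfl : i = n + 1 := by omega
        simpa [hn] using hq
      · simpa [show i ≤ n + 1 by omega, hni] using hf i hni
  choose n f h0 hn hf using fun j => hseg _ _ (h j)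
  -- `st t` is the number of the segment, and the position therein, after `t` steps.
  let st : ℕ → ℕ × ℕ := fun t => Nat.rec (0, 0)
    (fun _ p => if p.2 < n p.1 then (p.1, p.2 + 1) else (p.1 + 1, 0)) t
  have hst : ∀ t, st (t + 1) =
      if (st t).2 < n (st t).1 then ((st t).1, (st t).2 + 1) else ((st t).1 + 1, 0) :=
    fun t => rfl
  have hle : ∀ t, (st t).2 ≤ n (st t).1 := by
    intro t
    induction t with
    | zero => exact Nat.zero_le _
    | succ t ih =>
      rw [hst]
      split_ifs with hlt
      · exact hlt
      · exact Nat.zero_le _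
  refine ⟨fun t => f (st t).1 (st t).2, h0 0, fun t => ?_, fun j => ?_⟩
  · have h1 := hf (st t).1 (st t).2 (hle t)
    simp only [hst]
    split_ifs with hlt
    · exact h1
    · have e : (st t).2 = n (st t).1 := le_antisymm (hle t) (not_lt.1 hlt)
      rw [e, hn] at h1
      simp only [h0]
      rw [e]
      exact h1
  · have key : ∃ t, st t = (j, 0) := by
      induction j with
      | zero => exact ⟨0, rfl⟩
      | succ j ih =>
        obtain ⟨t, ht⟩ := ih
        have hr : ∀ r ≤ n j, st (t + r) = (j, r) := by
          intro r
          induction r with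
          | zero => intro _; exact ht
          | succ r ih =>
            intro hr
            rw [← add_assoc, hst, ih (by omega)]
            simp [show r < n j by omega]
        refine ⟨t + n j + 1, ?_⟩
        rw [hst, hr _ le_rfl]
        simp
    obtain ⟨t, ht⟩ := key
    exact ⟨t, by simp only [ht, h0]⟩

/-- A sequence that changes at the times in `D` only is a slowed-down version of the sequence of
its changes. -/
theorem exists_contraction {X : Type} (x : ℕ → X) (D : ℕ → Prop) (hinf : ∀ t, ∃ t' ≥ t, D t')
    (hx : ∀ t, ¬ D t → x (t + 1) = x t) :
    ∃ (y : ℕ → X) (τ : ℕ → ℕ), (∀ t, x t = y (τ t)) ∧ y 0 = x 0 ∧ Monotone τ ∧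
      Function.Surjective τ ∧ ∀ j, ∃ t, D t ∧ y j = x t ∧ y (j + 1) = x (t + 1) := by
  classical
  have hD : {t | D t}.Infinite := by
    refine Set.infinite_of_not_bddAbove fun ⟨b, hb⟩ => ?_
    obtain ⟨t, ht, hDt⟩ := hinf (b + 1)
    have := hb hDt
    omega
  have hconst : ∀ a k, (∀ t, a ≤ t → t < a + k → ¬ D t) → x (a + k) = x a := by
    intro a k hk
    induction k with
    | zero => rfl
    | succ k ih =>
      rw [← add_assoc, hx _ (hk _ (by omega) (by omega)), ih fun t h1 h2 => hk t h1 (by omega)]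
  have key : ∀ t, x (Nat.nth D (Nat.count D t)) = x t := by
    intro t
    have hle : t ≤ Nat.nth D (Nat.count D t) := Nat.le_nth_count hD t
    obtain ⟨k, hk⟩ := Nat.exists_eq_add_of_le hle
    rw [hk]
    refine hconst t k fun t' h1 h2 hDt => ?_
    have h3 : Nat.count D t ≤ Nat.count D t' := Nat.count_monotone D h1
    have h4 : Nat.nth D (Nat.count D t) ≤ Nat.nth D (Nat.count D t') :=
      (Nat.nth_strictMono hD).monotone h3
    rw [Nat.nth_count hDt] at h4
    omega
  refine ⟨fun j => x (Nat.nth D j), Nat.count D, fun t => (key t).symm, ?_, Nat.count_monotone D,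
    fun j => ⟨Nat.nth D j, Nat.count_nth_of_infinite hD j⟩, fun j => ?_⟩
  · simpa using key 0
  · refine ⟨Nat.nth D j, Nat.nth_mem_of_infinite hD j, rfl, ?_⟩
    have := key (Nat.nth D j + 1)
    rwa [Nat.count_succ, if_pos (Nat.nth_mem_of_infinite hD j),
      Nat.count_nth_of_infinite hD j] at this

/-- The set of sequences is invariant under slowing down. -/
def StutterInvariant {Λ : Type} (P : Set (ℕ → Λ)) : Prop :=
  ∀ (l : ℕ → Λ) (τ : ℕ → ℕ), Monotone τ → Function.Surjective τ → ((fun t => l (τ t)) ∈ P ↔ l ∈ P)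

end Sequences

namespace Arena

section Plays

variable {A V : Type} {G : Arena A V}

theorem exists_legal (G : Arena A V) (i : Player) : ∃ s, G.Legal i s :=
  ⟨fun _ v => (G.allowed_nonempty v i).choose, fun _ v => (G.allowed_nonempty v i).choose_spec⟩

/-- Two objectives that agree on legal plays are equivalent. -/
theorem wins_congr {α β : Set (ℕ → V)} {v : V} (i : Player)
    (h : ∀ s₁ s₂, G.Legal .one s₁ → G.Legal .two s₂ →
      (G.path s₁ s₂ v ∈ α ↔ G.path s₁ s₂ v ∈ β)) : G.Wins α i v ↔ G.Wins β i v := by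
  cases i
  · exact exists_congr fun s₁ => and_congr_right fun h₁ => forall_congr' fun s₂ =>
      forall_congr' fun h₂ => h s₁ s₂ h₁ h₂
  · exact exists_congr fun s₂ => and_congr_right fun h₂ => forall_congr' fun s₁ =>
      forall_congr' fun h₁ => not_congr (h s₁ s₂ h₁ h₂)

/-- A winning strategy of Player 1 amounts to a graph of states, each of which determines a vertex
and an action, that has an edge for each action of Player 2, and all of whose infinite paths from
the initial state are winning. -/
theorem wins_one_iff {α : Set (ℕ → V)} {v : V} : G.Wins α .one v ↔
    ∃ (X : Type) (x₀ : X) (pos : X → V) (act : X → A) (R : X → X → Prop), pos x₀ = v ∧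
      (∀ x, act x ∈ G.allowed (pos x) .one) ∧
      (∀ x, ∀ b ∈ G.allowed (pos x) .two, ∃ y, R x y ∧ pos y = G.next (pos x) (act x) b) ∧
      ∀ x : ℕ → X, x 0 = x₀ → (∀ m, R (x m) (x (m + 1))) → (fun m => pos (x m)) ∈ α := by
  classical
  constructor
  · rintro ⟨s, hs, hwin⟩
    refine ⟨List (V × A × A) × V, ([], v), fun x => x.2, fun x => s x.1 x.2,
      fun x y => ∃ b ∈ G.allowed x.2 .two,
        y = (x.1 ++ [(x.2, s x.1 x.2, b)], G.next x.2 (s x.1 x.2) b), rfl,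
      fun x => hs _ _, fun x b hb => ⟨_, ⟨b, hb, rfl⟩, rfl⟩, fun x h0 hR => ?_⟩
    choose b hb hy using hR
    obtain ⟨s', hs'⟩ := G.exists_legal .two
    -- Player 2 plays the actions of the given path, irrespective of the history.
    let s₂ : Strategy A V := fun h u =>
      if b h.length ∈ G.allowed u .two then b h.length else s' h u
    have hs₂ : G.Legal .two s₂ := by
      intro h u
      simp only [s₂]
      split_ifs with hb
      · exact hb
      · exact hs' h u
    have hlen : ∀ m, (x m).1.length = m := by
      intro m
      induction m with
      | zero => rw [h0]; rfl
      | succ m ih => rw [hy]; simp [ih]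
    have hhist : ∀ m, G.history s s₂ v m = x m := by
      intro m
      induction m with
      | zero => exact h0.symm
      | succ m ih =>
        have e : s₂ (x m).1 (x m).2 = b m := by
          simp only [s₂, hlen]
          exact if_pos (hb m)
        simp only [history, ih, e, hy m]
    have := hwin s₂ hs₂
    convert this using 1
    funext m
    simp only [path, hhist]
  · rintro ⟨X, x₀, pos, act, R, h0, hact, htot, hwin⟩
    choose! succ hR hpos using htot
    let upd : X → V × A × A → X := fun x t => succ x t.2.2
    obtain ⟨s', hs'⟩ := G.exists_legal .one
    let s₁ : Strategy A V := fun h u =>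
      if pos (h.foldl upd x₀) = u then act (h.foldl upd x₀) else s' h u
    have hs₁ : G.Legal .one s₁ := by
      intro h u
      simp only [s₁]
      split_ifs with hu
      · rw [← hu]
        exact hact _
      · exact hs' h u
    refine ⟨s₁, hs₁, fun s₂ hs₂ => ?_⟩
    let x : ℕ → X := fun m => (G.history s₁ s₂ v m).1.foldl upd x₀
    have hstep : ∀ m, pos (x m) = (G.history s₁ s₂ v m).2 → R (x m) (x (m + 1)) ∧
        pos (x (m + 1)) = (G.history s₁ s₂ v (m + 1)).2 := by
      intro m hm
      set h := G.history s₁ s₂ v m with hh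
      have e1 : s₁ h.1 h.2 = act (x m) := if_pos hm
      have hb : s₂ h.1 h.2 ∈ G.allowed (pos (x m)) .two := by
        rw [hm]
        exact hs₂ _ _
      have e2 : x (m + 1) = succ (x m) (s₂ h.1 h.2) := by
        simp only [x, history, List.foldl_append, List.foldl_cons, List.foldl_nil, upd]
        rfl
      rw [e2]
      refine ⟨hR _ _ hb, ?_⟩
      rw [hpos _ _ hb, ← e1, hm]
      rfl
    have hp : ∀ m, pos (x m) = (G.history s₁ s₂ v m).2 := by
      intro m
      induction m with
      | zero => exact h0
      | succ m ih => exact (hstep m ih).2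
    have := hwin x rfl fun m => (hstep m (hp m)).1
    convert this using 1
    funext m
    exact (hp m).symm

end Plays

end Arena

end BidGame

namespace BidGame

namespace Arena

open Relation

variable {A V A' V' Λ : Type}

/-- Stuttering simulation. Paths are compared by means of labels of the vertices. Labels in `suff`
suffice to win, and labels in `bad` are a trap that is losing unless `suff` has been visited.
`Z p a q` means that a play of `G'` in `q` can simulate a play of `G` in `p`, where `a` is the next
action of Player 1 in `G`. The simulation advances in `G`, with an action of Player 2 that it
chooses, or in `G'`, with an action of Player 1 that it chooses, or in both games, and it must not
advance in one of the games only for ever. -/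
theorem Wins.transfer {G : Arena A V} {G' : Arena A' V'} {lab : V → Λ} {lab' : V' → Λ}
    {P : Set (ℕ → Λ)} (hP : StutterInvariant P) (suff bad : Set Λ)
    (hsuff : ∀ l : ℕ → Λ, (∃ m, l m ∈ suff) → l ∈ P)
    (hbad : ∀ l ∈ P, (∃ m, l m ∈ bad) → ∃ m, l m ∈ suff)
    (hdisj : ∀ c ∈ bad, c ∉ suff)
    (htrap : ∀ p, lab p ∈ bad → ∀ a ∈ G.allowed p .one,
      ∃ b ∈ G.allowed p .two, lab (G.next p a b) ∈ bad)
    (Z : V → A → V' → Prop) (rk : V → V' → ℕ) (hlab : ∀ p a q, Z p a q → lab p = lab' q)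
    (hsim : ∀ p a q, Z p a q → a ∈ G.allowed p .one → lab p ∉ suff →
      (∃ b ∈ G.allowed p .two, lab (G.next p a b) ∈ bad) ∨
      (∃ b ∈ G.allowed p .two, rk (G.next p a b) q < rk p q ∧
        ∀ a₁ ∈ G.allowed (G.next p a b) .one, Z (G.next p a b) a₁ q) ∨
      ∃ a' ∈ G'.allowed q .one, ∀ b' ∈ G'.allowed q .two,
        lab' (G'.next q a' b') ∈ suff ∨
        (Z p a (G'.next q a' b') ∧ rk p (G'.next q a' b') < rk p q) ∨
        ∃ b ∈ G.allowed p .two, ∀ a₁ ∈ G.allowed (G.next p a b) .one,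
          Z (G.next p a b) a₁ (G'.next q a' b'))
    {p₀ : V} {q₀ : V'} (h₀ : ∀ a ∈ G.allowed p₀ .one, Z p₀ a q₀)
    (hwin : G.Wins {π | (fun m => lab (π m)) ∈ P} .one p₀) :
    G'.Wins {π | (fun m => lab' (π m)) ∈ P} .one q₀ := by
  classical
  by_cases hp₀ : lab p₀ ∈ suff
  · obtain ⟨a, ha⟩ := G.allowed_nonempty p₀ .one
    obtain ⟨s, hs⟩ := G'.exists_legal .one
    exact ⟨s, hs, fun s₂ _ => hsuff _ ⟨0, by
      rw [hlab _ _ _ (h₀ a ha)] at hp₀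
      exact hp₀⟩⟩
  obtain ⟨X, x₀, pos, act, R, hx₀, hact, htot, hwinX⟩ := wins_one_iff.1 hwin
  -- States that are reachable without a visit to `suff`.
  let Good : X → Prop := ReflTransGen (fun x y => R x y ∧ lab (pos y) ∉ suff) x₀
  have hgood_suff : ∀ x, Good x → lab (pos x) ∉ suff := by
    intro x hx
    rcases hx.cases_tail with h | ⟨y, _, h⟩
    · rw [h, hx₀]; exact hp₀
    · exact h.2
  -- In such a state, the action of Player 1 does not allow Player 2 to enter the trap.
  have hnobad : ∀ x, Good x → ¬ ∃ b ∈ G.allowed (pos x) .two,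
      lab (G.next (pos x) (act x) b) ∈ bad := by
    rintro x hx ⟨b, hb, hbb⟩
    have hstay : ∀ y : {y // lab (pos y) ∈ bad}, ∃ z : {y // lab (pos y) ∈ bad}, R y z := by
      rintro ⟨y, hy⟩
      obtain ⟨b, hb, hbb⟩ := htrap _ hy _ (hact y)
      obtain ⟨z, hz, e⟩ := htot y b hb
      exact ⟨⟨z, by rw [e]; exact hbb⟩, hz⟩
    choose nxt hnxt using hstay
    obtain ⟨y, hy, e⟩ := htot x b hb
    have hpath : ∀ x', Good x' → ReflTransGen (fun x y => R x y ∧ lab (pos y) ∉ suff) x' x →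
        ∃ w : ℕ → X, w 0 = x' ∧ (∀ m, R (w m) (w (m + 1))) ∧ (∀ m, lab (pos (w m)) ∉ suff) ∧
          ∃ m, lab (pos (w m)) ∈ bad := by
      intro x' hx' hr
      induction hr using ReflTransGen.head_induction_on with
      | refl =>
        let w : ℕ → {y // lab (pos y) ∈ bad} := fun m => nxt^[m] ⟨y, by rw [e]; exact hbb⟩
        refine ⟨fun m => Nat.casesOn m x fun m => w m, rfl, fun m => ?_, fun m => ?_, 1,
          (w 0).2⟩
        · cases m with
          | zero => exact hy
          | succ m =>
            have := hnxt (w m)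
            simp only [w] at this ⊢
            rwa [Function.iterate_succ_apply']
        · cases m with
          | zero => exact hgood_suff x hx'
          | succ m => exact hdisj _ (w m).2
      | head h1 h2 ih =>
        rename_i u v
        obtain ⟨w, hw0, hwR, hws, m, hm⟩ := ih (hx'.tail h1)
        refine ⟨fun m => Nat.casesOn m u fun m => w m, rfl, fun m => ?_, fun m => ?_, m + 1, hm⟩
        · cases m with
          | zero => simpa [hw0] using h1.1
          | succ m => exact hwR m
        · cases m with
          | zero => exact hgood_suff u hx'
          | succ m => exact hws m
    obtain ⟨w, hw0, hwR, hws, hwb⟩ := hpath x₀ .refl hx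
    obtain ⟨m, hm⟩ := hbad _ (hwinX w hw0 hwR) hwb
    exact hws m hm
  -- States of the simulation, and the condition that it can advance in `G'`.
  let Sim : X × V' → Prop := fun z => Good z.1 ∧ Z (pos z.1) (act z.1) z.2
  let Ready : X × V' → A' → Prop := fun z a' => a' ∈ G'.allowed z.2 .one ∧
    ∀ b' ∈ G'.allowed z.2 .two, lab' (G'.next z.2 a' b') ∈ suff ∨
      (Z (pos z.1) (act z.1) (G'.next z.2 a' b') ∧
        rk (pos z.1) (G'.next z.2 a' b') < rk (pos z.1) z.2) ∨
      ∃ b ∈ G.allowed (pos z.1) .two, ∀ a₁ ∈ G.allowed (G.next (pos z.1) (act z.1) b) .one,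
        Z (G.next (pos z.1) (act z.1) b) a₁ (G'.next z.2 a' b')
  let Left : X × V' → X × V' → Prop := fun z w => w.2 = z.2 ∧ R z.1 w.1 ∧
    lab (pos w.1) = lab' w.2
  let Move : X × V' → X × V' → Prop := fun z w => lab (pos w.1) = lab' w.2 ∧
    ((w.1 = z.1 ∧ rk (pos w.1) w.2 < rk (pos z.1) z.2) ∨ R z.1 w.1)
  have hnorm : ∀ n z, Sim z → rk (pos z.1) z.2 = n →
      ∃ w, ReflTransGen Left z w ∧ w.2 = z.2 ∧ Sim w ∧ ∃ a', Ready w a' := by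
    intro n
    induction n using Nat.strong_induction_on with
    | _ n ih =>
      rintro ⟨x, q⟩ ⟨hx, hZ⟩ hn
      rcases hsim _ _ _ hZ (hact x) (hgood_suff x hx) with h | ⟨b, hb, hr, hZ'⟩ | ⟨a', ha', h⟩
      · exact absurd h (hnobad x hx)
      · obtain ⟨y, hy, e⟩ := htot x b hb
        have hZy : Z (pos y) (act y) q := by
          rw [e]
          exact hZ' _ (by rw [← e]; exact hact y)
        have hl : lab (pos y) = lab' q := hlab _ _ _ hZy
        have hs : lab (pos y) ∉ suff := by
          rw [hl, ← hlab _ _ _ hZ]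
          exact hgood_suff x hx
        have hgy : Good y := .tail (show Good x from hx) ⟨hy, hs⟩
        obtain ⟨w, hw1, hw2, hw3⟩ := ih (rk (pos y) q)
          (by rw [← hn, e]; exact hr) (y, q) ⟨hgy, hZy⟩ rfl
        exact ⟨w, .head (show Left (x, q) (y, q) from ⟨rfl, hy, hl⟩) hw1, hw2, hw3⟩
      · exact ⟨(x, q), .refl, rfl, ⟨hx, hZ⟩, a', ha', h⟩
  have hA' : Nonempty A' := ⟨(G'.allowed_nonempty q₀ .one).choose⟩
  choose! nrm hnrm_left hnrm_snd hnrm_sim ract hract using fun z (hz : Sim z) => hnorm _ z hz rfl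
  obtain ⟨s', hs'⟩ := G'.exists_legal .one
  refine wins_one_iff.2 ⟨{z // Sim z} ⊕ V', .inl ⟨(x₀, q₀), .refl, by
      rw [hx₀]; exact h₀ _ (by rw [← hx₀]; exact hact x₀)⟩,
    Sum.elim (fun z => z.1.2) id, Sum.elim (fun z => ract z.1) (fun q => s' [] q),
    fun y y' => match y, y' with
      | .inl z, .inl w => ∃ u, ReflTransGen Left z.1 u ∧ Move u w.1
      | .inl _, .inr q => lab' q ∈ suff
      | .inr _, .inl _ => False
      | .inr _, .inr _ => True, rfl, ?_, ?_, ?_⟩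
  · rintro (⟨z, hz⟩ | q)
    · have := (hract z hz).1
      rwa [hnrm_snd z hz] at this
    · exact hs' _ _
  · rintro (⟨z, hz⟩ | q) b' hb'
    · simp only [Sum.elim_inl] at hb' ⊢
      have h2 := (hract z hz).2 b' (by rw [hnrm_snd z hz]; exact hb')
      obtain ⟨hg, hZ⟩ := hnrm_sim z hz
      rw [hnrm_snd z hz] at h2 hZ
      rcases h2 with h | ⟨h, hr⟩ | ⟨b, hb, h⟩
      · exact ⟨.inr (G'.next z.2 (ract z) b'), h, rfl⟩
      · exact ⟨.inl ⟨((nrm z).1, G'.next z.2 (ract z) b'), hg, h⟩,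
          ⟨nrm z, hnrm_left z hz, hlab _ _ _ h, .inl ⟨rfl, by
            rw [hnrm_snd z hz]; exact hr⟩⟩, rfl⟩
      · obtain ⟨y, hy, e⟩ := htot _ b hb
        have hZy : Z (pos y) (act y) (G'.next z.2 (ract z) b') := by
          rw [e]
          exact h _ (by rw [← e]; exact hact y)
        by_cases hs : lab (pos y) ∈ suff
        · exact ⟨.inr (G'.next z.2 (ract z) b'), by rw [hlab _ _ _ hZy] at hs; exact hs, rfl⟩
        · exact ⟨.inl ⟨(y, G'.next z.2 (ract z) b'), hg.tail ⟨hy, hs⟩, hZy⟩,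
            ⟨nrm z, hnrm_left z hz, hlab _ _ _ hZy, .inr hy⟩, rfl⟩
    · exact ⟨.inr (G'.next q (s' [] q) b'), trivial, rfl⟩
  · intro y hy0 hR
    by_cases hexit : ∃ m q, y m = .inr q
    · -- The simulation has been stopped by a visit to `suff`.
      have hex : ∃ m q, y m = .inr q := hexit
      obtain ⟨q, hq⟩ := Nat.find_spec hex
      rcases hm : Nat.find hex with _ | m
      · rw [hm, hy0] at hq
        cases hq
      · rw [hm] at hq
        refine hsuff _ ⟨m + 1, ?_⟩
        rcases hym : y m with z | q'
        · have := hR m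
          rw [hym, hq] at this
          show lab' (Sum.elim _ _ (y (m + 1))) ∈ suff
          rw [hq]
          exact this
        · exact absurd ⟨q', hym⟩ (Nat.find_min hex (by omega))
    · have hinl : ∀ m, ∃ z, y m = .inl z := by
        intro m
        rcases hym : y m with z | q
        · exact ⟨z, rfl⟩
        · exact absurd ⟨m, q, hym⟩ hexit
      choose z hz using hinl
      have hstep : ∀ m, ∃ u, ReflTransGen Left (z m).1 u ∧ Move u (z (m + 1)).1 := by
        intro m
        have := hR m
        rwa [hz, hz] at this
      -- The interleaved moves of both games, together with the number of moves in `G'`.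
      let Q : ℕ × (X × V') → ℕ × (X × V') → Prop := fun c c' =>
        (c'.1 = c.1 ∧ Left c.2 c'.2 ∨ c'.1 = c.1 + 1 ∧ Move c.2 c'.2) ∧
          c'.2.2 = (z c'.1).1.2
      have htrans : ∀ j, TransGen Q (j, (z j).1) (j + 1, (z (j + 1)).1) := by
        intro j
        obtain ⟨u, hu, hm⟩ := hstep j
        have hlift : ReflTransGen Q (j, (z j).1) (j, u) ∧ u.2 = (z j).1.2 := by
          clear hm
          induction hu with
          | refl => exact ⟨.refl, rfl⟩
          | tail _ h ih =>
            have e := h.1.trans ih.2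
            exact ⟨ih.1.tail ⟨.inl ⟨rfl, h⟩, e⟩, e⟩
        exact TransGen.tail' hlift.1 ⟨.inr ⟨rfl, hm⟩, rfl⟩
      obtain ⟨c, hc0, hcQ, hcs⟩ := exists_path_of_transGen (fun j => (j, (z j).1)) htrans
      have hz0 : (z 0).1 = (x₀, q₀) := by
        have := hz 0
        rw [hy0] at this
        exact (congrArg Subtype.val (Sum.inl.inj this)).symm
      have hsnd : ∀ t, (c t).2.2 = (z (c t).1).1.2 := by
        intro t
        cases t with
        | zero => rw [hc0]
        | succ t => exact (hcQ t).2
      have hlabt : ∀ t, lab (pos (c t).2.1) = lab' (c t).2.2 := by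
        intro t
        cases t with
        | zero => rw [hc0]; exact hlab _ _ _ (z 0).2.2
        | succ t =>
          rcases (hcQ t).1 with ⟨_, h⟩ | ⟨_, h⟩
          · exact h.2.2
          · exact h.1
      have hmono : Monotone fun t => (c t).1 := by
        refine monotone_nat_of_le_succ fun t => ?_
        rcases (hcQ t).1 with ⟨h, _⟩ | ⟨h, _⟩ <;> omega
      have hsurj : Function.Surjective fun t => (c t).1 := by
        intro j
        obtain ⟨t, ht⟩ := hcs j
        exact ⟨t, by simp only [ht]⟩
      -- The play in `G`.
      have hinf : ∀ t, ∃ t' ≥ t, R (c t').2.1 (c (t' + 1)).2.1 := by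
        intro t
        by_contra! hno
        have hdec : ∀ k, rk (pos (c (t + k)).2.1) (c (t + k)).2.2 + k ≤
            rk (pos (c t).2.1) (c t).2.2 := by
          intro k
          induction k with
          | zero => simp
          | succ k ih =>
            have h1 := hno (t + k) (by omega)
            rcases (hcQ (t + k)).1 with ⟨_, h⟩ | ⟨_, _, ⟨_, h⟩ | h⟩
            · exact absurd h.2.1 h1
            · rw [add_assoc t k 1] at h
              omega
            · exact absurd h h1
        have := hdec (rk (pos (c t).2.1) (c t).2.2 + 1)
        omega
      obtain ⟨x, τ, hxτ, hx0, hτm, hτs, hxR⟩ := exists_contraction (fun t => (c t).2.1)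
        (fun t => R (c t).2.1 (c (t + 1)).2.1) hinf (fun t ht => by
          rcases (hcQ t).1 with ⟨_, h⟩ | ⟨_, _, ⟨h, _⟩ | h⟩
          · exact absurd h.2.1 ht
          · exact h
          · exact absurd h ht)
      have hwx := hwinX x (by rw [hx0, hc0]; simp only [hz0]) (fun j => by
        obtain ⟨t, ht, e1, e2⟩ := hxR j
        rw [e1, e2]
        exact ht)
      have h1 := (hP (fun m => lab (pos (x m))) τ hτm hτs).2 hwx
      have h2 := (hP (fun m => lab' (z m).1.2) (fun t => (c t).1) hmono hsurj).1 (by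
        convert h1 using 1
        funext t
        have := hxτ t
        rw [← this, hlabt, hsnd])
      show (fun m => lab' _) ∈ P
      convert h2 using 1
      funext m
      rw [hz]
      rfl

end Arena

end BidGame

/-! ### Objectives: slowing down paths, and adding sinks -/

namespace BidGame

open Filter

section Frequently

variable {X Y : Type}

theorem frequently_stutter {τ : ℕ → ℕ} (hm : Monotone τ) (hs : Function.Surjective τ)
    (p : ℕ → Prop) : (∃ᶠ t in atTop, p (τ t)) ↔ ∃ᶠ j in atTop, p j := by
  simp only [frequently_atTop]
  constructor
  · intro h a
    obtain ⟨t, rfl⟩ := hs a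
    obtain ⟨t', ht', hp⟩ := h t
    exact ⟨τ t', hm ht', hp⟩
  · intro h a
    obtain ⟨j, hj, hp⟩ := h (τ a + 1)
    obtain ⟨t, rfl⟩ := hs j
    refine ⟨t, ?_, hp⟩
    by_contra! hlt
    have := hm hlt.le
    omega

theorem infSet_stutter {τ : ℕ → ℕ} (hm : Monotone τ) (hs : Function.Surjective τ) (l : ℕ → X) :
    infSet (fun t => l (τ t)) = infSet l :=
  Set.ext fun x => frequently_stutter hm hs fun j => l j = x

theorem infSet_comp [Finite X] (f : X → Y) (π : ℕ → X) :
    infSet (fun m => f (π m)) = f '' infSet π := by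
  ext y
  constructor
  · intro h
    by_contra hno
    refine h ?_
    have : ∀ᶠ m in atTop, ∀ x, f x = y → π m ≠ x := by
      refine eventually_all.2 fun x => ?_
      by_cases hx : f x = y
      · have : ¬ ∃ᶠ m in atTop, π m = x := fun hf => hno ⟨x, hf, hx⟩
        filter_upwards [not_frequently.1 this] with m hm _ using hm
      · exact Eventually.of_forall fun m h => absurd h hx
    filter_upwards [this] with m hm h using hm _ h rfl
  · rintro ⟨x, hx, rfl⟩
    exact hx.mono fun m hm => congrArg f hm

theorem infSet_eventually_const {l : ℕ → X} {x : X} (h : ∀ᶠ m in atTop, l m = x) :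
    infSet l = {x} := by
  ext y
  constructor
  · intro hy
    obtain ⟨m, h1, h2⟩ := (hy.and_eventually h).exists
    exact h1.symm.trans h2
  · rintro rfl
    exact h.frequently

end Frequently

/-- A numbering of the sinks of the players. -/
def sinkIndex : Player → Fin 2
  | .one => 0
  | .two => 1

section Sinks

variable {n n' : ℕ} (φ : Fin n' → Fin n ⊕ Player)

/-- The vertices that represent a vertex in `T` or the sink of Player 1. -/
def targetsWithSinks (T : Finset (Fin n)) : Finset (Fin n') :=
  Finset.univ.filter fun w => φ w ∈ T.disjSum {Player.one}

/-- The priorities of the represented vertices; the sinks have priorities 1 and 2. -/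
def priorityWithSinks (p : Fin n → ℕ+) (w : Fin n') : ℕ+ :=
  Sum.elim p (fun i => (sinkIndex i : ℕ).succPNat) (φ w)

/-- The colours of the represented vertices; the sinks have two new colours. -/
def colorWithSinks (M : MullerCondition n) (w : Fin n') : Fin (M.colors + 2) :=
  Sum.elim (fun v => (M.color v).castAdd 2) (fun i => (sinkIndex i).natAdd M.colors) (φ w)

/-- The accepting sets, and the set that consists of the colour of the sink of Player 1. -/
def familyWithSinks (M : MullerCondition n) : List (Finset (Fin (M.colors + 2))) :=
  {Fin.natAdd M.colors (sinkIndex .one)} :: M.family.map fun S => S.map (Fin.castAddEmb 2)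

variable {φ} {π : ℕ → Fin n'}

/-- A path that ends up in the sink of Player `i` is winning for Player `i`: the Büchi condition. -/
theorem targets_sink {i : Player} (T : Finset (Fin n)) (h : ∀ᶠ m in atTop, φ (π m) = .inr i) :
    (∃ᶠ m in atTop, π m ∈ targetsWithSinks φ T) ↔ i = .one := by
  simp only [targetsWithSinks, Finset.mem_filter, Finset.mem_univ, true_and]
  constructor
  · intro h'
    obtain ⟨m', h1, h2⟩ := (h'.and_eventually h).exists
    rw [h2] at h1
    simpa using h1
  · rintro rfl
    exact (h.mono fun m' h => by rw [h]; simp).frequently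

/-- A path that ends up in the sink of Player `i` is winning for Player `i`: the parity
condition. -/
theorem priority_sink {i : Player} (p : Fin n → ℕ+) {w : Fin n'} (hw : w ∈ infSet π)
    (h : ∀ u ∈ infSet π, φ u = .inr i) :
    (∃ v ∈ infSet π, Odd (priorityWithSinks φ p v : ℕ) ∧
      ∀ u ∈ infSet π, priorityWithSinks φ p u ≤ priorityWithSinks φ p v) ↔ i = .one := by
  simp only [priorityWithSinks]
  constructor
  · rintro ⟨v, hv, ho, -⟩
    rw [h v hv] at ho
    cases i
    · rfl
    · exact absurd ho (by simp [sinkIndex])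
  · rintro rfl
    exact ⟨w, hw, by rw [h w hw]; simp [sinkIndex], fun u hu => by rw [h w hw, h u hu]⟩

/-- A path that ends up in the sink of Player `i` is winning for Player `i`: the Müller condition.
The new colours of the sinks do not occur in the old accepting sets. -/
theorem muller_sink {i : Player} (M : MullerCondition n) {w : Fin n'} (hw : w ∈ infSet π)
    (h : ∀ u ∈ infSet π, φ u = .inr i) :
    (∃ S ∈ familyWithSinks M, (S : Set (Fin (M.colors + 2))) =
      colorWithSinks φ M '' infSet π) ↔ i = .one := by
  have himg : colorWithSinks φ M '' infSet π = {Fin.natAdd M.colors (sinkIndex i)} := by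
    ext x
    constructor
    · rintro ⟨u, hu, rfl⟩
      simp [colorWithSinks, h u hu]
    · rintro rfl
      exact ⟨w, hw, by simp [colorWithSinks, h w hw]⟩
  rw [himg]
  constructor
  · rintro ⟨S, hS, e⟩
    rcases List.mem_cons.1 hS with rfl | hS
    · have : Fin.natAdd M.colors (sinkIndex .one) = Fin.natAdd M.colors (sinkIndex i) := by
        rw [Finset.coe_singleton] at e
        exact Set.singleton_injective e
      cases i
      · rfl
      · simp [sinkIndex] at this
    · obtain ⟨S, _, rfl⟩ := List.mem_map.1 hS
      have : Fin.natAdd M.colors (sinkIndex i) ∈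
          ((S.map (Fin.castAddEmb 2) : Finset (Fin (M.colors + 2))) : Set _) := by
        rw [e]; rfl
      rw [Finset.coe_map] at this
      obtain ⟨x, _, hx⟩ := this
      have := congrArg Fin.val hx
      simp at this
      omega
  · rintro rfl
    exact ⟨_, List.mem_cons_self, by simp⟩

theorem targets_inl {ρ : ℕ → Fin n} (h : ∀ m, φ (π m) = .inl (ρ m)) (T : Finset (Fin n)) (m : ℕ) :
    π m ∈ targetsWithSinks φ T ↔ ρ m ∈ T := by
  simp [targetsWithSinks, h]

theorem priority_inl {ρ : ℕ → Fin n} (p : Fin n → ℕ+)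
    (h₁ : ∀ v ∈ infSet ρ, ∃ w ∈ infSet π, φ w = .inl v)
    (h₂ : ∀ w ∈ infSet π, ∃ v ∈ infSet ρ, φ w = .inl v) :
    (∃ v ∈ infSet π, Odd (priorityWithSinks φ p v : ℕ) ∧
      ∀ u ∈ infSet π, priorityWithSinks φ p u ≤ priorityWithSinks φ p v) ↔
    ∃ v ∈ infSet ρ, Odd (p v : ℕ) ∧ ∀ u ∈ infSet ρ, p u ≤ p v := by
  simp only [priorityWithSinks]
  constructor
  · rintro ⟨w, hw, ho, hmax⟩
    obtain ⟨v, hv, e⟩ := h₂ w hw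
    rw [e] at ho
    refine ⟨v, hv, ho, fun u hu => ?_⟩
    obtain ⟨w', hw', e'⟩ := h₁ u hu
    have := hmax w' hw'
    rwa [e, e'] at this
  · rintro ⟨v, hv, ho, hmax⟩
    obtain ⟨w, hw, e⟩ := h₁ v hv
    refine ⟨w, hw, by rw [e]; exact ho, fun w' hw' => ?_⟩
    obtain ⟨u, hu, e'⟩ := h₂ w' hw'
    rw [e, e']
    exact hmax u hu

theorem muller_inl {ρ : ℕ → Fin n} (M : MullerCondition n)
    (h₁ : ∀ v ∈ infSet ρ, ∃ w ∈ infSet π, φ w = .inl v)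
    (h₂ : ∀ w ∈ infSet π, ∃ v ∈ infSet ρ, φ w = .inl v) :
    (∃ S ∈ familyWithSinks M, (S : Set (Fin (M.colors + 2))) =
      colorWithSinks φ M '' infSet π) ↔
    ∃ S ∈ M.family, (S : Set (Fin M.colors)) = M.color '' infSet ρ := by
  have himg : colorWithSinks φ M '' infSet π =
      Fin.castAdd 2 '' (M.color '' infSet ρ) := by
    ext x
    constructor
    · rintro ⟨w, hw, rfl⟩
      obtain ⟨v, hv, e⟩ := h₂ w hw
      exact ⟨_, ⟨v, hv, rfl⟩, by simp [colorWithSinks, e]⟩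
    · rintro ⟨_, ⟨v, hv, rfl⟩, rfl⟩
      obtain ⟨w, hw, e⟩ := h₁ v hv
      exact ⟨w, hw, by simp [colorWithSinks, e]⟩
  rw [himg]
  constructor
  · rintro ⟨S, hS, e⟩
    rcases List.mem_cons.1 hS with rfl | hS
    · exfalso
      have : Fin.natAdd M.colors (sinkIndex .one) ∈
          Fin.castAdd 2 '' (M.color '' infSet ρ) := by
        rw [← e]; simp
      obtain ⟨x, _, hx⟩ := this
      have := congrArg Fin.val hx
      simp at this
      omega
    · obtain ⟨S, hS', rfl⟩ := List.mem_map.1 hS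
      refine ⟨S, hS', ?_⟩
      rw [Finset.coe_map] at e
      exact Set.image_injective.2 (Fin.castAdd_injective _ 2) e
  · rintro ⟨S, hS, e⟩
    refine ⟨S.map (Fin.castAddEmb 2), List.mem_cons_of_mem _ (List.mem_map.2 ⟨S, hS, rfl⟩), ?_⟩
    rw [Finset.coe_map, e]
    rfl

end Sinks

namespace Condition

variable {n : ℕ} {k : Objective}

theorem paths_stutterInvariant (c : Condition k n) : StutterInvariant c.paths := by
  intro l τ hm hs
  cases k with
  | reachability => exact hs.exists (p := fun j => l j ∈ (show Finset (Fin n) from c)).symm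
  | buchi => exact frequently_stutter hm hs fun j => l j ∈ (show Finset (Fin n) from c)
  | parity => simp only [paths, Set.mem_ofPred_eq, infSet_stutter hm hs]
  | muller => simp only [paths, Set.mem_ofPred_eq, infSet_stutter hm hs]

/-- The labels that suffice to win: the sink of Player 1, and the targets of a reachability
objective. -/
def suffLabels : {k : Objective} → Condition k n → Set (Fin n ⊕ Player)
  | .reachability, T => {x | x ∈ (show Finset (Fin n) from T).disjSum {Player.one}}
  | _, _ => {.inr .one}

/-- The winning sequences of vertices and sinks of the players. -/
def labelPaths (c : Condition k n) : Set (ℕ → Fin n ⊕ Player) :=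
  {l | (∃ m, l m ∈ c.suffLabels) ∨ ∃ π ∈ c.paths, l = fun m => .inl (π m)}

theorem labelPaths_stutterInvariant (c : Condition k n) : StutterInvariant c.labelPaths := by
  intro l τ hm hs
  refine or_congr (hs.exists (p := fun j => l j ∈ c.suffLabels)).symm ?_
  constructor
  · rintro ⟨π, hπ, e⟩
    have : ∀ j, ∃ v, l j = .inl v := by
      intro j
      obtain ⟨t, rfl⟩ := hs j
      exact ⟨_, congrFun e t⟩
    choose ρ hρ using this
    have e' : π = fun t => ρ (τ t) := by
      funext t
      have := congrFun e t
      simp only [hρ] at this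
      exact (Sum.inl.inj this).symm
    rw [e', paths_stutterInvariant c ρ τ hm hs] at hπ
    exact ⟨ρ, hπ, funext hρ⟩
  · rintro ⟨π, hπ, rfl⟩
    exact ⟨fun t => π (τ t), (paths_stutterInvariant c π τ hm hs).2 hπ, rfl⟩

theorem inr_two_notMem_suffLabels (c : Condition k n) : .inr .two ∉ c.suffLabels := by
  cases k
  case reachability => exact fun h => by simpa using Finset.inr_mem_disjSum.1 h
  all_goals exact fun h => by cases h

theorem inr_one_mem_suffLabels (c : Condition k n) : .inr .one ∈ c.suffLabels := by
  cases k
  case reachability => exact Finset.inr_mem_disjSum.2 (by simp)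
  all_goals rfl

theorem inl_mem_labelPaths {c : Condition k n} {π : ℕ → Fin n} :
    (fun m => Sum.inl (π m)) ∈ c.labelPaths ↔ π ∈ c.paths := by
  constructor
  · rintro (⟨m, hm⟩ | ⟨ρ, hρ, e⟩)
    · cases k with
      | reachability =>
        exact ⟨m, Finset.inl_mem_disjSum.1 hm⟩
      | buchi => cases hm
      | parity => cases hm
      | muller => cases hm
    · have : π = ρ := funext fun m => Sum.inl.inj (congrFun e m)
      rwa [this]
  · intro h
    exact .inr ⟨π, h, rfl⟩

/-- A winning sequence that visits a sink also visits a label that suffices to win. -/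
theorem suff_of_mem_labelPaths {c : Condition k n} {l : ℕ → Fin n ⊕ Player} (hl : l ∈ c.labelPaths)
    {m : ℕ} {i : Player} (h : l m = .inr i) : ∃ m, l m ∈ c.suffLabels := by
  rcases hl with h' | ⟨π, _, rfl⟩
  · exact h'
  · cases h

/-- The condition on vertices that represent a vertex of the original game or a sink. -/
def withSinks {n' : ℕ} (φ : Fin n' → Fin n ⊕ Player) : {k : Objective} → Condition k n →
    Condition k n'
  | .reachability, T => targetsWithSinks φ T
  | .buchi, T => targetsWithSinks φ T
  | .parity, p => priorityWithSinks φ p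
  | .muller, M => MullerCondition.mk (M.colors + 2) (colorWithSinks φ M) (familyWithSinks M)

/-- If sinks are never left, then the condition with sinks judges a path by the vertices it
represents, and by the sink it ends up in, if any. -/
theorem mem_paths_withSinks {n' : ℕ} (φ : Fin n' → Fin n ⊕ Player) (c : Condition k n)
    (π : ℕ → Fin n') (hπ : ∀ m i, φ (π m) = .inr i → φ (π (m + 1)) = .inr i) :
    π ∈ (c.withSinks φ).paths ↔ (fun m => φ (π m)) ∈ c.labelPaths := by
  by_cases hsink : ∃ m i, φ (π m) = .inr i
  · obtain ⟨m, i, hm⟩ := hsink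
    have hstay : ∀ m', m ≤ m' → φ (π m') = .inr i := by
      intro m' hm'
      induction m', hm' using Nat.le_induction with
      | base => exact hm
      | succ m' _ ih => exact hπ _ _ ih
    have hev : ∀ᶠ m' in atTop, φ (π m') = .inr i := eventually_atTop.2 ⟨m, hstay⟩
    have hinf : φ '' infSet π = {.inr i} := by
      rw [← infSet_comp]
      exact infSet_eventually_const hev
    obtain ⟨w, hw, hwi⟩ : ∃ w ∈ infSet π, φ w = .inr i := by
      have : (Sum.inr i : Fin n ⊕ Player) ∈ φ '' infSet π := by rw [hinf]; rfl
      exact this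
    have hall : ∀ u ∈ infSet π, φ u = .inr i := by
      intro u hu
      have : φ u ∈ φ '' infSet π := ⟨u, hu, rfl⟩
      rwa [hinf] at this
    -- Only the sink of Player 1 is sufficient, except for reachability.
    have hlab : (∃ m, φ (π m) = .inr .one) ↔ i = .one := by
      constructor
      · rintro ⟨m', h'⟩
        obtain ⟨m'', h1, h2⟩ := ((eventually_ge_atTop m').and hev).exists
        have : φ (π m'') = .inr .one := by
          clear h2
          induction m'', h1 using Nat.le_induction with
          | base => exact h'
          | succ m' _ ih => exact hπ _ _ ih
        rw [this] at h2
        exact (Sum.inr.inj h2).symm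
      · rintro rfl
        exact ⟨m, hm⟩
    have hno : ¬ ∃ ρ ∈ c.paths, (fun m => φ (π m)) = fun m => .inl (ρ m) := by
      rintro ⟨ρ, _, e⟩
      have := congrFun e m
      simp [hm] at this
    have hR : (fun m => φ (π m)) ∈ c.labelPaths ↔ ∃ m, φ (π m) ∈ c.suffLabels :=
      or_iff_left hno
    rw [hR]
    cases k with
    | reachability =>
      exact exists_congr fun m => by
        show π m ∈ targetsWithSinks φ _ ↔ _
        simp only [targetsWithSinks, Finset.mem_filter, Finset.mem_univ, true_and]
        rfl
    | buchi => exact (targets_sink _ hev).trans hlab.symm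
    | parity => exact (priority_sink _ hw hall).trans hlab.symm
    | muller => exact (muller_sink _ hw hall).trans hlab.symm
  · have hinl : ∀ m, ∃ v, φ (π m) = .inl v := by
      intro m
      rcases h : φ (π m) with v | i
      · exact ⟨v, rfl⟩
      · exact absurd ⟨m, i, h⟩ hsink
    choose ρ hρ using hinl
    have hinf : φ '' infSet π = Sum.inl '' infSet ρ := by
      rw [← infSet_comp, ← infSet_comp]
      simp only [hρ]
    have h1 : ∀ v ∈ infSet ρ, ∃ w ∈ infSet π, φ w = .inl v := by
      intro v hv
      have : (Sum.inl v : Fin n ⊕ Player) ∈ φ '' infSet π := by rw [hinf]; exact ⟨v, hv, rfl⟩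
      exact this
    have h2 : ∀ w ∈ infSet π, ∃ v ∈ infSet ρ, φ w = .inl v := by
      intro w hw
      have : φ w ∈ Sum.inl '' infSet ρ := by rw [← hinf]; exact ⟨w, hw, rfl⟩
      obtain ⟨v, hv, e⟩ := this
      exact ⟨v, hv, e.symm⟩
    have hR : (fun m => φ (π m)) ∈ c.labelPaths ↔ ρ ∈ c.paths := by
      simp only [hρ]
      exact inl_mem_labelPaths
    rw [hR]
    cases k with
    | reachability => exact exists_congr fun m => targets_inl hρ _ m
    | buchi => exact frequently_congr (Eventually.of_forall fun m => targets_inl hρ _ m)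
    | parity => exact priority_inl _ h1 h2
    | muller => exact muller_inl _ h1 h2

end Condition

end BidGame

/-! ### The path of the token in a bidding game -/

namespace BidGame

/-- The position of the token. -/
def BidVertex.tok {n N : ℕ} : BidVertex n N → Fin n
  | .conf c => c.vertex
  | .bids c _ _ => c.vertex
  | .yielded c _ => c.vertex

/-- A vertex of the concurrent game is a configuration. -/
def BidVertex.IsConf {n N : ℕ} (x : BidVertex n N) : Prop := ∃ c, x = .conf c

namespace BiddingGame

variable {k : Objective} (G : BiddingGame k)

theorem next_conf {c : Config G.n G.N} {a₁ a₂ : BidAction G.n G.N}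
    (h₁ : a₁ ∈ G.allowed (.conf c) .one) (h₂ : a₂ ∈ G.allowed (.conf c) .two) :
    ∃ b₁ b₂ : Fin (G.N + 1), a₁ = .bid b₁ ∧ a₂ = .bid b₂ ∧ (b₁ : ℕ) ≤ c.budget .one ∧
      (b₂ : ℕ) ≤ c.budget .two ∧ G.next (.conf c) a₁ a₂ = .bids c b₁ b₂ := by
  obtain ⟨b₁, h1, rfl⟩ := h₁
  obtain ⟨b₂, h2, rfl⟩ := h₂
  exact ⟨b₁, b₂, rfl, rfl, h1, h2, rfl⟩

theorem pick_mem {x : BidVertex G.n G.N} {a₁ a₂ : BidAction G.n G.N}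
    (h₁ : a₁ ∈ G.allowed x .one) (h₂ : a₂ ∈ G.allowed x .two) (i : Player) :
    i.pick a₁ a₂ ∈ G.allowed x i := by
  cases i
  · exact h₁
  · exact h₂

/-- After the bids, the winner of the bidding moves the token, or the holder of the advantage lets
the opponent win after a tie. -/
theorem next_bids {c : Config G.n G.N} {b₁ b₂ : Fin (G.N + 1)} {a₁ a₂ : BidAction G.n G.N}
    (h₁ : a₁ ∈ G.allowed (.bids c b₁ b₂) .one) (h₂ : a₂ ∈ G.allowed (.bids c b₁ b₂) .two) :
    (∃ w u, higherBidder b₁ b₂ = some w ∧ G.edge c.vertex u = true ∧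
      G.next (.bids c b₁ b₂) a₁ a₂ =
        .conf (c.update w (w.pick b₁ b₂ : Fin (G.N + 1)) c.adv u)) ∨
    (∃ u, higherBidder b₁ b₂ = none ∧ G.edge c.vertex u = true ∧
      G.next (.bids c b₁ b₂) a₁ a₂ = .conf (c.update c.adv b₁ c.adv.other u)) ∨
    higherBidder b₁ b₂ = none ∧ G.next (.bids c b₁ b₂) a₁ a₂ = .yielded c b₁ := by
  rcases hb : higherBidder b₁ b₂ with _ | w
  · have h := G.pick_mem h₁ h₂ c.adv
    simp only [allowed, hb, if_true] at h
    rcases h with h | ⟨u, hu, h⟩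
    · exact .inr (.inr ⟨rfl, by simp only [next, hb, h]⟩)
    · exact .inr (.inl ⟨u, rfl, hu, by simp only [next, hb, h]⟩)
  · have h := G.pick_mem h₁ h₂ w
    simp only [allowed, hb, if_true] at h
    obtain ⟨u, hu, h⟩ := h
    exact .inl ⟨w, u, rfl, hu, by simp only [next, hb, h]⟩

theorem next_yielded {c : Config G.n G.N} {b : Fin (G.N + 1)} {a₁ a₂ : BidAction G.n G.N}
    (h₁ : a₁ ∈ G.allowed (.yielded c b) .one) (h₂ : a₂ ∈ G.allowed (.yielded c b) .two) :
    ∃ u, G.edge c.vertex u = true ∧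
      G.next (.yielded c b) a₁ a₂ = .conf (c.update c.adv.other b c.adv u) := by
  have h := G.pick_mem h₁ h₂ c.adv.other
  simp only [allowed, if_true] at h
  obtain ⟨u, hu, h⟩ := h
  exact ⟨u, hu, by simp only [next, h]⟩

/-- A legal turn leads from a configuration to bids, and the token does not move until the next
configuration. -/
theorem next_tok {x : BidVertex G.n G.N} {a₁ a₂ : BidAction G.n G.N}
    (h₁ : a₁ ∈ G.allowed x .one) (h₂ : a₂ ∈ G.allowed x .two) :
    (G.next x a₁ a₂).IsConf ∨ (G.next x a₁ a₂).tok = x.tok := by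
  cases x with
  | conf c =>
    obtain ⟨b₁, b₂, _, _, _, _, e⟩ := G.next_conf h₁ h₂
    exact .inr (by rw [e]; rfl)
  | bids c b₁ b₂ =>
    rcases G.next_bids h₁ h₂ with ⟨w, u, _, _, e⟩ | ⟨u, _, _, e⟩ | ⟨_, e⟩
    · exact .inl ⟨_, e⟩
    · exact .inl ⟨_, e⟩
    · exact .inr (by rw [e]; rfl)
  | yielded c b =>
    obtain ⟨u, _, e⟩ := G.next_yielded h₁ h₂
    exact .inl ⟨_, e⟩

/-- The legal steps of the concurrent game. -/
def Step (x y : BidVertex G.n G.N) : Prop :=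
  ∃ a₁ ∈ G.allowed x .one, ∃ a₂ ∈ G.allowed x .two, y = G.next x a₁ a₂

theorem exists_isConf_of_step {π : ℕ → BidVertex G.n G.N} (h : ∀ m, G.Step (π m) (π (m + 1)))
    (m : ℕ) : ∃ m' ≥ m, (π m').IsConf := by
  have hy : ∀ m c b, π m = .yielded c b → (π (m + 1)).IsConf := by
    intro m c b hm
    obtain ⟨a₁, h₁, a₂, h₂, e⟩ := h m
    rw [hm] at h₁ h₂ e
    obtain ⟨u, _, e'⟩ := G.next_yielded h₁ h₂
    exact ⟨_, e.trans e'⟩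
  rcases hm : π m with c | ⟨c, b₁, b₂⟩ | ⟨c, b⟩
  · exact ⟨m, le_rfl, c, hm⟩
  · obtain ⟨a₁, h₁, a₂, h₂, e⟩ := h m
    rw [hm] at h₁ h₂ e
    rcases G.next_bids h₁ h₂ with ⟨w, u, _, _, e'⟩ | ⟨u, _, _, e'⟩ | ⟨_, e'⟩
    · exact ⟨m + 1, by omega, _, e.trans e'⟩
    · exact ⟨m + 1, by omega, _, e.trans e'⟩
    · exact ⟨m + 2, by omega, hy _ _ _ (e.trans e')⟩
  · exact ⟨m + 1, by omega, hy _ _ _ hm⟩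

/-- On legal plays, the objective can be evaluated on the token positions of all vertices, since
these slow down the path of the token. -/
theorem mem_objective_iff {π : ℕ → BidVertex G.n G.N} (h₀ : (π 0).IsConf)
    (h : ∀ m, G.Step (π m) (π (m + 1))) :
    π ∈ G.objective ↔ (fun m => (π m).tok) ∈ G.cond.paths := by
  have key : ∀ φ : ℕ → ℕ, StrictMono φ → Set.range φ = {m | (π m).IsConf} →
      ((fun m => (π m).tok) ∈ G.cond.paths ↔ (fun j => (π (φ j)).tok) ∈ G.cond.paths) := by
    intro φ hφ hr
    have hφ0 : φ 0 = 0 := by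
      obtain ⟨j, hj⟩ : 0 ∈ Set.range φ := by rw [hr]; exact h₀
      have := hφ.monotone (Nat.zero_le j)
      omega
    have hex : ∀ m, ∃ j, φ j ≤ m ∧ m < φ (j + 1) := by
      intro m
      induction m with
      | zero => exact ⟨0, by omega, by have := hφ (Nat.lt_succ_self 0); simpa [hφ0] using this⟩
      | succ m ih =>
        obtain ⟨j, h1, h2⟩ := ih
        rcases Nat.lt_or_ge (m + 1) (φ (j + 1)) with h3 | h3
        · exact ⟨j, by omega, h3⟩
        · exact ⟨j + 1, h3, lt_of_le_of_lt h2 (hφ (Nat.lt_succ_self (j + 1)))⟩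
    choose τ hτ1 hτ2 using hex
    have hτ : ∀ m, (π m).tok = (π (φ (τ m))).tok := by
      intro m
      have : ∀ i, φ (τ m) + i ≤ m → (π (φ (τ m) + i)).tok = (π (φ (τ m))).tok := by
        intro i
        induction i with
        | zero => intro _; rfl
        | succ i ih =>
          intro hi
          obtain ⟨a₁, h₁, a₂, h₂, e⟩ := h (φ (τ m) + i)
          rcases G.next_tok h₁ h₂ with hc | hc
          · rw [← e] at hc
            obtain ⟨j, hj⟩ : φ (τ m) + i + 1 ∈ Set.range φ := by rw [hr]; exact hc
            have h3 := hφ.lt_iff_lt.1 (show φ (τ m) < φ j by omega)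
            have h4 := hφ.monotone (show τ m + 1 ≤ j from h3)
            have := hτ2 m
            omega
          · rw [← e] at hc
            rw [← ih (by omega), ← hc]
            rfl
      have := this (m - φ (τ m)) (by have := hτ1 m; omega)
      rwa [Nat.add_sub_cancel' (hτ1 m)] at this
    have e : (fun m => (π m).tok) = fun m => (fun j => (π (φ j)).tok) (τ m) := funext hτ
    rw [e]
    refine G.cond.paths_stutterInvariant (fun j => (π (φ j)).tok) τ ?_ ?_
    · intro m m' hm
      have h1 := hτ1 m
      have h2 := hτ2 m'
      have := hφ.lt_iff_lt.1 (show φ (τ m) < φ (τ m' + 1) by omega)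
      omega
    · intro j
      refine ⟨φ j, ?_⟩
      have h1 := hφ.le_iff_le.1 (hτ1 (φ j))
      have h2 := hφ.lt_iff_lt.1 (hτ2 (φ j))
      omega
  constructor
  · rintro ⟨ρ, hρ, φ, hφ, hr, hc⟩
    refine (key φ hφ hr).2 ?_
    convert hρ using 1
    funext j
    obtain ⟨c, e, e'⟩ := hc j
    show (π (φ j)).tok = _
    rw [e]
    exact e'
  · intro hp
    have hinf : {m | (π m).IsConf}.Infinite := by
      refine Set.infinite_of_not_bddAbove fun ⟨b, hb⟩ => ?_
      obtain ⟨m, hm, hc⟩ := G.exists_isConf_of_step h (b + 1)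
      have := hb hc
      omega
    have hφ := Nat.nth_strictMono hinf
    have hr := Nat.range_nth_of_infinite hinf
    refine ⟨_, (key _ hφ hr).1 hp, _, hφ, hr, fun j => ?_⟩
    obtain ⟨c, hc⟩ : (π (Nat.nth (fun m => (π m).IsConf) j)).IsConf :=
      Nat.nth_mem_of_infinite hinf j
    exact ⟨c, hc, by rw [hc]; rfl⟩

theorem step_path {s₁ s₂ : Strategy (BidAction G.n G.N) (BidVertex G.n G.N)}
    (h₁ : G.arena.Legal .one s₁) (h₂ : G.arena.Legal .two s₂) (x : BidVertex G.n G.N) (m : ℕ) :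
    G.Step (G.arena.path s₁ s₂ x m) (G.arena.path s₁ s₂ x (m + 1)) :=
  ⟨_, h₁ _ _, _, h₂ _ _, rfl⟩

theorem winsFrom_iff (i : Player) (c : Config G.n G.N) :
    G.WinsFrom i c ↔ G.arena.Wins {π | (fun m => (π m).tok) ∈ G.cond.paths} i (.conf c) :=
  Arena.wins_congr i fun _ _ h₁ h₂ => G.mem_objective_iff ⟨c, rfl⟩ (G.step_path h₁ h₂ _)

end BiddingGame

end BidGame

/-! ### From bidding games to turn-based games -/

namespace BidGame

theorem sinkIndex_injective : Function.Injective sinkIndex := by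
  intro i j h
  cases i <;> cases j <;> first | rfl | simp [sinkIndex] at h

/-- The product of the ranges of `4` phases of a turn, the position of the token, the budget of
Player 1, the holder of the advantage and the bids of the players. -/
abbrev Node (n N : ℕ) : Type :=
  Fin 4 × Fin n × Fin (N + 1) × Fin 2 × Fin (N + 1) × Fin (N + 1)

/-- The number of nodes. -/
abbrev nodeCount (n N : ℕ) : ℕ := 4 * (n * ((N + 1) * (2 * ((N + 1) * (N + 1)))))

/-- The lexicographic numbering of the nodes. -/
def nodeEquiv (n N : ℕ) : Node n N ≃ Fin (nodeCount n N) :=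
  (Equiv.prodCongr (.refl _) ((Equiv.prodCongr (.refl _) ((Equiv.prodCongr (.refl _)
    ((Equiv.prodCongr (.refl _) finProdFinEquiv).trans finProdFinEquiv)).trans
    finProdFinEquiv)).trans finProdFinEquiv)).trans finProdFinEquiv

/-- The edges between nodes `(κ, v, B, s, b, d)` and `(κ', v', B', s', b', d')`, where `e` says that
there is an edge from `v` to `v'` in the bidding game. In the phases `κ = 0`, `1`, Player 1 reveals
his bid `b` and Player 2 answers with the bid `d`; in phase `2`, the token is moved or the holder
`s` of the advantage lets the other player win, who then moves the token in phase `3`. -/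
def NodeEdge (N : ℕ) (e : Prop) (κ v B s b d κ' v' B' s' b' d' : ℕ) : Prop :=
  (κ = 0 ∧ κ' = 1 ∧ v' = v ∧ B' = B ∧ s' = s ∧ b' ≤ B ∧ d' = 0) ∨
  (κ = 1 ∧ κ' = 2 ∧ v' = v ∧ B' = B ∧ s' = s ∧ b' = b ∧ d' ≤ N - B) ∨
  (κ = 2 ∧ κ' = 0 ∧ e ∧ b' = 0 ∧ d' = 0 ∧
    ((d < b ∧ B' = B - b ∧ s' = s) ∨ (b < d ∧ B' = B + (d - (d - (N - B))) ∧ s' = s) ∨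
      (b = d ∧ s = 0 ∧ B' = B - b ∧ s' = 1) ∨
      (b = d ∧ s = 1 ∧ B' = B + (b - (b - (N - B))) ∧ s' = 0))) ∨
  (κ = 2 ∧ κ' = 3 ∧ b = d ∧ v' = v ∧ B' = B ∧ s' = s ∧ b' = b ∧ d' = d) ∨
  (κ = 3 ∧ κ' = 0 ∧ e ∧ b' = 0 ∧ d' = 0 ∧
    ((s = 0 ∧ B' = B + (b - (b - (N - B)))) ∨ (s = 1 ∧ B' = B - b)) ∧ s' = s)

theorem nodeEdge_two {N v B s b d κ' v' B' s' b' d' : ℕ} {e : Prop} :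
    NodeEdge N e 2 v B s b d κ' v' B' s' b' d' ↔
      (κ' = 0 ∧ e ∧ b' = 0 ∧ d' = 0 ∧
        ((d < b ∧ B' = B - b ∧ s' = s) ∨ (b < d ∧ B' = B + (d - (d - (N - B))) ∧ s' = s) ∨
          (b = d ∧ s = 0 ∧ B' = B - b ∧ s' = 1) ∨
          (b = d ∧ s = 1 ∧ B' = B + (b - (b - (N - B))) ∧ s' = 0))) ∨
      (κ' = 3 ∧ b = d ∧ v' = v ∧ B' = B ∧ s' = s ∧ b' = b ∧ d' = d) := by
  simp [NodeEdge]

theorem nodeEdge_three {N v B s b d κ' v' B' s' b' d' : ℕ} {e : Prop} :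
    NodeEdge N e 3 v B s b d κ' v' B' s' b' d' ↔
      κ' = 0 ∧ e ∧ b' = 0 ∧ d' = 0 ∧
        ((s = 0 ∧ B' = B + (b - (b - (N - B)))) ∨ (s = 1 ∧ B' = B - b)) ∧ s' = s := by
  simp [NodeEdge]

/-- The node belongs to Player 2. -/
def NodeOwnerTwo (κ s b d : ℕ) : Prop :=
  κ = 1 ∨ (κ = 2 ∧ (b < d ∨ (b = d ∧ s = 1))) ∨ (κ = 3 ∧ s = 0)

instance (N : ℕ) (e : Prop) [Decidable e] (κ v B s b d κ' v' B' s' b' d' : ℕ) :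
    Decidable (NodeEdge N e κ v B s b d κ' v' B' s' b' d') := by
  unfold NodeEdge; infer_instance

instance (κ s b d : ℕ) : Decidable (NodeOwnerTwo κ s b d) := by
  unfold NodeOwnerTwo; infer_instance

namespace BiddingGame

variable {k : Objective} (G : BiddingGame k)

/-- The edges between nodes. -/
def Edge (x y : Node G.n G.N) : Prop :=
  NodeEdge G.N (G.edge x.2.1 y.2.1 = true) x.1 x.2.1 x.2.2.1 x.2.2.2.1 x.2.2.2.2.1 x.2.2.2.2.2
    y.1 y.2.1 y.2.2.1 y.2.2.2.1 y.2.2.2.2.1 y.2.2.2.2.2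

instance (x y : Node G.n G.N) : Decidable (G.Edge x y) := by unfold Edge; infer_instance

/-- The owners of the nodes. -/
def nodeOwner (x : Node G.n G.N) : Player :=
  if NodeOwnerTwo x.1 x.2.2.2.1 x.2.2.2.2.1 x.2.2.2.2.2 then .two else .one

theorem exists_edge (x : Node G.n G.N) : ∃ y, G.Edge x y := by
  obtain ⟨κ, v, B, s, b, d⟩ := x
  obtain ⟨u, hu⟩ := G.no_dead_end v
  have hB := B.isLt
  have hs := s.isLt
  have h0 : 0 < G.N + 1 := Nat.succ_pos _
  have hκ : κ = 0 ∨ κ = 1 ∨ κ = 2 ∨ κ = 3 := by fin_cases κ <;> simp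
  rcases hκ with rfl | rfl | rfl | rfl
  · exact ⟨(1, v, B, s, 0, 0), by simp [Edge, NodeEdge]⟩
  · exact ⟨(2, v, B, s, b, 0), by simp [Edge, NodeEdge]⟩
  · rcases lt_trichotomy (b : ℕ) d with h | h | h
    · exact ⟨(0, u, ⟨B + (d - (d - (G.N - B))), by omega⟩, s, 0, 0),
        .inr (.inr (.inl ⟨rfl, rfl, hu, rfl, rfl, .inr (.inl ⟨h, rfl, rfl⟩)⟩))⟩
    · exact ⟨(3, v, B, s, b, d),
        .inr (.inr (.inr (.inl ⟨rfl, rfl, h, rfl, rfl, rfl, rfl, rfl⟩)))⟩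
    · exact ⟨(0, u, ⟨B - b, by omega⟩, s, 0, 0),
        .inr (.inr (.inl ⟨rfl, rfl, hu, rfl, rfl, .inl ⟨h, rfl, rfl⟩⟩))⟩
  · rcases (show (s : ℕ) = 0 ∨ (s : ℕ) = 1 by omega) with h | h
    · exact ⟨(0, u, ⟨B + (b - (b - (G.N - B))), by omega⟩, s, 0, 0),
        .inr (.inr (.inr (.inr ⟨rfl, rfl, hu, rfl, rfl, .inl ⟨h, rfl⟩, rfl⟩)))⟩
    · exact ⟨(0, u, ⟨B - b, by omega⟩, s, 0, 0),
        .inr (.inr (.inr (.inr ⟨rfl, rfl, hu, rfl, rfl, .inr ⟨h, rfl⟩, rfl⟩)))⟩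

/-- The turn-based game in which Player 1 reveals his bid first. -/
def toTurnBased : TurnBasedGame k where
  n := nodeCount G.n G.N
  edge q q' := decide (G.Edge ((nodeEquiv _ _).symm q) ((nodeEquiv _ _).symm q'))
  no_dead_end q := by
    obtain ⟨y, hy⟩ := G.exists_edge ((nodeEquiv _ _).symm q)
    exact ⟨nodeEquiv _ _ y, by simpa using hy⟩
  owner q := G.nodeOwner ((nodeEquiv _ _).symm q)
  cond := G.cond.withSinks fun q => .inl ((nodeEquiv _ _).symm q).2.1

variable {G}

theorem budget_one_lt (c : Config G.n G.N) : c.budget .one < G.N + 1 := by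
  have := c.total
  omega

/-- The node in a given phase of a turn that started in the configuration `c`. -/
def node (κ : Fin 4) (c : Config G.n G.N) (b d : Fin (G.N + 1)) : Node G.n G.N :=
  (κ, c.vertex, ⟨c.budget .one, budget_one_lt c⟩, sinkIndex c.adv, b, d)

/-- The node that represents a vertex of the concurrent game. -/
def embed : BidVertex G.n G.N → Node G.n G.N
  | .conf c => node 0 c 0 0
  | .bids c b₁ b₂ => node 2 c b₁ b₂
  | .yielded c b => node 3 c b b

theorem eq_node_iff {y : Node G.n G.N} {κ : Fin 4} {c : Config G.n G.N} {b d : Fin (G.N + 1)} :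
    y = node κ c b d ↔ (y.1 : ℕ) = κ ∧ (y.2.1 : ℕ) = c.vertex ∧
      (y.2.2.1 : ℕ) = c.budget .one ∧ (y.2.2.2.1 : ℕ) = sinkIndex c.adv ∧
      (y.2.2.2.2.1 : ℕ) = b ∧ (y.2.2.2.2.2 : ℕ) = d := by
  obtain ⟨κ', v, B, s, b', d'⟩ := y
  simp only [node, Prod.mk.injEq, Fin.ext_iff]

theorem edge_node {y : Node G.n G.N} {κ : Fin 4} {c : Config G.n G.N} {b d : Fin (G.N + 1)} :
    G.Edge (node κ c b d) y ↔ NodeEdge G.N (G.edge c.vertex y.2.1 = true) κ c.vertex (c.budget .one)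
      (sinkIndex c.adv) b d y.1 y.2.1 y.2.2.1 y.2.2.2.1 y.2.2.2.2.1 y.2.2.2.2.2 :=
  Iff.rfl

theorem edge_embed_conf {c : Config G.n G.N} {y : Node G.n G.N} :
    G.Edge (embed (.conf c)) y ↔
      ∃ b : Fin (G.N + 1), (b : ℕ) ≤ c.budget .one ∧ y = node 1 c b 0 := by
  simp only [embed, edge_node, eq_node_iff, NodeEdge]
  have e0 : ((0 : Fin 4) : ℕ) = 0 := rfl
  have e1 : ((1 : Fin 4) : ℕ) = 1 := rfl
  have e0' : ((0 : Fin (G.N + 1)) : ℕ) = 0 := rfl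
  constructor
  · intro h
    exact ⟨y.2.2.2.2.1, by omega⟩
  · rintro ⟨b, h⟩
    omega

theorem edge_reveal {c : Config G.n G.N} {b : Fin (G.N + 1)} {y : Node G.n G.N} :
    G.Edge (node 1 c b 0) y ↔
      ∃ d : Fin (G.N + 1), (d : ℕ) ≤ c.budget .two ∧ y = embed (.bids c b d) := by
  simp only [embed, edge_node, eq_node_iff, NodeEdge]
  have e1 : ((1 : Fin 4) : ℕ) = 1 := rfl
  have e2 : ((2 : Fin 4) : ℕ) = 2 := rfl
  have := c.total
  constructor
  · intro h
    exact ⟨y.2.2.2.2.2, by omega⟩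
  · rintro ⟨d, h⟩
    omega

/-- The player who decides how an intermediate vertex is left. -/
def controller : BidVertex G.n G.N → Player
  | .conf _ => .one
  | .bids c b₁ b₂ => (higherBidder b₁ b₂).getD c.adv
  | .yielded c _ => c.adv.other

/-- The possible successors of an intermediate vertex. -/
def Succ : BidVertex G.n G.N → BidVertex G.n G.N → Prop
  | .conf _, _ => False
  | .bids c b₁ b₂, y => match higherBidder b₁ b₂ with
    | some w => ∃ u, G.edge c.vertex u = true ∧
        y = .conf (c.update w (w.pick b₁ b₂ : Fin (G.N + 1)) c.adv u)
    | none => y = .yielded c b₁ ∨ ∃ u, G.edge c.vertex u = true ∧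
        y = .conf (c.update c.adv b₁ c.adv.other u)
  | .yielded c b, y => ∃ u, G.edge c.vertex u = true ∧
      y = .conf (c.update c.adv.other b c.adv u)

theorem pick_self {A : Type} (i : Player) (a a' : A) : i.pick (i.pick a a') (i.pick a' a) = a := by
  cases i <;> rfl

/-- The action of the controller determines the successor. -/
theorem controller_next {x : BidVertex G.n G.N} (hx : ¬ x.IsConf) {a : BidAction G.n G.N}
    (ha : a ∈ G.allowed x (controller x)) : ∃ y, Succ x y ∧
      ∀ a', G.next x ((controller x).pick a a') ((controller x).pick a' a) = y := by
  rcases x with c | ⟨c, b₁, b₂⟩ | ⟨c, b⟩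
  · exact absurd ⟨c, rfl⟩ hx
  · rcases hb : higherBidder b₁ b₂ with _ | w
    · simp only [allowed, controller, hb, Option.getD_none, if_true] at ha
      simp only [controller, Succ, hb, Option.getD_none, next, pick_self]
      rcases ha with rfl | ⟨u, hu, rfl⟩
      · exact ⟨_, .inl rfl, fun _ => rfl⟩
      · exact ⟨_, .inr ⟨u, hu, rfl⟩, fun _ => rfl⟩
    · simp only [allowed, controller, hb, Option.getD_some, if_true] at ha
      simp only [controller, Succ, hb, Option.getD_some, next, pick_self]
      obtain ⟨u, hu, rfl⟩ := ha
      exact ⟨_, ⟨u, hu, rfl⟩, fun _ => rfl⟩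
  · simp only [allowed, controller, if_true] at ha
    simp only [controller, Succ, next, pick_self]
    obtain ⟨u, hu, rfl⟩ := ha
    exact ⟨_, ⟨u, hu, rfl⟩, fun _ => rfl⟩

/-- Every successor is chosen by some action of the controller. -/
theorem exists_next_of_succ {x y : BidVertex G.n G.N} (h : Succ x y) :
    ∃ a ∈ G.allowed x (controller x),
      ∀ a', G.next x ((controller x).pick a a') ((controller x).pick a' a) = y := by
  rcases x with c | ⟨c, b₁, b₂⟩ | ⟨c, b⟩
  · exact absurd h id
  · rcases hb : higherBidder b₁ b₂ with _ | w
    · simp only [Succ, hb] at h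
      simp only [controller, allowed, hb, Option.getD_none, next, pick_self, if_true]
      rcases h with rfl | ⟨u, hu, rfl⟩
      · exact ⟨_, .inl rfl, fun _ => rfl⟩
      · exact ⟨_, .inr ⟨u, hu, rfl⟩, fun _ => rfl⟩
    · simp only [Succ, hb] at h
      simp only [controller, allowed, hb, Option.getD_some, next, pick_self, if_true]
      obtain ⟨u, hu, rfl⟩ := h
      exact ⟨_, ⟨u, hu, rfl⟩, fun _ => rfl⟩
  · simp only [Succ] at h
    simp only [controller, allowed, next, pick_self, if_true]
    obtain ⟨u, hu, rfl⟩ := h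
    exact ⟨_, ⟨u, hu, rfl⟩, fun _ => rfl⟩

theorem higherBidder_cases (b₁ b₂ : ℕ) : (b₂ < b₁ ∧ higherBidder b₁ b₂ = some .one) ∨
    (b₁ < b₂ ∧ higherBidder b₁ b₂ = some .two) ∨ (b₁ = b₂ ∧ higherBidder b₁ b₂ = none) := by
  unfold higherBidder
  rcases lt_trichotomy b₁ b₂ with h | h | h
  · exact .inr (.inl ⟨h, by simp [h, h.le]⟩)
  · exact .inr (.inr ⟨h, by simp [h]⟩)
  · exact .inl ⟨h, by simp [h]⟩

theorem nodeOwner_embed {x : BidVertex G.n G.N} : G.nodeOwner (embed x) = controller x := by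
  rcases x with c | ⟨c, b₁, b₂⟩ | ⟨c, b⟩
  · exact if_neg (by simp [NodeOwnerTwo, embed, node])
  · rcases higherBidder_cases b₁ b₂ with ⟨h, e⟩ | ⟨h, e⟩ | ⟨h, e⟩
    · simp only [controller, e, Option.getD_some]
      refine if_neg ?_
      rintro (h' | ⟨_, h'⟩ | ⟨h', _⟩)
      · simp [embed, node] at h'
      · simp only [embed, node] at h'
        omega
      · simp [embed, node] at h'
    · simp only [controller, e, Option.getD_some]
      exact if_pos (.inr (.inl ⟨rfl, .inl h⟩))
    · simp only [controller, e, Option.getD_none]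
      cases hs : c.adv
      · refine if_neg ?_
        rintro (h' | ⟨_, h'⟩ | ⟨h', _⟩)
        · simp [embed, node] at h'
        · simp only [embed, node, hs, sinkIndex, Fin.val_zero] at h'
          omega
        · simp [embed, node] at h'
      · exact if_pos (.inr (.inl ⟨rfl, .inr ⟨h, by simp [embed, node, hs, sinkIndex]⟩⟩))
  · cases hs : c.adv <;>
      simp [nodeOwner, NodeOwnerTwo, embed, node, controller, hs, sinkIndex, Player.other]

theorem nodeOwner_reveal {c : Config G.n G.N} {b : Fin (G.N + 1)} :
    G.nodeOwner (node 1 c b 0) = .two :=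
  if_pos (.inl rfl)

theorem update_budget_one (c : Config G.n G.N) (a : ℕ) (s : Player) (u : Fin G.n) :
    (c.update .one a s u).budget .one = c.budget .one - min a (c.budget .one) :=
  by simp [Config.update]

theorem update_budget_two (c : Config G.n G.N) (a : ℕ) (s : Player) (u : Fin G.n) :
    (c.update .two a s u).budget .one = c.budget .one + min a (c.budget .two) :=
  by simp [Config.update]

/-- The edges from the node of an intermediate vertex lead to the nodes of its successors. -/
theorem edge_embed {x : BidVertex G.n G.N} (hx : ¬ x.IsConf) {y : Node G.n G.N} :
    G.Edge (embed x) y ↔ ∃ z, Succ x z ∧ y = embed z := by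
  have e0 : ((0 : Fin 4) : ℕ) = 0 := rfl
  have e2 : ((2 : Fin 4) : ℕ) = 2 := rfl
  have e3 : ((3 : Fin 4) : ℕ) = 3 := rfl
  have e0' : ((0 : Fin (G.N + 1)) : ℕ) = 0 := rfl
  have s1 : (sinkIndex .one : ℕ) = 0 := rfl
  have s2 : (sinkIndex .two : ℕ) = 1 := rfl
  have hup : ∀ (c : Config G.n G.N) (w s : Player) (a : ℕ),
      (∃ z, (∃ u, G.edge c.vertex u = true ∧ z = .conf (c.update w a s u)) ∧ y = embed z) ↔
      ((y.1 : ℕ) = 0 ∧ G.edge c.vertex y.2.1 = true ∧ (y.2.2.2.2.1 : ℕ) = 0 ∧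
        (y.2.2.2.2.2 : ℕ) = 0 ∧ (y.2.2.1 : ℕ) = (c.update w a s c.vertex).budget .one ∧
        (y.2.2.2.1 : ℕ) = sinkIndex s) := by
    intro c w s a
    constructor
    · rintro ⟨_, ⟨u, h1, rfl⟩, h⟩
      obtain ⟨h2, h3, h5, h6, h7, h8⟩ := eq_node_iff.1 h
      obtain rfl : y.2.1 = u := Fin.ext h3
      exact ⟨h2, h1, h7, h8, h5, h6⟩
    · rintro ⟨h2, h1, h3, h4, h5, h6⟩
      exact ⟨_, ⟨y.2.1, h1, rfl⟩, eq_node_iff.2 ⟨h2, rfl, h5, h6, h3, h4⟩⟩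
  rcases x with c | ⟨c, b₁, b₂⟩ | ⟨c, b⟩
  · exact absurd ⟨c, rfl⟩ hx
  · have ht := c.total
    have hb1 : c.budget .one - min (b₁ : ℕ) (c.budget .one) = c.budget .one - b₁ := by omega
    have hb2 : ∀ x, x - (x - (G.N - c.budget .one)) = min x (c.budget .two) := by omega
    rcases higherBidder_cases b₁ b₂ with ⟨h, e⟩ | ⟨h, e⟩ | ⟨h, e⟩
    · simp only [Succ, e]
      rw [hup]
      simp only [embed, edge_node, e2, nodeEdge_two, Player.pick, update_budget_one, hb1, h,
        h.not_gt, h.ne', true_and, false_and, and_false, or_false]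
    · simp only [Succ, e]
      rw [hup]
      simp only [embed, edge_node, e2, nodeEdge_two, Player.pick, update_budget_two, hb2, h,
        h.not_gt, h.ne, true_and, false_and, and_false, or_false, false_or]
    · have hor : (∃ z, Succ (.bids c b₁ b₂) z ∧ y = embed z) ↔
          (∃ z, (∃ u, G.edge c.vertex u = true ∧ z = .conf (c.update c.adv b₁ c.adv.other u)) ∧
            y = embed z) ∨ y = embed (.yielded c b₁) := by
        simp only [Succ, e, or_and_right, exists_or, exists_eq_left, or_comm]
      rw [hor, hup]
      obtain rfl : b₂ = b₁ := Fin.ext h.symm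
      cases hs : c.adv
      · simp only [embed, edge_node, nodeEdge_two, e2, e3, Player.other, eq_node_iff, hs, s1,
          s2, update_budget_one, hb1, lt_self_iff_false, zero_ne_one, true_and, false_and,
          or_false, false_or]
      · simp only [embed, edge_node, nodeEdge_two, e2, e3, Player.other, eq_node_iff, hs, s1,
          s2, update_budget_two, hb2, lt_self_iff_false, one_ne_zero, true_and, false_and,
          false_or]
  · have ht := c.total
    have hb1 : c.budget .one - min (b : ℕ) (c.budget .one) = c.budget .one - b := by omega
    have hb2 : ∀ x, x - (x - (G.N - c.budget .one)) = min x (c.budget .two) := by omega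
    simp only [Succ]
    rw [hup]
    cases hs : c.adv
    · simp only [hs, embed, edge_node, nodeEdge_three, e3, Player.other, s1,
        update_budget_two, hb2, zero_ne_one, true_and, false_and, or_false]
    · simp only [hs, embed, edge_node, nodeEdge_three, e3, Player.other, s2,
        update_budget_one, hb1, one_ne_zero, true_and, false_and, false_or]

end BiddingGame

end BidGame

namespace BidGame

open Arena

namespace TurnBasedGame

variable {k : Objective} {G : TurnBasedGame k} {q a : Fin G.n} {i : Player}

theorem mem_allowed : a ∈ G.arena.allowed q i ↔ (i = G.owner q → G.edge q a = true) := by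
  by_cases h : i = G.owner q
  · rw [show G.arena.allowed q i = {u | G.edge q u = true} from if_pos h]
    exact ⟨fun h' _ => h', fun h' => h' h⟩
  · rw [show G.arena.allowed q i = Set.univ from if_neg h]
    exact ⟨fun _ h' => absurd h' h, fun _ => trivial⟩

theorem next_eq {a₁ a₂ : Fin G.n} : G.arena.next q a₁ a₂ = (G.owner q).pick a₁ a₂ :=
  rfl

end TurnBasedGame

namespace BiddingGame

variable {k : Objective} {G : BiddingGame k}

/-- The vertex of the turn-based game that has the number of a node. -/
def vertexOf (x : Node G.n G.N) : Fin G.toTurnBased.n := nodeEquiv _ _ x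

/-- The token position of a vertex of the turn-based game. -/
def vertexTok (q : Fin G.toTurnBased.n) : Fin G.n := ((nodeEquiv G.n G.N).symm q).2.1

theorem vertexTok_vertexOf (x : Node G.n G.N) : vertexTok (vertexOf x) = x.2.1 := by
  simp only [vertexTok, vertexOf, Equiv.symm_apply_apply]

theorem vertexOf_surjective (q : Fin G.toTurnBased.n) : ∃ x : Node G.n G.N, q = vertexOf x :=
  ⟨_, ((nodeEquiv G.n G.N).apply_symm_apply q).symm⟩

theorem owner_vertexOf (x : Node G.n G.N) : G.toTurnBased.owner (vertexOf x) = G.nodeOwner x := by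
  simp only [toTurnBased, vertexOf, Equiv.symm_apply_apply]

theorem edge_vertexOf {x y : Node G.n G.N} :
    G.toTurnBased.edge (vertexOf x) (vertexOf y) = true ↔ G.Edge x y := by
  simp only [toTurnBased, vertexOf, Equiv.symm_apply_apply, decide_eq_true_eq]

theorem toTurnBased_paths {π : ℕ → Fin G.toTurnBased.n} :
    π ∈ G.toTurnBased.cond.paths ↔ (fun m => vertexTok (π m)) ∈ G.cond.paths :=
  (Condition.mem_paths_withSinks _ G.cond π fun _ _ h => Sum.inl_ne_inr h |>.elim).trans
    Condition.inl_mem_labelPaths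

theorem vertexTok_embed (x : BidVertex G.n G.N) : vertexTok (vertexOf (embed x)) = x.tok := by
  rw [vertexTok_vertexOf]
  cases x <;> rfl

/-- Player 1 wins the turn-based game if he wins the bidding game: he reveals the bids of a winning
strategy. -/
theorem wins_toTurnBased (c : Config G.n G.N) (h : G.WinsFrom .one c) :
    G.toTurnBased.arena.Wins G.toTurnBased.cond.paths .one (vertexOf (embed (.conf c))) := by
  classical
  have hset : G.toTurnBased.cond.paths = {π | (fun m => vertexTok (π m)) ∈ G.cond.paths} :=
    Set.ext fun _ => toTurnBased_paths
  rw [hset]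
  rw [winsFrom_iff] at h
  refine Wins.transfer (Condition.paths_stutterInvariant _) ∅ ∅ (by simp) (by simp) (by simp)
    (by simp)
    (fun p a q => q = vertexOf (embed p) ∨ ∃ c b, p = .conf c ∧ a = .bid b ∧
      q = vertexOf (node 1 c b 0))
    (fun _ q => if ∃ c, q = vertexOf (embed (.conf c)) then 1 else 0) ?_ ?_
    (fun a _ => .inl rfl) h
  · rintro p a q (rfl | ⟨c, b, rfl, rfl, rfl⟩)
    · exact (vertexTok_embed p).symm
    · rw [vertexTok_vertexOf]
      rfl
  · rintro p a q (rfl | ⟨c, b, rfl, rfl, rfl⟩) ha -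
    · refine .inr (.inr ?_)
      by_cases hp : p.IsConf
      · obtain ⟨c, rfl⟩ := hp
        obtain ⟨b, hb, rfl⟩ := ha
        have ho : G.toTurnBased.owner (vertexOf (embed (.conf c))) = .one :=
          (owner_vertexOf _).trans nodeOwner_embed
        refine ⟨vertexOf (node 1 c b 0), ?_, fun b' _ => .inr (.inl ?_)⟩
        · exact TurnBasedGame.mem_allowed.2 fun _ =>
            edge_vertexOf.2 (edge_embed_conf.2 ⟨b, hb, rfl⟩)
        · rw [TurnBasedGame.next_eq, ho]
          refine ⟨.inr ⟨c, b, rfl, rfl, rfl⟩, ?_⟩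
          refine lt_of_lt_of_eq (lt_of_eq_of_lt (if_neg ?_) zero_lt_one) (if_pos ⟨c, rfl⟩).symm
          rintro ⟨c', h'⟩
          have := congrArg Prod.fst ((nodeEquiv G.n G.N).injective h')
          simp [embed, node] at this
      · have ho : G.toTurnBased.owner (vertexOf (embed p)) = controller p :=
          (owner_vertexOf _).trans nodeOwner_embed
        cases hc : controller p
        · obtain ⟨y, hy, hn⟩ := controller_next hp (hc ▸ ha)
          rw [hc] at hn
          refine ⟨vertexOf (embed y), ?_, fun b' _ => .inr (.inr ?_)⟩
          · exact TurnBasedGame.mem_allowed.2 fun _ =>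
              edge_vertexOf.2 ((edge_embed hp).2 ⟨y, hy, rfl⟩)
          · obtain ⟨b, hb⟩ := G.allowed_nonempty p .two
            refine ⟨b, hb, fun _ _ => .inl ?_⟩
            rw [TurnBasedGame.next_eq, ho, hc]
            exact congrArg (fun x => vertexOf (embed x)) (hn b).symm
        · obtain ⟨a', ha'⟩ := G.toTurnBased.arena.allowed_nonempty (vertexOf (embed p)) .one
          refine ⟨a', ha', fun b' hb' => .inr (.inr ?_)⟩
          obtain ⟨z, rfl⟩ := vertexOf_surjective b'
          have he := edge_vertexOf.1 (TurnBasedGame.mem_allowed.1 hb' (ho.trans hc).symm)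
          obtain ⟨y, hy, rfl⟩ := (edge_embed hp).1 he
          obtain ⟨b, hb, hn⟩ := exists_next_of_succ hy
          rw [hc] at hb hn
          refine ⟨b, hb, fun _ _ => .inl ?_⟩
          rw [TurnBasedGame.next_eq, ho, hc]
          exact congrArg (fun x => vertexOf (embed x)) (hn a).symm
    · have ho : G.toTurnBased.owner (vertexOf (node 1 c b 0)) = .two :=
        (owner_vertexOf _).trans nodeOwner_reveal
      obtain ⟨a', ha'⟩ := G.toTurnBased.arena.allowed_nonempty (vertexOf (node 1 c b 0)) .one
      refine .inr (.inr ⟨a', ha', fun b' hb' => .inr (.inr ?_)⟩)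
      obtain ⟨z, rfl⟩ := vertexOf_surjective b'
      have he := edge_vertexOf.1 (TurnBasedGame.mem_allowed.1 hb' ho.symm)
      obtain ⟨d, hd, rfl⟩ := edge_reveal.1 he
      refine ⟨.bid d, ⟨d, hd, rfl⟩, fun _ _ => .inl ?_⟩
      rw [TurnBasedGame.next_eq, ho]
      rfl

/-- Player 1 wins the bidding game if he wins the turn-based game, since his winning strategy there
does not need to know the bids of Player 2. -/
theorem wins_of_toTurnBased (c : Config G.n G.N)
    (h : G.toTurnBased.arena.Wins G.toTurnBased.cond.paths .one (vertexOf (embed (.conf c)))) :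
    G.WinsFrom .one c := by
  classical
  have hset : G.toTurnBased.cond.paths = {π | (fun m => vertexTok (π m)) ∈ G.cond.paths} :=
    Set.ext fun _ => toTurnBased_paths
  rw [hset] at h
  rw [winsFrom_iff]
  refine Wins.transfer (Condition.paths_stutterInvariant _) ∅ ∅ (by simp) (by simp) (by simp)
    (by simp)
    (fun q _ p => q = vertexOf (embed p) ∨ ∃ (c : Config G.n G.N) (b : Fin (G.N + 1)),
      (b : ℕ) ≤ c.budget .one ∧ p = .conf c ∧ q = vertexOf (node 1 c b 0))
    (fun q _ => if ∃ c, q = vertexOf (embed (.conf c)) then 1 else 0) ?_ ?_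
    (fun a _ => .inl rfl) h
  · rintro q a p (rfl | ⟨c, b, -, rfl, rfl⟩)
    · exact vertexTok_embed p
    · rw [vertexTok_vertexOf]
      rfl
  · rintro q a p (rfl | ⟨c, b, hbc, rfl, rfl⟩) ha -
    · by_cases hp : p.IsConf
      · obtain ⟨c, rfl⟩ := hp
        have ho : G.toTurnBased.owner (vertexOf (embed (.conf c))) = .one :=
          (owner_vertexOf _).trans nodeOwner_embed
        obtain ⟨z, rfl⟩ := vertexOf_surjective a
        obtain ⟨b, hb, rfl⟩ := edge_embed_conf.1
          (edge_vertexOf.1 (TurnBasedGame.mem_allowed.1 ha ho.symm))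
        obtain ⟨b', hb'⟩ := G.toTurnBased.arena.allowed_nonempty (vertexOf (embed (.conf c))) .two
        refine .inr (.inl ⟨b', hb', ?_, fun a₁ _ => .inr ⟨c, b, hb, rfl, ?_⟩⟩)
        · rw [TurnBasedGame.next_eq, ho]
          refine lt_of_lt_of_eq (lt_of_eq_of_lt (if_neg ?_) zero_lt_one) (if_pos ⟨c, rfl⟩).symm
          rintro ⟨c', h'⟩
          have := congrArg Prod.fst ((nodeEquiv G.n G.N).injective h')
          simp [embed, node] at this
        · rw [TurnBasedGame.next_eq, ho]
          rfl
      · refine .inr (.inr ?_)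
        have ho : G.toTurnBased.owner (vertexOf (embed p)) = controller p :=
          (owner_vertexOf _).trans nodeOwner_embed
        cases hc : controller p
        · obtain ⟨z, rfl⟩ := vertexOf_surjective a
          obtain ⟨y, hy, rfl⟩ := (edge_embed hp).1
            (edge_vertexOf.1 (TurnBasedGame.mem_allowed.1 ha (ho.trans hc).symm))
          obtain ⟨a', ha', hn⟩ := exists_next_of_succ hy
          rw [hc] at ha' hn
          refine ⟨a', ha', fun b' _ => .inr (.inr ?_)⟩
          obtain ⟨b, hb⟩ := G.toTurnBased.arena.allowed_nonempty (vertexOf (embed p)) .two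
          refine ⟨b, hb, fun _ _ => .inl ?_⟩
          rw [TurnBasedGame.next_eq, ho, hc]
          exact congrArg (fun x => vertexOf (embed x)) (hn b').symm
        · obtain ⟨a', ha'⟩ := G.allowed_nonempty p .one
          refine ⟨a', ha', fun b' hb' => .inr (.inr ?_)⟩
          obtain ⟨y, hy, hn⟩ := controller_next hp (hc ▸ hb')
          rw [hc] at hn
          refine ⟨vertexOf (embed y), ?_, fun _ _ => .inl ?_⟩
          · exact TurnBasedGame.mem_allowed.2 fun _ =>
              edge_vertexOf.2 ((edge_embed hp).2 ⟨y, hy, rfl⟩)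
          · rw [TurnBasedGame.next_eq, ho, hc]
            exact congrArg (fun x => vertexOf (embed x)) (hn a').symm
    · have ho : G.toTurnBased.owner (vertexOf (node 1 c b 0)) = .two :=
        (owner_vertexOf _).trans nodeOwner_reveal
      refine .inr (.inr ⟨.bid b, ⟨b, hbc, rfl⟩, ?_⟩)
      rintro _ ⟨d, hd, rfl⟩
      refine .inr (.inr ⟨vertexOf (embed (.bids c b d)), ?_, fun _ _ => .inl ?_⟩)
      · exact TurnBasedGame.mem_allowed.2 fun _ => edge_vertexOf.2 (edge_reveal.2 ⟨d, hd, rfl⟩)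
      · rw [TurnBasedGame.next_eq, ho]
        rfl

end BiddingGame

/-- The instance of the turn-based problem for an instance of the bidding problem. -/
def BidInstance.toTB {k : Objective} (x : BidInstance k) : TBInstance k where
  toTurnBasedGame := x.toTurnBased
  start := BiddingGame.vertexOf (BiddingGame.embed (.conf x.start))

theorem BidInstance.bidWin_iff {k : Objective} (x : BidInstance k) :
    BidWin x ↔ TBWin x.toTB :=
  ⟨BiddingGame.wins_toTurnBased x.start, BiddingGame.wins_of_toTurnBased x.start⟩

end BidGame

/-! ### From turn-based games to bidding games -/

namespace BidGame

open Arena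

theorem Player.other_ne (i : Player) : i.other ≠ i := by cases i <;> nofun

theorem Player.eq_or_eq_other (i j : Player) : j = i ∨ j = i.other := by
  cases i <;> cases j <;> simp [Player.other]

/-- A step of the concurrent game moves the token along an edge or not at all. -/
theorem BiddingGame.Step.tok {k : Objective} {G : BiddingGame k} {x y : BidVertex G.n G.N}
    (h : G.Step x y) : y.tok = x.tok ∨ G.edge x.tok y.tok = true := by
  obtain ⟨a₁, h₁, a₂, h₂, rfl⟩ := h
  cases x with
  | conf c =>
    obtain ⟨b₁, b₂, _, _, _, _, e⟩ := G.next_conf h₁ h₂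
    exact .inl (by rw [e]; rfl)
  | bids c b₁ b₂ =>
    rcases G.next_bids h₁ h₂ with ⟨w, u, _, hu, e⟩ | ⟨u, _, hu, e⟩ | ⟨_, e⟩
    · exact .inr (by rw [e]; exact hu)
    · exact .inr (by rw [e]; exact hu)
    · exact .inl (by rw [e]; rfl)
  | yielded c b =>
    obtain ⟨u, hu, e⟩ := G.next_yielded h₁ h₂
    exact .inr (by rw [e]; exact hu)

/-- A vertex (or a sink, denoted by `none`) together with the player it is assigned to. -/
abbrev Place (n : ℕ) : Type := Option (Fin n) × Player

/-- The numbering of the players by `sinkIndex`. -/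
def playerEquiv : Player ≃ Fin 2 where
  toFun := sinkIndex
  invFun i := if i = 0 then .one else .two
  left_inv i := by cases i <;> rfl
  right_inv i := by fin_cases i <;> rfl

/-- The numbering of the places. -/
def placeEquiv (n : ℕ) : Place n ≃ Fin ((n + 1) * 2) :=
  (Equiv.prodCongr finSuccEquivLast.symm playerEquiv).trans finProdFinEquiv

/-- The represented vertex or sink. -/
def Place.label {n : ℕ} : Place n → Fin n ⊕ Player
  | (some v, _) => .inl v
  | (none, i) => .inr i

namespace TurnBasedGame

variable {k : Objective} (G : TurnBasedGame k)

/-- The player that a place is assigned to has the choices of the owner if he is the owner; if not,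
he can only pass the turn to the owner. In addition, he can move to the sink of the opponent. -/
def PlaceEdge : Place G.n → Place G.n → Prop
  | (some v, i), (some u, j) => j = i.other ∧ if G.owner v = i then G.edge v u = true else u = v
  | (some _, i), (none, j) => j = i.other
  | (none, _), (some _, _) => False
  | (none, i), (none, j) => j = i

instance (p q : Place G.n) : Decidable (G.PlaceEdge p q) := by
  rcases p with ⟨_ | v, i⟩ <;> rcases q with ⟨_ | u, j⟩ <;> simp only [PlaceEdge] <;> infer_instance

/-- The bidding game with total budget `0` on the places. -/
def toBidding : BiddingGame k where
  n := (G.n + 1) * 2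
  edge q q' := decide (G.PlaceEdge ((placeEquiv _).symm q) ((placeEquiv _).symm q'))
  no_dead_end q := by
    obtain ⟨⟨_ | v, i⟩, rfl⟩ := (placeEquiv G.n).surjective q
    · exact ⟨placeEquiv _ (none, i), by simp [PlaceEdge]⟩
    · exact ⟨placeEquiv _ (none, i.other), by simp [PlaceEdge]⟩
  N := 0
  cond := G.cond.withSinks fun q => ((placeEquiv _).symm q).label

variable {G}

/-- The vertex of the bidding game that has the number of a place. -/
def spot (p : Place G.n) : Fin G.toBidding.n := placeEquiv _ p

/-- The vertex or sink that is represented by a vertex of the bidding game. -/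
def spotLabel (q : Fin G.toBidding.n) : Fin G.n ⊕ Player := ((placeEquiv G.n).symm q).label

/-- The player that a vertex of the bidding game is assigned to. -/
def spotPlayer (q : Fin G.toBidding.n) : Player := ((placeEquiv G.n).symm q).2

theorem spotPlayer_spot (p : Place G.n) : spotPlayer (spot p) = p.2 := by
  simp only [spotPlayer, spot, Equiv.symm_apply_apply]

theorem spotLabel_spot (p : Place G.n) : spotLabel (spot p) = p.label := by
  simp only [spotLabel, spot, Equiv.symm_apply_apply]

theorem spot_surjective (q : Fin G.toBidding.n) : ∃ p : Place G.n, q = spot p :=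
  ⟨_, ((placeEquiv G.n).apply_symm_apply q).symm⟩

theorem spot_injective : Function.Injective (spot (G := G)) := (placeEquiv G.n).injective

theorem edge_spot {p q : Place G.n} :
    G.toBidding.edge (spot p) (spot q) = true ↔ G.PlaceEdge p q := by
  simp only [toBidding, spot, Equiv.symm_apply_apply, decide_eq_true_eq]

theorem spotLabel_eq_inr {q : Fin G.toBidding.n} {i : Player} :
    spotLabel q = .inr i ↔ q = spot (none, i) := by
  obtain ⟨⟨_ | v, j⟩, rfl⟩ := spot_surjective q
  · rw [spotLabel_spot, spot_injective.eq_iff]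
    simp [Place.label]
  · rw [spotLabel_spot, spot_injective.eq_iff]
    simp [Place.label]

theorem edge_sink {i : Player} {q : Fin G.toBidding.n} :
    G.toBidding.edge (spot (none, i)) q = true ↔ q = spot (none, i) := by
  obtain ⟨⟨_ | v, j⟩, rfl⟩ := spot_surjective q
  · rw [edge_spot, spot_injective.eq_iff]
    simp [PlaceEdge]
  · rw [edge_spot, spot_injective.eq_iff]
    simp [PlaceEdge]

theorem edge_spot_some {v : Fin G.n} {i : Player} {q : Fin G.toBidding.n} :
    G.toBidding.edge (spot (some v, i)) q = true ↔ q = spot (none, i.other) ∨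
      ∃ u, q = spot (some u, i.other) ∧ if G.owner v = i then G.edge v u = true else u = v := by
  obtain ⟨⟨_ | u, j⟩, rfl⟩ := spot_surjective q
  · rw [edge_spot]
    simp [PlaceEdge, spot_injective.eq_iff]
  · rw [edge_spot]
    simp only [PlaceEdge, spot_injective.eq_iff, Prod.mk.injEq, reduceCtorEq, false_and, false_or,
      Option.some.injEq]
    constructor
    · rintro ⟨h1, h2⟩
      exact ⟨u, ⟨rfl, h1⟩, h2⟩
    · rintro ⟨_, ⟨rfl, h1⟩, h2⟩
      exact ⟨h1, h2⟩

/-- The token does not leave a sink. -/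
theorem spotLabel_tok_of_step {x y : BidVertex G.toBidding.n G.toBidding.N} {i : Player}
    (h : G.toBidding.Step x y) (hx : spotLabel x.tok = .inr i) : spotLabel y.tok = .inr i := by
  rcases h.tok with e | e
  · rw [e, hx]
  · rw [spotLabel_eq_inr] at hx ⊢
    rw [hx] at e
    exact edge_sink.1 e

theorem toBidding_winsFrom_iff (i : Player) (c : Config G.toBidding.n G.toBidding.N) :
    G.toBidding.WinsFrom i c ↔ G.toBidding.arena.Wins
      {π | (fun m => spotLabel (π m).tok) ∈ G.cond.labelPaths} i (.conf c) := by
  rw [BiddingGame.winsFrom_iff]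
  exact wins_congr i fun s₁ s₂ h₁ h₂ => Condition.mem_paths_withSinks _ G.cond
    (fun m => (G.toBidding.arena.path s₁ s₂ (.conf c) m).tok) fun m j =>
      spotLabel_tok_of_step (G.toBidding.step_path h₁ h₂ _ m)

/-- Every configuration on the sink of a player is winning for that player. -/
theorem winsFrom_sink {i : Player} {c : Config G.toBidding.n G.toBidding.N}
    (hc : c.vertex = spot (none, i)) : G.toBidding.WinsFrom i c := by
  rw [toBidding_winsFrom_iff]
  have hstay : ∀ s₁ s₂, G.toBidding.arena.Legal .one s₁ → G.toBidding.arena.Legal .two s₂ →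
      ∀ m, spotLabel (G.toBidding.arena.path s₁ s₂ (.conf c) m).tok = .inr i := by
    intro s₁ s₂ h₁ h₂ m
    induction m with
    | zero => exact spotLabel_eq_inr.2 hc
    | succ m ih => exact spotLabel_tok_of_step (G.toBidding.step_path h₁ h₂ _ m) ih
  cases i
  · obtain ⟨s₁, h₁⟩ := G.toBidding.arena.exists_legal .one
    refine ⟨s₁, h₁, fun s₂ h₂ => .inl ⟨0, ?_⟩⟩
    show spotLabel _ ∈ _
    rw [hstay s₁ s₂ h₁ h₂]
    exact G.cond.inr_one_mem_suffLabels
  · obtain ⟨s₂, h₂⟩ := G.toBidding.arena.exists_legal .two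
    refine ⟨s₂, h₂, fun s₁ h₁ hmem => ?_⟩
    obtain ⟨m, hm⟩ := Condition.suff_of_mem_labelPaths hmem (hstay s₁ s₂ h₁ h₂ 0)
    rw [hstay s₁ s₂ h₁ h₂] at hm
    exact G.cond.inr_two_notMem_suffLabels hm

end TurnBasedGame

end BidGame

namespace BidGame

open Arena

namespace TurnBasedGame

variable {k : Objective} {G : TurnBasedGame k}

/-- Without budgets, each bidding ends in a tie. -/
theorem higherBidder_toBidding (b₁ b₂ : Fin (G.toBidding.N + 1)) :
    higherBidder (b₁ : ℕ) b₂ = none := by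
  have h₁ : (b₁ : ℕ) < 0 + 1 := b₁.isLt
  have h₂ : (b₂ : ℕ) < 0 + 1 := b₂.isLt
  unfold higherBidder
  rw [if_neg (by omega), if_neg (by omega)]

theorem mem_allowed_bids {c : Config G.toBidding.n G.toBidding.N} {b₁ b₂ : Fin (G.toBidding.N + 1)}
    {i : Player} {a : BidAction G.toBidding.n G.toBidding.N} :
    a ∈ G.toBidding.arena.allowed (.bids c b₁ b₂) i ↔
      (i = c.adv → a = .yield ∨ ∃ u, G.toBidding.edge c.vertex u = true ∧ a = .move u) := by
  simp only [BiddingGame.arena, BiddingGame.allowed, higherBidder_toBidding]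
  split_ifs with h
  · exact ⟨fun h' _ => h', fun h' => h' h⟩
  · exact ⟨fun _ h' => absurd h' h, fun _ => trivial⟩

theorem mem_allowed_yielded {c : Config G.toBidding.n G.toBidding.N} {b : Fin (G.toBidding.N + 1)}
    {i : Player} {a : BidAction G.toBidding.n G.toBidding.N} :
    a ∈ G.toBidding.arena.allowed (.yielded c b) i ↔
      (i = c.adv.other → ∃ u, G.toBidding.edge c.vertex u = true ∧ a = .move u) := by
  simp only [BiddingGame.arena, BiddingGame.allowed]
  split_ifs with h
  · exact ⟨fun h' _ => h', fun h' => h' h⟩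
  · exact ⟨fun _ h' => absurd h' h, fun _ => trivial⟩

theorem next_bids_move {c : Config G.toBidding.n G.toBidding.N} {b₁ b₂ : Fin (G.toBidding.N + 1)}
    {a₁ a₂ : BidAction G.toBidding.n G.toBidding.N} {u : Fin G.toBidding.n}
    (h : c.adv.pick a₁ a₂ = .move u) : G.toBidding.arena.next (.bids c b₁ b₂) a₁ a₂ =
      .conf (c.update c.adv b₁ c.adv.other u) := by
  simp only [BiddingGame.arena, BiddingGame.next, higherBidder_toBidding, h]

theorem next_bids_yield {c : Config G.toBidding.n G.toBidding.N} {b₁ b₂ : Fin (G.toBidding.N + 1)}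
    {a₁ a₂ : BidAction G.toBidding.n G.toBidding.N}
    (h : c.adv.pick a₁ a₂ = .yield) :
    G.toBidding.arena.next (.bids c b₁ b₂) a₁ a₂ = .yielded c b₁ := by
  simp only [BiddingGame.arena, BiddingGame.next, higherBidder_toBidding, h]

theorem next_yielded_move {c : Config G.toBidding.n G.toBidding.N} {b : Fin (G.toBidding.N + 1)}
    {a₁ a₂ : BidAction G.toBidding.n G.toBidding.N} {u : Fin G.toBidding.n}
    (h : c.adv.other.pick a₁ a₂ = .move u) : G.toBidding.arena.next (.yielded c b) a₁ a₂ =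
      .conf (c.update c.adv.other b c.adv u) := by
  simp only [BiddingGame.arena, BiddingGame.next, h]

/-- The vertex of the concurrent game represents `v`: the advantage is held by the player that the
place of the token is assigned to, and only Player `y` may have declined to use it. -/
inductive Represents (y : Player) (v : Fin G.n) : BidVertex G.toBidding.n G.toBidding.N → Prop
  | conf (c) (hc : c.vertex = spot (some v, c.adv)) : Represents y v (.conf c)
  | bids (c) (b₁ b₂) (hc : c.vertex = spot (some v, c.adv)) : Represents y v (.bids c b₁ b₂)
  | yielded (c) (b) (hc : c.vertex = spot (some v, c.adv)) (hy : c.adv = y) :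
    Represents y v (.yielded c b)

theorem Represents.label {y : Player} {v : Fin G.n} {x : BidVertex G.toBidding.n G.toBidding.N}
    (h : Represents y v x) : spotLabel x.tok = .inl v := by
  cases h with
  | conf c hc => exact (congrArg spotLabel hc).trans (spotLabel_spot _)
  | bids c _ _ hc => exact (congrArg spotLabel hc).trans (spotLabel_spot _)
  | yielded c _ hc => exact (congrArg spotLabel hc).trans (spotLabel_spot _)

/-- A bound on the number of steps until the owner of `v` moves. -/
def delay (v : Fin G.n) : BidVertex G.toBidding.n G.toBidding.N → ℕ
  | .conf c => if G.owner v = c.adv then 2 else 5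
  | .bids c _ _ => if G.owner v = c.adv then 1 else 4
  | .yielded _ _ => 0

theorem delay_bids_lt {v : Fin G.n} {c : Config G.toBidding.n G.toBidding.N}
    {b₁ b₂ : Fin (G.toBidding.N + 1)} : delay v (.bids c b₁ b₂) < delay v (.conf c) := by
  simp only [delay]
  split_ifs <;> omega

theorem delay_yielded_lt {v : Fin G.n} {c : Config G.toBidding.n G.toBidding.N}
    {b b₁ b₂ : Fin (G.toBidding.N + 1)} : delay v (.yielded c b) < delay v (.bids c b₁ b₂) := by
  simp only [delay]
  split_ifs <;> omega

theorem delay_update_lt {v : Fin G.n} {c : Config G.toBidding.n G.toBidding.N}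
    {b b₁ b₂ : Fin (G.toBidding.N + 1)} {w : Player} {u : Fin G.toBidding.n}
    (h : G.owner v ≠ c.adv) :
    delay v (.conf (c.update w b c.adv.other u)) < delay v (.bids c b₁ b₂) := by
  have h' : G.owner v = c.adv.other := (c.adv.eq_or_eq_other _).resolve_left h
  exact lt_of_eq_of_lt (if_pos h') (lt_of_lt_of_eq (by omega) (if_neg h).symm)

theorem setOf_inl_mem_labelPaths :
    {π : ℕ → Fin G.n | (fun m => Sum.inl (π m)) ∈ G.cond.labelPaths} = G.cond.paths :=
  Set.ext fun _ => Condition.inl_mem_labelPaths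

/-- Player 1 wins the bidding game if he wins the turn-based game. -/
theorem toBidding_winsFrom {v : Fin G.n} {c : Config G.toBidding.n G.toBidding.N}
    (hc : c.vertex = spot (some v, c.adv)) (h : G.arena.Wins G.cond.paths .one v) :
    G.toBidding.WinsFrom .one c := by
  rw [toBidding_winsFrom_iff]
  rw [← setOf_inl_mem_labelPaths] at h
  refine Wins.transfer (lab' := fun x : BidVertex G.toBidding.n G.toBidding.N => spotLabel x.tok)
    (Condition.labelPaths_stutterInvariant _)
    G.cond.suffLabels {.inr .two} (fun l hl => .inl hl) ?_ ?_ ?_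
    (fun v _ x => Represents .two v x) (fun v x => delay v x) ?_ ?_ (fun _ _ => .conf c hc) h
  · rintro l hl ⟨m, hm⟩
    exact Condition.suff_of_mem_labelPaths hl hm
  · rintro _ rfl
    exact G.cond.inr_two_notMem_suffLabels
  · intro v hv
    cases hv
  · exact fun v _ x hx => hx.label.symm
  · intro v a x hx ha _
    have hsuff : ∀ y : BidVertex G.toBidding.n G.toBidding.N, y.tok = spot (none, .one) →
        spotLabel y.tok ∈ G.cond.suffLabels := by
      intro y hy
      rw [spotLabel_eq_inr.2 hy]
      exact G.cond.inr_one_mem_suffLabels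
    refine .inr (.inr ?_)
    rcases hx with ⟨c, hc⟩ | ⟨c, b₁, b₂, hc⟩ | ⟨c, b, hc, hy⟩
    · refine ⟨.bid 0, ⟨0, Nat.zero_le _, rfl⟩, ?_⟩
      rintro _ ⟨b, hb, rfl⟩
      exact .inr (.inl ⟨.bids c 0 b hc, delay_bids_lt⟩)
    · rcases hadv : c.adv with _ | _
      · rw [hadv] at hc
        by_cases ho : G.owner v = .one
        · refine ⟨.move (spot (some a, .two)), mem_allowed_bids.2 fun _ => .inr ⟨_, ?_, rfl⟩,
            fun b' _ => .inr (.inr ?_)⟩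
          · rw [hc]
            refine edge_spot_some.2 (.inr ⟨a, rfl, ?_⟩)
            rw [if_pos ho]
            exact mem_allowed.1 ha ho.symm
          · obtain ⟨b, hb⟩ := G.arena.allowed_nonempty v .two
            refine ⟨b, hb, fun _ _ => ?_⟩
            rw [next_eq, ho]
            rw [next_bids_move (by rw [hadv]; rfl)]
            exact .conf _ (by simp [Config.update, hadv, Player.other, Player.pick])
        · refine ⟨.move (spot (some v, .two)), mem_allowed_bids.2 fun _ => .inr ⟨_, ?_, rfl⟩,
            fun b' _ => .inr (.inl ?_)⟩
          · rw [hc]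
            refine edge_spot_some.2 (.inr ⟨v, rfl, ?_⟩)
            rw [if_neg ho]
          · rw [next_bids_move (by rw [hadv]; rfl)]
            exact ⟨.conf _ (by simp [Config.update, hadv, Player.other]),
              delay_update_lt (by rw [hadv]; exact ho)⟩
      · refine ⟨.yield, mem_allowed_bids.2 fun _ => .inl rfl, fun b' hb' => ?_⟩
        rcases mem_allowed_bids.1 hb' hadv.symm with rfl | ⟨u, hu, rfl⟩
        · rw [next_bids_yield (by rw [hadv]; rfl)]
          exact .inr (.inl ⟨.yielded _ _ hc hadv, delay_yielded_lt⟩)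
        · rw [next_bids_move (by rw [hadv]; rfl)]
          rw [hc, hadv] at hu
          rcases edge_spot_some.1 hu with rfl | ⟨u, rfl, hu'⟩
          · exact .inl (hsuff _ rfl)
          · by_cases ho : G.owner v = .two
            · rw [if_pos ho] at hu'
              refine .inr (.inr ⟨u, mem_allowed.2 fun _ => hu', fun _ _ => ?_⟩)
              rw [next_eq, ho]
              exact .conf _ (by simp [Config.update, hadv, Player.other, Player.pick])
            · rw [if_neg ho] at hu'
              subst hu'
              exact .inr (.inl ⟨.conf _ (by simp [Config.update, hadv, Player.other]),
                delay_update_lt (by rw [hadv]; exact ho)⟩)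
    · refine ⟨.move (spot (none, .one)), mem_allowed_yielded.2 fun _ => ⟨_, ?_, rfl⟩,
        fun b' _ => .inl ?_⟩
      · rw [hc, hy]
        exact edge_spot_some.2 (.inl rfl)
      · rw [next_yielded_move (by rw [hy]; rfl)]
        exact hsuff _ rfl

/-- Player 1 wins the turn-based game if he wins the bidding game. -/
theorem wins_of_toBidding {v : Fin G.n} {c : Config G.toBidding.n G.toBidding.N}
    (hc : c.vertex = spot (some v, c.adv)) (h : G.toBidding.WinsFrom .one c) :
    G.arena.Wins G.cond.paths .one v := by
  rw [toBidding_winsFrom_iff] at h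
  rw [← setOf_inl_mem_labelPaths]
  refine Wins.transfer (lab := fun x : BidVertex G.toBidding.n G.toBidding.N => spotLabel x.tok)
    (Condition.labelPaths_stutterInvariant _)
    G.cond.suffLabels {.inr .two} (fun l hl => .inl hl) ?_ ?_ ?_
    (fun x _ v => Represents .one v x) (fun x v => delay v x) ?_ ?_ (fun _ _ => .conf c hc) h
  · rintro l hl ⟨m, hm⟩
    exact Condition.suff_of_mem_labelPaths hl hm
  · rintro _ rfl
    exact G.cond.inr_two_notMem_suffLabels
  · intro x hx a ha
    obtain ⟨b, hb⟩ := G.toBidding.allowed_nonempty x .two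
    exact ⟨b, hb, spotLabel_tok_of_step ⟨a, ha, b, hb, rfl⟩ hx⟩
  · exact fun x _ v hx => hx.label
  · intro x a v hx ha _
    have hbad : ∀ y : BidVertex G.toBidding.n G.toBidding.N, y.tok = spot (none, .two) →
        spotLabel y.tok ∈ ({.inr .two} : Set (Fin G.n ⊕ Player)) := fun y hy =>
      spotLabel_eq_inr.2 hy
    rcases hx with ⟨c, hc⟩ | ⟨c, b₁, b₂, hc⟩ | ⟨c, b, hc, hy⟩
    · obtain ⟨b, hb, rfl⟩ := ha
      exact .inr (.inl ⟨.bid 0, ⟨0, Nat.zero_le _, rfl⟩, delay_bids_lt, fun _ _ => .bids c b 0 hc⟩)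
    · rcases hadv : c.adv with _ | _
      · obtain ⟨b, hb⟩ := G.toBidding.allowed_nonempty (.bids c b₁ b₂) .two
        rcases mem_allowed_bids.1 ha hadv.symm with rfl | ⟨u, hu, rfl⟩
        · refine .inr (.inl ⟨b, hb, ?_⟩)
          rw [next_bids_yield (by rw [hadv]; rfl)]
          exact ⟨delay_yielded_lt, fun _ _ => .yielded _ _ hc hadv⟩
        · rw [hc, hadv] at hu
          rcases edge_spot_some.1 hu with rfl | ⟨u, rfl, hu'⟩
          · refine .inl ⟨b, hb, ?_⟩
            rw [next_bids_move (by rw [hadv]; rfl)]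
            exact hbad _ rfl
          · by_cases ho : G.owner v = .one
            · rw [if_pos ho] at hu'
              refine .inr (.inr ⟨u, mem_allowed.2 fun _ => hu', fun b' _ => .inr (.inr
                ⟨b, hb, fun _ _ => ?_⟩)⟩)
              rw [next_eq, ho]
              rw [next_bids_move (by rw [hadv]; rfl)]
              exact .conf _ (by simp [Config.update, hadv, Player.other, Player.pick])
            · rw [if_neg ho] at hu'
              subst hu'
              refine .inr (.inl ⟨b, hb, ?_⟩)
              rw [next_bids_move (by rw [hadv]; rfl)]
              exact ⟨delay_update_lt (by rw [hadv]; exact ho), fun _ _ =>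
                .conf _ (by simp [Config.update, hadv, Player.other])⟩
      · rw [hadv] at hc
        by_cases ho : G.owner v = .two
        · obtain ⟨a', ha'⟩ := G.arena.allowed_nonempty v .one
          refine .inr (.inr ⟨a', ha', fun u hu => .inr (.inr ⟨.move (spot (some u, .one)),
            mem_allowed_bids.2 fun _ => .inr ⟨_, ?_, rfl⟩, fun _ _ => ?_⟩)⟩)
          · rw [hc]
            refine edge_spot_some.2 (.inr ⟨u, rfl, ?_⟩)
            rw [if_pos ho]
            exact mem_allowed.1 hu ho.symm
          · rw [next_eq, ho]
            rw [next_bids_move (by rw [hadv]; rfl)]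
            exact .conf _ (by simp [Config.update, hadv, Player.other, Player.pick])
        · refine .inr (.inl ⟨.move (spot (some v, .one)),
            mem_allowed_bids.2 fun _ => .inr ⟨_, ?_, rfl⟩, ?_⟩)
          · rw [hc]
            refine edge_spot_some.2 (.inr ⟨v, rfl, ?_⟩)
            rw [if_neg ho]
          · rw [next_bids_move (by rw [hadv]; rfl)]
            exact ⟨delay_update_lt (by rw [hadv]; exact ho), fun _ _ =>
              .conf _ (by simp [Config.update, hadv, Player.other])⟩
    · refine .inl ⟨.move (spot (none, .two)), mem_allowed_yielded.2 fun _ => ⟨_, ?_, rfl⟩, ?_⟩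
      · rw [hc, hy]
        exact edge_spot_some.2 (.inl rfl)
      · rw [next_yielded_move (by rw [hy]; rfl)]
        exact hbad _ rfl

end TurnBasedGame

/-- The instance of the bidding problem for an instance of the turn-based problem. -/
def TBInstance.toBid {k : Objective} (x : TBInstance k) : BidInstance k where
  toBiddingGame := x.toBidding
  start :=
    { vertex := TurnBasedGame.spot (some x.start, .one)
      budget := fun _ => 0
      total := rfl
      adv := .one }

theorem TBInstance.tbWin_iff {k : Objective} (x : TBInstance k) : TBWin x ↔ BidWin x.toBid :=
  ⟨TurnBasedGame.toBidding_winsFrom rfl, TurnBasedGame.wins_of_toBidding rfl⟩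

/-- A place `(v, i)` is assigned to Player `i`, and the initial place to Player 1. -/
theorem TBInstance.forcesAdvantage_toBid {k : Objective} (x : TBInstance k) :
    ForcesAdvantage x.toBid := by
  have hsink : ∀ p : Place x.n, TurnBasedGame.spot p ∉ Set.range (fun i : Player =>
      (TurnBasedGame.spot (none, i) : Fin x.toBidding.n)) → ∃ v i, p = (some v, i) := by
    rintro ⟨_ | v, i⟩ h
    · exact absurd ⟨i, rfl⟩ h
    · exact ⟨v, i, rfl⟩
  refine ⟨rfl, fun i => TurnBasedGame.spot (none, i),
    TurnBasedGame.spotPlayer, ?_, fun i u => TurnBasedGame.edge_sink,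
    fun i c => TurnBasedGame.winsFrom_sink, ?_, ?_, ?_⟩
  · exact fun h => nomatch TurnBasedGame.spot_injective h
  · rintro ⟨i, h⟩
    cases TurnBasedGame.spot_injective h
  · exact TurnBasedGame.spotPlayer_spot _
  · intro q hq
    obtain ⟨p, rfl⟩ := TurnBasedGame.spot_surjective q
    obtain ⟨v, i, rfl⟩ := hsink p hq
    refine ⟨fun j => ?_, fun q' hq' he => ?_⟩
    · exact TurnBasedGame.edge_spot.trans (by rw [TurnBasedGame.spotPlayer_spot]; exact Iff.rfl)
    · obtain ⟨p', rfl⟩ := TurnBasedGame.spot_surjective q'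
      obtain ⟨u, j, rfl⟩ := hsink p' hq'
      rw [TurnBasedGame.spotPlayer_spot, TurnBasedGame.spotPlayer_spot]
      exact (TurnBasedGame.edge_spot.1 he).1

end BidGame

/-! ### Generating the encodings of the constructed games -/

namespace StackProg

open Function

/-- Formulas about the values of expressions. -/
inductive Form where
  | eq (e₁ e₂ : Expr)
  | lt (e₁ e₂ : Expr)
  | and (f₁ f₂ : Form)
  | or (f₁ f₂ : Form)

/-- The truth of a formula. -/
def Form.Holds (L : List ℕ) (env : ℕ → ℕ) : Form → Prop
  | .eq e₁ e₂ => e₁.eval L env = e₂.eval L env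
  | .lt e₁ e₂ => e₁.eval L env < e₂.eval L env
  | .and f₁ f₂ => f₁.Holds L env ∧ f₂.Holds L env
  | .or f₁ f₂ => f₁.Holds L env ∨ f₂.Holds L env

/-- The expression for the truth value of a formula. -/
def Form.toExpr : Form → Expr
  | .eq e₁ e₂ => .sub (.const 1) (.add (.sub e₁ e₂) (.sub e₂ e₁))
  | .lt e₁ e₂ => .sub (.const 1) (.sub (.const 1) (.sub e₂ e₁))
  | .and f₁ f₂ => .mul f₁.toExpr f₂.toExpr
  | .or f₁ f₂ => .sub (.const 1) (.mul (.sub (.const 1) f₁.toExpr) (.sub (.const 1) f₂.toExpr))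

theorem Form.eval_toExpr (L : List ℕ) (env : ℕ → ℕ) (f : Form) :
    (f.Holds L env → f.toExpr.eval L env = 1) ∧ (¬ f.Holds L env → f.toExpr.eval L env = 0) := by
  induction f with
  | eq e₁ e₂ =>
    simp only [Holds, toExpr, Expr.eval]
    omega
  | lt e₁ e₂ =>
    simp only [Holds, toExpr, Expr.eval]
    omega
  | and f₁ f₂ ih₁ ih₂ =>
    simp only [Holds, toExpr, Expr.eval]
    by_cases h₁ : f₁.Holds L env <;> by_cases h₂ : f₂.Holds L env <;> simp_all
  | or f₁ f₂ ih₁ ih₂ =>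
    simp only [Holds, toExpr, Expr.eval]
    by_cases h₁ : f₁.Holds L env <;> by_cases h₂ : f₂.Holds L env <;> simp_all

theorem Form.eval_toExpr_eq_bit {L : List ℕ} {env : ℕ → ℕ} {f : Form} {p : Prop} [Decidable p]
    (h : f.Holds L env ↔ p) : f.toExpr.eval L env = BidGame.bit p := by
  unfold BidGame.bit
  split_ifs with hp
  · exact (f.eval_toExpr L env).1 (h.2 hp)
  · exact (f.eval_toExpr L env).2 fun h' => hp (h.1 h')

/-- The expression `e₁` if the truth value `c` is `1`, and `e₂` otherwise. -/
def Expr.ite (c e₁ e₂ : Expr) : Expr := .add (.mul c e₁) (.mul (.sub (.const 1) c) e₂)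

theorem Gen.eval_loop {L : List ℕ} {d n : ℕ} {env : ℕ → ℕ} {e : Expr} {g : Gen}
    {f : Fin n → List ℕ} (he : e.eval L env = n)
    (h : ∀ i : Fin n, g.eval L (d + 1) (update env d i) = f i) :
    (Gen.loop e g).eval L d env = (List.finRange n).flatMap f := by
  simp only [Gen.eval, he, ← List.map_coe_finRange_eq_range, List.flatMap_map, h]

end StackProg

namespace BidGame

theorem tableNats_eq_flatMap {n : ℕ} (f : Fin n → ℕ) :
    tableNats f = (List.finRange n).flatMap fun i => [f i] := by
  rw [tableNats, List.ofFn_eq_map, List.map_eq_flatMap]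

/-- The elements of a type in the order of a numbering. -/
def enumerate {α : Type} {n : ℕ} (e : α ≃ Fin n) : List α := (List.finRange n).map e.symm

theorem enumerate_refl (n : ℕ) : enumerate (Equiv.refl (Fin n)) = List.finRange n := by
  simp [enumerate]

theorem finRange_flatMap_symm {α : Type} {n : ℕ} (e : α ≃ Fin n) (f : α → List ℕ) :
    ((List.finRange n).flatMap fun q => f (e.symm q)) = (enumerate e).flatMap f := by
  rw [enumerate, List.flatMap_map]

theorem finRange_mul (m n : ℕ) : List.finRange (m * n) =
    (List.finRange m).flatMap fun i => (List.finRange n).map fun j => finProdFinEquiv (i, j) := by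
  rw [← List.ofFn_id, List.ofFn_mul, List.flatMap_def, List.ofFn_eq_map]
  congr 2
  funext i
  rw [List.ofFn_eq_map]
  congr 1
  funext j
  ext
  simp [add_comm, mul_comm]

/-- Products are enumerated by nested loops. -/
theorem enumerate_prod {α β : Type} {m n : ℕ} (e₁ : α ≃ Fin m) (e₂ : β ≃ Fin n)
    (f : α × β → List ℕ) :
    (enumerate ((Equiv.prodCongr e₁ e₂).trans finProdFinEquiv)).flatMap f =
      (enumerate e₁).flatMap fun a => (enumerate e₂).flatMap fun b => f (a, b) := by
  simp only [enumerate, finRange_mul, List.flatMap_map, List.map_flatMap, List.flatMap_assoc,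
    List.map_map]
  simp

theorem getD_append_add (l l' : List ℕ) (i : ℕ) :
    (l ++ l').getD (l.length + i) 0 = l'.getD i 0 := by
  simp [List.getD_eq_getElem?_getD, List.getElem?_append_right]

theorem getD_tableNats {n : ℕ} (f : Fin n → ℕ) (i : Fin n) : (tableNats f).getD i 0 = f i := by
  simp [tableNats, List.getD_eq_getElem?_getD]

theorem getD_append_of_lt {l l' : List ℕ} {i : ℕ} (h : i < l.length) :
    (l ++ l').getD i 0 = l.getD i 0 := by
  simp [List.getD_eq_getElem?_getD, List.getElem?_append_left h]

/-- Entries of a matrix that is listed row by row. -/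
theorem getD_flatMap {α : Type} {n : ℕ} {f : α → List ℕ} (hf : ∀ a, (f a).length = n) (l : List α)
    (j : ℕ) (hj : j < l.length) {c : ℕ} (hc : c < n) :
    (l.flatMap f).getD (j * n + c) 0 = (f l[j]).getD c 0 := by
  induction l generalizing j with
  | nil => exact absurd hj (Nat.not_lt_zero _)
  | cons a l ih =>
    rw [List.flatMap_cons]
    cases j with
    | zero => rw [Nat.zero_mul, Nat.zero_add, getD_append_of_lt (by rw [hf]; exact hc)]; rfl
    | succ j =>
      rw [show (j + 1) * n + c = (f a).length + (j * n + c) by rw [hf]; ring, getD_append_add,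
        ih j (by simpa using hj)]
      rfl

theorem getD_edgeNats {n : ℕ} (e : Fin n → Fin n → Bool) (v u : Fin n) :
    (edgeNats e).getD (v * n + u) 0 = bit (e v u = true) := by
  rw [edgeNats, getD_flatMap (fun _ => length_tableNats _) _ _ (by simp) u.isLt, getD_tableNats]
  simp

theorem flatMap_eq_finRange {α : Type} (l : List α) (f : α → List ℕ) :
    l.flatMap f = (List.finRange l.length).flatMap fun j => f l[j] := by
  conv_lhs => rw [← List.map_getElem_finRange l]
  rw [List.flatMap_map]
  rfl

end BidGame

namespace BidGame

open StackProg

/-- The generator of the condition `c.withSinks φ`, when the encoding of `c` starts at the entry `O`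
of the input. The vertices are enumerated by `verts`; in each round, `isV` tells whether a vertex
or a sink is represented, and `vE` resp. `iE` is its number. -/
def condGen (verts : Gen → Gen) (nE O isV vE iE : Expr) : Objective → Gen
  | .reachability | .buchi =>
    verts (.emit (.ite isV (.input (.add O vE)) (Form.eq iE (.const 0)).toExpr))
  | .parity => verts (.emit (.ite isV (.input (.add O vE)) (.add iE (.const 1))))
  | .muller =>
    .seq (.emit (.add (.input O) (.const 2))) <|
    .seq (.emit (.add (.input (.add O (.const 1))) (.const 1))) <|
    .seq (verts (.emit (.ite isV (.input (.add O (.add (.const 2) vE))) (.add (.input O) iE)))) <|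
    .seq (.loop (.add (.input O) (.const 2)) (.emit (Form.eq (.var 0) (.input O)).toExpr)) <|
    .loop (.input (.add O (.const 1))) <| .loop (.add (.input O) (.const 2)) <| .emit <|
      .mul (Form.lt (.var 1) (.input O)).toExpr <| .input <|
        .add O <| .add (.const 2) <| .add nE <| .add (.mul (.var 0) (.input O)) (.var 1)

section

variable {n n' : ℕ} {φ : Fin n' → Fin n ⊕ Player} {L pre : List ℕ} {verts : Gen → Gen}
  {nE O isV vE iE : Expr} {envOf : Fin n' → ℕ → ℕ} {env₀ : ℕ → ℕ}

/-- A case distinction on whether a vertex or a sink is represented is made by the generator. -/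
theorem eval_ite_label {e₁ e₂ : Expr} {q : Fin n'} {f : Fin n → ℕ} {f' : Player → ℕ}
    (hlab : Sum.elim (fun v : Fin n => isV.eval L (envOf q) = 1 ∧ vE.eval L (envOf q) = v)
      (fun i => isV.eval L (envOf q) = 0 ∧ iE.eval L (envOf q) = sinkIndex i) (φ q))
    (h₁ : ∀ v : Fin n, vE.eval L (envOf q) = v → e₁.eval L (envOf q) = f v)
    (h₂ : ∀ i : Player, iE.eval L (envOf q) = sinkIndex i → e₂.eval L (envOf q) = f' i) :
    (Expr.ite isV e₁ e₂).eval L (envOf q) = Sum.elim f f' (φ q) := by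
  rcases h : φ q with v | i
  · rw [h] at hlab
    simp only [Expr.ite, Expr.eval, hlab.1, h₁ v hlab.2]
    simp
  · rw [h] at hlab
    simp only [Expr.ite, Expr.eval, hlab.1, h₂ i hlab.2]
    simp

theorem eval_targets (T : Finset (Fin n)) (hL : L = pre ++ tableNats fun v => bit (v ∈ T))
    (hO : ∀ env, O.eval L env = pre.length)
    (hverts : ∀ e : Expr, (verts (.emit e)).eval L 0 env₀ = tableNats fun q => e.eval L (envOf q))
    (hlab : ∀ q, Sum.elim (fun v : Fin n => isV.eval L (envOf q) = 1 ∧ vE.eval L (envOf q) = v)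
      (fun i => isV.eval L (envOf q) = 0 ∧ iE.eval L (envOf q) = sinkIndex i) (φ q)) :
    (verts (.emit (.ite isV (.input (.add O vE)) (Form.eq iE (.const 0)).toExpr))).eval L 0 env₀ =
      tableNats fun q => bit (q ∈ targetsWithSinks φ T) := by
  rw [hverts]
  congr 1
  funext q
  rw [eval_ite_label (hlab q) (f := fun v => bit (v ∈ T)) (f' := fun i => bit (i = .one))]
  · have : q ∈ targetsWithSinks φ T ↔ φ q ∈ T.disjSum {Player.one} := by simp [targetsWithSinks]
    rcases h : φ q with v | i <;> simp [bit, this, h]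
  · intro v hv
    simp only [Expr.eval, hO, hv]
    rw [hL, getD_append_add, getD_tableNats]
  · intro i hi
    refine Form.eval_toExpr_eq_bit ?_
    simp only [Form.Holds, Expr.eval, hi]
    cases i <;> simp [sinkIndex]

theorem eval_priority (p : Fin n → ℕ+) (hL : L = pre ++ tableNats fun v => (p v : ℕ))
    (hO : ∀ env, O.eval L env = pre.length)
    (hverts : ∀ e : Expr, (verts (.emit e)).eval L 0 env₀ = tableNats fun q => e.eval L (envOf q))
    (hlab : ∀ q, Sum.elim (fun v : Fin n => isV.eval L (envOf q) = 1 ∧ vE.eval L (envOf q) = v)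
      (fun i => isV.eval L (envOf q) = 0 ∧ iE.eval L (envOf q) = sinkIndex i) (φ q)) :
    (verts (.emit (.ite isV (.input (.add O vE)) (.add iE (.const 1))))).eval L 0 env₀ =
      tableNats fun q => (priorityWithSinks φ p q : ℕ) := by
  rw [hverts]
  congr 1
  funext q
  rw [eval_ite_label (hlab q) (f := fun v => (p v : ℕ)) (f' := fun i => (sinkIndex i : ℕ) + 1)]
  · rcases h : φ q with v | i <;> simp [priorityWithSinks, h]
  · intro v hv
    simp only [Expr.eval, hO, hv]
    rw [hL, getD_append_add, getD_tableNats]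
  · intro i hi
    simp only [Expr.eval, hi]

/-- The listing of the Müller condition: the colours of the sinks come after the old ones, and the
first accepting set, a singleton, is followed by the old sets, whose rows are padded by zeros. -/
theorem eval_muller (M : MullerCondition n) (hL : L = pre ++ Condition.nats (k := .muller) M)
    (hO : ∀ env, O.eval L env = pre.length) (hn : ∀ env, nE.eval L env = n)
    (hverts : ∀ e : Expr, (verts (.emit e)).eval L 0 env₀ = tableNats fun q => e.eval L (envOf q))
    (hlab : ∀ q, Sum.elim (fun v : Fin n => isV.eval L (envOf q) = 1 ∧ vE.eval L (envOf q) = v)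
      (fun i => isV.eval L (envOf q) = 0 ∧ iE.eval L (envOf q) = sinkIndex i) (φ q)) :
    (condGen verts nE O isV vE iE .muller).eval L 0 env₀ =
      [M.colors + 2, (familyWithSinks M).length] ++
      (tableNats fun q => (colorWithSinks φ M q : ℕ)) ++
      (familyWithSinks M).flatMap fun S => tableNats fun c => bit (c ∈ S) := by
  have hL0 : L.getD pre.length 0 = M.colors := by
    have := getD_append_add pre (Condition.nats (k := .muller) M) 0
    rw [← hL] at this
    exact this
  have hL1 : L.getD (pre.length + 1) 0 = M.family.length := by
    rw [hL, getD_append_add]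
    rfl
  have hLc : ∀ v : Fin n, L.getD (pre.length + (2 + v)) 0 = M.color v := by
    intro v
    rw [hL, getD_append_add]
    have := getD_append_add [M.colors, M.family.length] ((tableNats fun v => (M.color v : ℕ)) ++
      M.family.flatMap fun S => tableNats fun c => bit (c ∈ S)) v
    refine Eq.trans this ?_
    rw [getD_append_of_lt (by simp), getD_tableNats]
  have hLf : ∀ (j : Fin M.family.length) (c : Fin M.colors),
      L.getD (pre.length + (2 + (n + (j * M.colors + c)))) 0 = bit (c ∈ M.family[j]) := by
    intro j c
    rw [hL, getD_append_add]
    have := getD_append_add [M.colors, M.family.length] ((tableNats fun v => (M.color v : ℕ)) ++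
      M.family.flatMap fun S => tableNats fun c => bit (c ∈ S)) (n + (j * M.colors + c))
    refine Eq.trans this ?_
    have h2 := getD_append_add (tableNats fun v => (M.color v : ℕ))
      (M.family.flatMap fun S => tableNats fun c => bit (c ∈ S)) (j * M.colors + c)
    rw [length_tableNats] at h2
    rw [h2, getD_flatMap (fun _ => length_tableNats _) _ _ j.isLt c.isLt, getD_tableNats]
    rfl
  have hcolor : (fun q => (Expr.ite isV (.input (.add O (.add (.const 2) vE)))
      (.add (.input O) iE)).eval L (envOf q)) = fun q => (colorWithSinks φ M q : ℕ) := by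
    funext q
    rw [eval_ite_label (hlab q) (f := fun v => (M.color v : ℕ))
      (f' := fun i => M.colors + (sinkIndex i : ℕ))]
    · rcases h : φ q with v | i <;> simp [colorWithSinks, h]
    · intro v hv
      simp only [Expr.eval, hO, hv, hLc]
    · intro i hi
      simp only [Expr.eval, hO, hi, hL0]
  have hfirst : (Gen.loop (.add (.input O) (.const 2))
      (.emit (Form.eq (.var 0) (.input O)).toExpr)).eval L 0 env₀ =
      tableNats fun c => bit (c ∈ ({Fin.natAdd M.colors (sinkIndex .one)} : Finset _)) := by
    rw [tableNats_eq_flatMap]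
    refine Gen.eval_loop (by simp only [Expr.eval, hO, hL0]) fun c => congrArg (fun x => [x]) ?_
    refine Form.eval_toExpr_eq_bit ?_
    simp only [Form.Holds, Expr.eval, hO, hL0, Function.update_self, Finset.mem_singleton,
      Fin.ext_iff, Fin.val_natAdd]
    rfl
  have hrest : (Gen.loop (.input (.add O (.const 1))) <| .loop (.add (.input O) (.const 2)) <|
      .emit <| .mul (Form.lt (.var 1) (.input O)).toExpr <| .input <|
        .add O <| .add (.const 2) <| .add nE <| .add (.mul (.var 0) (.input O)) (.var 1)).eval
          L 0 env₀ = (M.family.map fun S => S.map (Fin.castAddEmb 2)).flatMap fun S =>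
            tableNats fun c => bit (c ∈ S) := by
    rw [List.flatMap_map, flatMap_eq_finRange]
    refine Gen.eval_loop (by simp only [Expr.eval, hO, hL1]) fun j => ?_
    rw [tableNats_eq_flatMap]
    refine Gen.eval_loop (by simp only [Expr.eval, hO, hL0]) fun c => congrArg (fun x => [x]) ?_
    have h0 : Function.update (Function.update env₀ 0 (j : ℕ)) (0 + 1) (c : ℕ) 0 = j := by simp
    have h1 : Function.update (Function.update env₀ 0 (j : ℕ)) (0 + 1) (c : ℕ) 1 = c := by simp
    simp only [Expr.eval, hO, hL0, hn, h0, h1]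
    rw [Form.eval_toExpr_eq_bit (p := (c : ℕ) < M.colors)
      (by simp only [Form.Holds, Expr.eval, hO, hL0, h1])]
    by_cases hc : (c : ℕ) < M.colors
    · rw [hLf j ⟨c, hc⟩]
      have h2 : c ∈ M.family[j].map (Fin.castAddEmb 2) ↔ (⟨c, hc⟩ : Fin M.colors) ∈ M.family[j] :=
        Finset.mem_map' (Fin.castAddEmb 2) (a := ⟨c, hc⟩)
      simp only [bit, hc, if_true, h2, one_mul]
    · have h2 : c ∉ M.family[j].map (Fin.castAddEmb 2) := by
        rw [Finset.mem_map]
        rintro ⟨c', _, rfl⟩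
        exact hc c'.isLt
      simp only [bit, hc, if_false, h2, zero_mul]
  have hvc := hverts (.ite isV (.input (.add O (.add (.const 2) vE))) (.add (.input O) iE))
  rw [hcolor] at hvc
  have h0 : (Expr.add (.input O) (.const 2)).eval L env₀ = M.colors + 2 := by
    simp only [Expr.eval, hO, hL0]
  have h1 : (Expr.add (.input (.add O (.const 1))) (.const 1)).eval L env₀ =
      (familyWithSinks M).length := by
    simp only [Expr.eval, hO, hL1, familyWithSinks, List.length_cons, List.length_map]
  show [_] ++ ([_] ++ (_ ++ (_ ++ _))) = _
  rw [h0, h1, hvc, hfirst, hrest]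
  simp only [familyWithSinks, List.flatMap_cons, List.cons_append, List.nil_append]

end

/-- The generated condition. -/
theorem eval_condGen {k : Objective} {n n' : ℕ} {φ : Fin n' → Fin n ⊕ Player} {L pre : List ℕ}
    {verts : Gen → Gen} {nE O isV vE iE : Expr} {envOf : Fin n' → ℕ → ℕ} {env₀ : ℕ → ℕ}
    (c : Condition k n) (hL : L = pre ++ c.nats)
    (hO : ∀ env, O.eval L env = pre.length) (hn : ∀ env, nE.eval L env = n)
    (hverts : ∀ e : Expr, (verts (.emit e)).eval L 0 env₀ = tableNats fun q => e.eval L (envOf q))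
    (hlab : ∀ q, Sum.elim (fun v : Fin n => isV.eval L (envOf q) = 1 ∧ vE.eval L (envOf q) = v)
      (fun i => isV.eval L (envOf q) = 0 ∧ iE.eval L (envOf q) = sinkIndex i) (φ q)) :
    (condGen verts nE O isV vE iE k).eval L 0 env₀ = (c.withSinks φ).nats := by
  cases k with
  | reachability => exact eval_targets _ hL hO hverts hlab
  | buchi => exact eval_targets _ hL hO hverts hlab
  | parity => exact eval_priority _ hL hO hverts hlab
  | muller => exact eval_muller _ hL hO hn hverts hlab

end BidGame

namespace BidGame

open StackProg Function

/-- Nested loops over the nodes. -/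
def nodeLoops (nE NE : Expr) (g : Gen) : Gen :=
  .loop (.const 4) <| .loop nE <| .loop (.add NE (.const 1)) <| .loop (.const 2) <|
    .loop (.add NE (.const 1)) <| .loop (.add NE (.const 1)) g

/-- The values of the loop variables in the round for a given node. -/
def nodeEnv {n N : ℕ} (d : ℕ) (env : ℕ → ℕ) (x : Node n N) : ℕ → ℕ :=
  update (update (update (update (update (update env d x.1) (d + 1) x.2.1) (d + 2) x.2.2.1)
    (d + 3) x.2.2.2.1) (d + 4) x.2.2.2.2.1) (d + 5) x.2.2.2.2.2

theorem eval_nodeLoops {n N d : ℕ} {L : List ℕ} {env : ℕ → ℕ} {nE NE : Expr} {g : Gen}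
    (hn : ∀ env, nE.eval L env = n) (hN : ∀ env, NE.eval L env = N) :
    (nodeLoops nE NE g).eval L d env = (List.finRange (nodeCount n N)).flatMap fun q =>
      g.eval L (d + 6) (nodeEnv d env ((nodeEquiv n N).symm q)) := by
  rw [finRange_flatMap_symm (nodeEquiv n N) fun x => g.eval L (d + 6) (nodeEnv d env x), nodeEquiv,
    enumerate_prod, enumerate_refl]
  have hN' : ∀ env, (Expr.add NE (.const 1)).eval L env = N + 1 := by
    intro env
    simp only [Expr.eval, hN]
  refine Gen.eval_loop rfl fun κ => ?_
  rw [enumerate_prod, enumerate_refl]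
  refine Gen.eval_loop (hn _) fun v => ?_
  rw [enumerate_prod, enumerate_refl]
  refine Gen.eval_loop (hN' _) fun B => ?_
  rw [enumerate_prod, enumerate_refl]
  refine Gen.eval_loop rfl fun s => ?_
  rw [show (finProdFinEquiv : Fin (N + 1) × Fin (N + 1) ≃ _) =
    (Equiv.prodCongr (.refl _) (.refl _)).trans finProdFinEquiv from rfl,
    enumerate_prod, enumerate_refl]
  refine Gen.eval_loop (hN' _) fun b => ?_
  refine Gen.eval_loop (hN' _) fun b => ?_
  rfl

/-- Conjunction of formulas. -/
local infixr:35 " ⊓ₑ " => Form.and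
/-- Disjunction of formulas. -/
local infixr:30 " ⊔ₑ " => Form.or
/-- Equality of expressions. -/
local infix:50 " =ₑ " => Form.eq

/-- The formula for `NodeEdge`, for the nodes that are given by the variables from `0` and from `6`
on. -/
def nodeEdgeForm (nE NE : Expr) : Form :=
  let κ := Expr.var 0; let v := Expr.var 1; let B := Expr.var 2
  let s := Expr.var 3; let b := Expr.var 4; let d := Expr.var 5
  let κ' := Expr.var 6; let v' := Expr.var 7; let B' := Expr.var 8
  let s' := Expr.var 9; let b' := Expr.var 10; let d' := Expr.var 11
  let e := Expr.input (.add (.const 6) (.add (.mul v nE) v')) =ₑ .const 1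
  let gain (x : Expr) := Expr.add B (.sub x (.sub x (.sub NE B)))
  (κ =ₑ .const 0 ⊓ₑ κ' =ₑ .const 1 ⊓ₑ v' =ₑ v ⊓ₑ B' =ₑ B ⊓ₑ s' =ₑ s ⊓ₑ
    Form.lt b' (.add B (.const 1)) ⊓ₑ d' =ₑ .const 0) ⊔ₑ
  (κ =ₑ .const 1 ⊓ₑ κ' =ₑ .const 2 ⊓ₑ v' =ₑ v ⊓ₑ B' =ₑ B ⊓ₑ s' =ₑ s ⊓ₑ b' =ₑ b ⊓ₑ
    Form.lt d' (.add (.sub NE B) (.const 1))) ⊔ₑ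
  (κ =ₑ .const 2 ⊓ₑ κ' =ₑ .const 0 ⊓ₑ e ⊓ₑ b' =ₑ .const 0 ⊓ₑ d' =ₑ .const 0 ⊓ₑ
    ((Form.lt d b ⊓ₑ B' =ₑ .sub B b ⊓ₑ s' =ₑ s) ⊔ₑ (Form.lt b d ⊓ₑ B' =ₑ gain d ⊓ₑ s' =ₑ s) ⊔ₑ
      (b =ₑ d ⊓ₑ s =ₑ .const 0 ⊓ₑ B' =ₑ .sub B b ⊓ₑ s' =ₑ .const 1) ⊔ₑ
      (b =ₑ d ⊓ₑ s =ₑ .const 1 ⊓ₑ B' =ₑ gain b ⊓ₑ s' =ₑ .const 0))) ⊔ₑ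
  (κ =ₑ .const 2 ⊓ₑ κ' =ₑ .const 3 ⊓ₑ b =ₑ d ⊓ₑ v' =ₑ v ⊓ₑ B' =ₑ B ⊓ₑ s' =ₑ s ⊓ₑ b' =ₑ b ⊓ₑ
    d' =ₑ d) ⊔ₑ
  (κ =ₑ .const 3 ⊓ₑ κ' =ₑ .const 0 ⊓ₑ e ⊓ₑ b' =ₑ .const 0 ⊓ₑ d' =ₑ .const 0 ⊓ₑ
    ((s =ₑ .const 0 ⊓ₑ B' =ₑ gain b) ⊔ₑ (s =ₑ .const 1 ⊓ₑ B' =ₑ .sub B b)) ⊓ₑ s' =ₑ s)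

/-- The formula for `NodeOwnerTwo`. -/
def nodeOwnerForm : Form :=
  let κ := Expr.var 0; let s := Expr.var 3; let b := Expr.var 4; let d := Expr.var 5
  κ =ₑ .const 1 ⊔ₑ (κ =ₑ .const 2 ⊓ₑ (Form.lt b d ⊔ₑ (b =ₑ d ⊓ₑ s =ₑ .const 1))) ⊔ₑ
    (κ =ₑ .const 3 ⊓ₑ s =ₑ .const 0)

/-- The generator of the encoding of `BidInstance.toTB`. -/
def toTBGen (k : Objective) : Gen :=
  let n := Expr.input (.const 0)
  let N := Expr.input (.const 1)
  let N' := Expr.add N (.const 1)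
  let m := Expr.mul N' N'
  .seq (.emit (.mul (.const 4) (.mul n (.mul N' (.mul (.const 2) m))))) <|
  .seq (.emit (.add (.mul m (.input (.const 5))) <| .add (.mul (.mul (.const 2) m)
    (.input (.const 3))) (.mul (.mul N' (.mul (.const 2) m)) (.input (.const 2))))) <|
  .seq (nodeLoops n N (.emit nodeOwnerForm.toExpr)) <|
  .seq (nodeLoops n N (nodeLoops n N (.emit (nodeEdgeForm n N).toExpr))) <|
  condGen (nodeLoops n N) n (.add (.const 6) (.mul n n)) (.const 1) (.var 1) (.const 0) k

theorem toTBGen_closed (k : Objective) : (toTBGen k).Closed 0 := by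
  cases k <;> simp [toTBGen, condGen, nodeLoops, nodeOwnerForm, nodeEdgeForm, Gen.Closed,
    Expr.Closed, Form.toExpr, Expr.ite]

theorem nodeEnv_zero {n N : ℕ} (env : ℕ → ℕ) (x : Node n N) : nodeEnv 0 env x 0 = x.1 ∧
    nodeEnv 0 env x 1 = x.2.1 ∧ nodeEnv 0 env x 2 = x.2.2.1 ∧ nodeEnv 0 env x 3 = x.2.2.2.1 ∧
    nodeEnv 0 env x 4 = x.2.2.2.2.1 ∧ nodeEnv 0 env x 5 = x.2.2.2.2.2 := by
  simp [nodeEnv]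

theorem nodeEnv_six {n N : ℕ} (env : ℕ → ℕ) (y : Node n N) : nodeEnv 6 env y 6 = y.1 ∧
    nodeEnv 6 env y 7 = y.2.1 ∧ nodeEnv 6 env y 8 = y.2.2.1 ∧ nodeEnv 6 env y 9 = y.2.2.2.1 ∧
    nodeEnv 6 env y 10 = y.2.2.2.2.1 ∧ nodeEnv 6 env y 11 = y.2.2.2.2.2 := by
  simp [nodeEnv]

theorem nodeEnv_six_of_lt {n N i : ℕ} (env : ℕ → ℕ) (y : Node n N) (hi : i < 6) :
    nodeEnv 6 env y i = env i := by
  simp only [nodeEnv, update_apply]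
  repeat rw [if_neg (by omega)]

theorem BidInstance.getD_edge {k : Objective} (x : BidInstance k) (v u : Fin x.n) :
    x.nats.getD (6 + (v * x.n + u)) 0 = bit (x.edge v u = true) := by
  have h1 := getD_append_add [x.n, x.N, (x.start.vertex : ℕ), x.start.budget .one,
    x.start.budget .two, bit (x.start.adv = .two)] (edgeNats x.edge ++ x.cond.nats) (v * x.n + u)
  have hlt : (v : ℕ) * x.n + u < x.n * x.n := by
    have h1 := v.isLt
    have h2 := u.isLt
    nlinarith
  rw [← List.append_assoc] at h1
  refine Eq.trans h1 ?_
  rw [getD_append_of_lt (by simpa using hlt), getD_edgeNats]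

theorem bit_eq_one {p : Prop} [Decidable p] : bit p = 1 ↔ p := by
  unfold bit
  split_ifs with h <;> simp [h]

theorem holds_nodeEdgeForm {k : Objective} (x : BidInstance k) (env : ℕ → ℕ)
    (y z : Node x.n x.N) : (nodeEdgeForm (.input (.const 0)) (.input (.const 1))).Holds x.nats
      (nodeEnv 6 (nodeEnv 0 env y) z) ↔ x.Edge y z := by
  have hn : x.nats.getD 0 0 = x.n := rfl
  have hN : x.nats.getD 1 0 = x.N := rfl
  obtain ⟨h0, h1, h2, h3, h4, h5⟩ := nodeEnv_zero env y
  obtain ⟨h6, h7, h8, h9, h10, h11⟩ := nodeEnv_six (nodeEnv 0 env y) z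
  have hlt : ∀ i < 6, nodeEnv 6 (nodeEnv 0 env y) z i = nodeEnv 0 env y i := fun i hi =>
    nodeEnv_six_of_lt _ z hi
  rw [← hlt _ (by omega)] at h0 h1 h2 h3 h4 h5
  simp only [nodeEdgeForm, Form.Holds, Expr.eval, h0, h1, h2, h3, h4, h5, h6, h7, h8, h9, h10, h11,
    hn, hN, x.getD_edge, bit_eq_one, Nat.lt_succ_iff, BiddingGame.Edge, NodeEdge]

theorem holds_nodeOwnerForm {n N : ℕ} (L : List ℕ) (env : ℕ → ℕ) (y : Node n N) :
    nodeOwnerForm.Holds L (nodeEnv 0 env y) ↔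
      NodeOwnerTwo y.1 y.2.2.2.1 y.2.2.2.2.1 y.2.2.2.2.2 := by
  obtain ⟨h0, h1, h2, h3, h4, h5⟩ := nodeEnv_zero env y
  simp only [nodeOwnerForm, Form.Holds, Expr.eval, h0, h3, h4, h5, NodeOwnerTwo]

/-- The number of a node, in terms of which the initial vertex is generated. -/
theorem nodeEquiv_val {n N : ℕ} (x : Node n N) : (nodeEquiv n N x : ℕ) =
    ((((((x.2.2.2.2.2 + (N + 1) * x.2.2.2.2.1) + (N + 1) * (N + 1) * x.2.2.2.1) +
      2 * ((N + 1) * (N + 1)) * x.2.2.1) + (N + 1) * (2 * ((N + 1) * (N + 1))) * x.2.1) +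
      n * ((N + 1) * (2 * ((N + 1) * (N + 1)))) * x.1 : ℕ)) := rfl

theorem sinkIndex_eq_bit (i : Player) : (sinkIndex i : ℕ) = bit (i = .two) := by
  cases i <;> rfl

/-- The generator lists the encoding of the constructed turn-based game. -/
theorem eval_toTBGen {k : Objective} (x : BidInstance k) :
    (toTBGen k).eval x.nats 0 (fun _ => 0) = x.toTB.nats := by
  have hn : ∀ env, (Expr.input (.const 0)).eval x.nats env = x.n := fun _ => rfl
  have hN : ∀ env, (Expr.input (.const 1)).eval x.nats env = x.N := fun _ => rfl
  have hloops : ∀ e : Expr, (nodeLoops (.input (.const 0)) (.input (.const 1)) (.emit e)).eval x.nats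
      0 (fun _ => 0) = tableNats fun q : Fin (nodeCount x.n x.N) =>
        e.eval x.nats (nodeEnv 0 (fun _ => 0) ((nodeEquiv _ _).symm q)) := by
    intro e
    rw [eval_nodeLoops hn hN, tableNats_eq_flatMap]
    rfl
  have howner : (nodeLoops (.input (.const 0)) (.input (.const 1))
      (.emit nodeOwnerForm.toExpr)).eval x.nats 0 (fun _ => 0) =
      tableNats fun q => bit (x.toTB.owner q = .two) := by
    rw [hloops]
    refine congrArg tableNats (funext fun q => ?_)
    refine Form.eval_toExpr_eq_bit ((holds_nodeOwnerForm _ _ _).trans ?_)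
    show _ ↔ x.nodeOwner ((nodeEquiv _ _).symm q) = .two
    unfold BiddingGame.nodeOwner
    split_ifs with h <;> simp [h]
  have hedge : (nodeLoops (.input (.const 0)) (.input (.const 1))
      (nodeLoops (.input (.const 0)) (.input (.const 1)) (.emit
        (nodeEdgeForm (.input (.const 0)) (.input (.const 1))).toExpr))).eval x.nats
      0 (fun _ => 0) = edgeNats x.toTB.edge := by
    rw [eval_nodeLoops hn hN, edgeNats]
    refine congrArg (fun f => (List.finRange (nodeCount x.n x.N)).flatMap f) (funext fun q => ?_)
    rw [eval_nodeLoops hn hN, tableNats_eq_flatMap]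
    refine congrArg (fun f => (List.finRange (nodeCount x.n x.N)).flatMap f) (funext fun q' => ?_)
    refine congrArg (fun m => [m]) (Form.eval_toExpr_eq_bit ((holds_nodeEdgeForm x _ _ _).trans ?_))
    exact decide_eq_true_iff.symm
  have hO : ∀ env, (Expr.add (.const 6) (.mul (.input (.const 0)) (.input (.const 0)))).eval x.nats
      env = ([x.n, x.N, (x.start.vertex : ℕ), x.start.budget .one, x.start.budget .two,
        bit (x.start.adv = .two)] ++ edgeNats x.edge).length := by
    intro env
    rw [List.length_append, length_edgeNats]
    rfl
  have hlab : ∀ q : Fin (nodeCount x.n x.N), Sum.elim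
      (fun v : Fin x.n => (Expr.const 1).eval x.nats (nodeEnv 0 (fun _ => 0)
        ((nodeEquiv _ _).symm q)) = 1 ∧ (Expr.var 1).eval x.nats (nodeEnv 0 (fun _ => 0)
        ((nodeEquiv _ _).symm q)) = v)
      (fun i => (Expr.const 1).eval x.nats (nodeEnv 0 (fun _ => 0)
        ((nodeEquiv _ _).symm q)) = 0 ∧ (Expr.const 0).eval x.nats (nodeEnv 0 (fun _ => 0)
        ((nodeEquiv _ _).symm q)) = sinkIndex i)
      (Sum.inl ((nodeEquiv x.n x.N).symm q).2.1) := fun q =>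
    ⟨rfl, (nodeEnv_zero (fun _ => 0) ((nodeEquiv x.n x.N).symm q)).2.1⟩
  have hcond := eval_condGen (L := x.nats) x.cond rfl hO hn hloops hlab
  have hcount : (Expr.mul (.const 4) (.mul (.input (.const 0))
      (.mul (.add (.input (.const 1)) (.const 1)) (.mul (.const 2)
        (.mul (.add (.input (.const 1)) (.const 1)) (.add (.input (.const 1)) (.const 1))))))).eval
      x.nats (fun _ => 0) = x.toTB.n := rfl
  have hstart : (x.toTB.start : ℕ) = (x.N + 1) * (x.N + 1) * bit (x.start.adv = .two) +
      (2 * ((x.N + 1) * (x.N + 1)) * x.start.budget .one +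
        (x.N + 1) * (2 * ((x.N + 1) * (x.N + 1))) * x.start.vertex) := by
    refine (nodeEquiv_val (BiddingGame.embed (.conf x.start))).trans ?_
    rw [← sinkIndex_eq_bit]
    show 0 + (x.N + 1) * 0 + (x.N + 1) * (x.N + 1) * (sinkIndex x.start.adv : ℕ) +
      2 * ((x.N + 1) * (x.N + 1)) * x.start.budget .one +
      (x.N + 1) * (2 * ((x.N + 1) * (x.N + 1))) * (x.start.vertex : ℕ) +
      x.n * ((x.N + 1) * (2 * ((x.N + 1) * (x.N + 1)))) * 0 = _
    ring
  have hnats : x.toTB.nats = [x.toTB.n] ++ ([(x.toTB.start : ℕ)] ++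
      ((tableNats fun q => bit (x.toTB.owner q = .two)) ++ (edgeNats x.toTB.edge ++
        x.toTB.cond.nats))) := by
    simp only [TBInstance.nats, List.cons_append, List.nil_append, List.append_assoc]
  rw [hnats, hstart]
  show [_] ++ ([_] ++ (_ ++ (_ ++ _))) = _
  rw [howner, hedge, hcond, hcount]
  rfl

end BidGame

namespace BidGame

open StackProg Function

/-- Nested loops over the places. -/
def placeLoops (nE : Expr) (g : Gen) : Gen := .loop (.add nE (.const 1)) (.loop (.const 2) g)

/-- The values of the loop variables in the round for a given place. -/
def placeEnv {n : ℕ} (d : ℕ) (env : ℕ → ℕ) (p : Place n) : ℕ → ℕ :=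
  update (update env d (finSuccEquivLast.symm p.1 : ℕ)) (d + 1) (sinkIndex p.2)

theorem eval_placeLoops {n d : ℕ} {L : List ℕ} {env : ℕ → ℕ} {nE : Expr} {g : Gen}
    (hn : ∀ env, nE.eval L env = n) :
    (placeLoops nE g).eval L d env = (List.finRange ((n + 1) * 2)).flatMap fun q =>
      g.eval L (d + 2) (placeEnv d env ((placeEquiv n).symm q)) := by
  rw [finRange_flatMap_symm (placeEquiv n) fun p => g.eval L (d + 2) (placeEnv d env p), placeEquiv,
    enumerate_prod]
  simp only [enumerate, List.flatMap_map]
  refine Gen.eval_loop (by simp only [Expr.eval, hn]) fun v => ?_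
  refine Gen.eval_loop rfl fun i => ?_
  have hi : sinkIndex (playerEquiv.symm i) = i := playerEquiv.apply_symm_apply i
  simp only [placeEnv, Equiv.symm_symm, Equiv.symm_apply_apply, hi]

/-- The formula for `TurnBasedGame.PlaceEdge`, for the places that are given by the variables `0`,
`1` and `2`, `3`. -/
def placeEdgeForm (nE : Expr) : Form :=
  let v := Expr.var 0; let i := Expr.var 1; let u := Expr.var 2; let j := Expr.var 3
  let o := Expr.input (.add (.const 2) v)
  let e := Expr.input (.add (.const 2) (.add nE (.add (.mul v nE) u)))
  let alternate := Form.eq (.add i j) (.const 1)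
  .or (.and (.lt v nE) <| .and (.lt u nE) <| .and alternate <|
    .or (.and (.eq o i) (.eq e (.const 1))) (.and (.eq (.add o i) (.const 1)) (.eq u v))) <|
  .or (.and (.lt v nE) <| .and (.eq u nE) alternate) <|
  .and (.eq v nE) <| .and (.eq u nE) (.eq j i)

/-- The generator of the encoding of `TBInstance.toBid`. -/
def toBidGen (k : Objective) : Gen :=
  let n := Expr.input (.const 0)
  .seq (.emit (.mul (.add n (.const 1)) (.const 2))) <|
  .seq (.emit (.const 0)) <|
  .seq (.emit (.mul (.const 2) (.input (.const 1)))) <|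
  .seq (.emit (.const 0)) <| .seq (.emit (.const 0)) <| .seq (.emit (.const 0)) <|
  .seq (placeLoops n (placeLoops n (.emit (placeEdgeForm n).toExpr))) <|
  condGen (placeLoops n) n (.add (.const 2) (.add n (.mul n n))) (Form.lt (.var 0) n).toExpr
    (.var 0) (.var 1) k

theorem toBidGen_closed (k : Objective) : (toBidGen k).Closed 0 := by
  cases k <;> simp [toBidGen, condGen, placeLoops, placeEdgeForm, Gen.Closed, Expr.Closed,
    Form.toExpr, Expr.ite]

theorem placeEnv_zero {n : ℕ} (env : ℕ → ℕ) (p : Place n) :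
    placeEnv 0 env p 0 = (finSuccEquivLast.symm p.1 : ℕ) ∧ placeEnv 0 env p 1 = sinkIndex p.2 := by
  simp [placeEnv]

theorem placeEnv_two {n : ℕ} (env : ℕ → ℕ) (p : Place n) :
    placeEnv 2 env p 0 = env 0 ∧ placeEnv 2 env p 1 = env 1 ∧
    placeEnv 2 env p 2 = (finSuccEquivLast.symm p.1 : ℕ) ∧ placeEnv 2 env p 3 = sinkIndex p.2 := by
  simp [placeEnv]

/-- The position of the owners in the encoding. -/
theorem TBInstance.getD_owner {k : Objective} (x : TBInstance k) (v : Fin x.n) :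
    x.nats.getD (2 + v) 0 = sinkIndex (x.owner v) := by
  rw [sinkIndex_eq_bit]
  have h1 := getD_append_add [x.n, (x.start : ℕ)] ((tableNats fun v => bit (x.owner v = .two)) ++
    (edgeNats x.edge ++ x.cond.nats)) v
  have h2 : x.nats = [x.n, (x.start : ℕ)] ++ ((tableNats fun v => bit (x.owner v = .two)) ++
      (edgeNats x.edge ++ x.cond.nats)) := by
    simp only [TBInstance.nats, List.append_assoc]
  rw [h2]
  refine h1.trans ?_
  rw [getD_append_of_lt (by simp), getD_tableNats]

/-- The position of the adjacency matrix in the encoding. -/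
theorem TBInstance.getD_edge {k : Objective} (x : TBInstance k) (v u : Fin x.n) :
    x.nats.getD (2 + (x.n + (v * x.n + u))) 0 = bit (x.edge v u = true) := by
  have hlt : (v : ℕ) * x.n + u < x.n * x.n := by
    have h1 := v.isLt
    have h2 := u.isLt
    nlinarith
  have h1 := getD_append_add ([x.n, (x.start : ℕ)] ++ tableNats fun v => bit (x.owner v = .two))
    (edgeNats x.edge ++ x.cond.nats) (v * x.n + u)
  have h2 : x.nats = [x.n, (x.start : ℕ)] ++ (tableNats fun v => bit (x.owner v = .two)) ++
      (edgeNats x.edge ++ x.cond.nats) := by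
    simp only [TBInstance.nats, List.append_assoc]
  rw [List.length_append, length_tableNats, add_assoc] at h1
  rw [h2]
  refine h1.trans ?_
  rw [getD_append_of_lt (by simpa using hlt), getD_edgeNats]

theorem holds_placeEdgeForm {k : Objective} (x : TBInstance k) (env : ℕ → ℕ) (p q : Place x.n) :
    (placeEdgeForm (.input (.const 0))).Holds x.nats (placeEnv 2 (placeEnv 0 env p) q) ↔
      x.PlaceEdge p q := by
  have hn : x.nats.getD 0 0 = x.n := rfl
  obtain ⟨h0, h1⟩ := placeEnv_zero env p
  obtain ⟨h0', h1', h2, h3⟩ := placeEnv_two (placeEnv 0 env p) q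
  rw [h0] at h0'
  rw [h1] at h1'
  have halt : ∀ i j : Player, (sinkIndex i : ℕ) + sinkIndex j = 1 ↔ j = i.other := by
    intro i j
    cases i <;> cases j <;> simp [sinkIndex, Player.other]
  have hinj : ∀ i j : Player, (sinkIndex i : ℕ) = sinkIndex j ↔ i = j := fun i j =>
    Fin.val_inj.trans sinkIndex_injective.eq_iff
  simp only [placeEdgeForm, Form.Holds, Expr.eval, h0', h1', h2, h3, hn, halt]
  rcases p with ⟨_ | v, i⟩ <;> rcases q with ⟨_ | u, j⟩
  · simp [TurnBasedGame.PlaceEdge, hinj]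
  · simp [TurnBasedGame.PlaceEdge, u.isLt.ne]
  · simp [TurnBasedGame.PlaceEdge, v.isLt.ne]
  · simp only [finSuccEquivLast_symm_some, Fin.val_castSucc, v.isLt, u.isLt, v.isLt.ne, u.isLt.ne,
      x.getD_owner, x.getD_edge, hinj, halt, bit_eq_one, Fin.val_inj, true_and, false_and, or_false,
      and_false, TurnBasedGame.PlaceEdge]
    refine and_congr_right fun _ => ?_
    by_cases ho : x.owner v = i
    · rw [if_pos ho]
      simp [ho, i.other_ne.symm]
    · rw [if_neg ho]
      have : i = (x.owner v).other := (Player.eq_or_eq_other _ _).resolve_left (Ne.symm ho)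
      simp [this, (Player.other_ne _).symm]

theorem placeEquiv_val {n : ℕ} (p : Place n) :
    (placeEquiv n p : ℕ) = sinkIndex p.2 + 2 * (finSuccEquivLast.symm p.1 : ℕ) :=
  rfl

/-- The generator lists the encoding of the constructed bidding game. -/
theorem eval_toBidGen {k : Objective} (x : TBInstance k) :
    (toBidGen k).eval x.nats 0 (fun _ => 0) = x.toBid.nats := by
  have hn : ∀ env, (Expr.input (.const 0)).eval x.nats env = x.n := fun _ => rfl
  have hloops : ∀ e : Expr, (placeLoops (.input (.const 0)) (.emit e)).eval x.nats
      0 (fun _ => 0) = tableNats fun q : Fin ((x.n + 1) * 2) =>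
        e.eval x.nats (placeEnv 0 (fun _ => 0) ((placeEquiv _).symm q)) := by
    intro e
    rw [eval_placeLoops hn, tableNats_eq_flatMap]
    rfl
  have hedge : (placeLoops (.input (.const 0)) (placeLoops (.input (.const 0)) (.emit
        (placeEdgeForm (.input (.const 0))).toExpr))).eval x.nats
      0 (fun _ => 0) = edgeNats x.toBid.edge := by
    rw [eval_placeLoops hn, edgeNats]
    refine congrArg (fun f => (List.finRange ((x.n + 1) * 2)).flatMap f) (funext fun q => ?_)
    rw [eval_placeLoops hn, tableNats_eq_flatMap]
    refine congrArg (fun f => (List.finRange ((x.n + 1) * 2)).flatMap f) (funext fun q' => ?_)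
    refine congrArg (fun m => [m]) (Form.eval_toExpr_eq_bit
      ((holds_placeEdgeForm x _ _ _).trans ?_))
    exact decide_eq_true_iff.symm
  have hO : ∀ env, (Expr.add (.const 2) (.add (.input (.const 0)) (.mul (.input (.const 0))
      (.input (.const 0))))).eval x.nats env = ([x.n, (x.start : ℕ)] ++
        (tableNats fun v => bit (x.owner v = .two)) ++ edgeNats x.edge).length := by
    intro env
    rw [List.length_append, List.length_append, length_edgeNats, length_tableNats, add_assoc]
    rfl
  have hlab : ∀ q : Fin ((x.n + 1) * 2), Sum.elim
      (fun v : Fin x.n => (Form.lt (.var 0) (.input (.const 0))).toExpr.eval x.nats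
        (placeEnv 0 (fun _ => 0) ((placeEquiv _).symm q)) = 1 ∧ (Expr.var 0).eval x.nats
        (placeEnv 0 (fun _ => 0) ((placeEquiv _).symm q)) = v)
      (fun i => (Form.lt (.var 0) (.input (.const 0))).toExpr.eval x.nats
        (placeEnv 0 (fun _ => 0) ((placeEquiv _).symm q)) = 0 ∧ (Expr.var 1).eval x.nats
        (placeEnv 0 (fun _ => 0) ((placeEquiv _).symm q)) = sinkIndex i)
      ((placeEquiv x.n).symm q).label := by
    intro q
    obtain ⟨h0, h1⟩ := placeEnv_zero (fun _ => 0) ((placeEquiv x.n).symm q)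
    have hev := Form.eval_toExpr x.nats (placeEnv 0 (fun _ => 0) ((placeEquiv x.n).symm q))
      (.lt (.var 0) (.input (.const 0)))
    simp only [Form.Holds, Expr.eval, h0] at hev
    rcases hp : (placeEquiv x.n).symm q with ⟨_ | v, i⟩
    · rw [hp] at hev h1
      exact ⟨hev.2 (by
        rw [show x.nats.getD 0 0 = x.n from rfl]
        simp), h1⟩
    · rw [hp] at hev h0
      exact ⟨hev.1 (by
        rw [show x.nats.getD 0 0 = x.n from rfl]
        simp), h0.trans (by simp)⟩
  have hcond := eval_condGen (L := x.nats) x.cond rfl hO hn hloops hlab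
  have hstart : (x.toBid.start.vertex : ℕ) = 2 * x.start := by
    refine (placeEquiv_val (some x.start, .one)).trans ?_
    simp [sinkIndex]
  show [_] ++ ([_] ++ ([_] ++ ([_] ++ ([_] ++ ([_] ++ (_ ++ _)))))) = _
  rw [hedge, hcond]
  have hnats : x.toBid.nats = [x.toBid.n] ++ ([x.toBid.N] ++ ([(x.toBid.start.vertex : ℕ)] ++
      ([x.toBid.start.budget .one] ++ ([x.toBid.start.budget .two] ++
        ([bit (x.toBid.start.adv = .two)] ++ (edgeNats x.toBid.edge ++ x.toBid.cond.nats)))))) := by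
    simp only [BidInstance.nats, List.cons_append, List.nil_append]
  rw [hnats, hstart]
  rfl

end BidGame

theorem mainTheorem7 (k : BidGame.Objective) :
    (∃ f : BidGame.BidInstance k → BidGame.TBInstance k,
      BidGame.IsPolyTimeReduction BidGame.BidInstance.encode BidGame.TBInstance.encode
        BidGame.BidWin BidGame.TBWin f) ∧
    (∃ g : BidGame.TBInstance k → BidGame.BidInstance k,
      BidGame.IsPolyTimeReduction BidGame.TBInstance.encode BidGame.BidInstance.encode
        BidGame.TBWin BidGame.BidWin g ∧
      ∀ x, BidGame.ForcesAdvantage (g x)) := by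
  refine ⟨⟨BidGame.BidInstance.toTB, ?_, BidGame.BidInstance.bidWin_iff⟩,
    BidGame.TBInstance.toBid, ⟨?_, BidGame.TBInstance.tbWin_iff⟩,
    BidGame.TBInstance.forcesAdvantage_toBid⟩
  · exact StackProg.polyTime_of_gen (BidGame.toTBGen k) (BidGame.toTBGen_closed k)
      BidGame.BidInstance.nats (fun _ => rfl)
      fun x => congrArg BidGame.unary (BidGame.eval_toTBGen x).symm
  · exact StackProg.polyTime_of_gen (BidGame.toBidGen k) (BidGame.toBidGen_closed k)
      BidGame.TBInstance.nats (fun _ => rfl)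
      fun x => congrArg BidGame.unary (BidGame.eval_toBidGen x).symm
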